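/- **Conventions.** A *metric measure space* $(X,d,\mu)$ is a proper metric space with a Borel measure for which all balls have positive and finite measure. Curves are continuous maps $\gamma:[0,1]\to X$, with length $\ell(\gamma)$; $\int_\gamma g$ is the integral of the Borel function $g:X\to[0,\infty]$ along the arc length parametrization of $\gamma$ if $\ell(\gamma)<\infty$, and $\infty$ otherwise. For a family $\Gamma$ of curves, $\operatorname{Mod}_p\Gamma=\inf\int_X\rho^p\,d\mu$ over all Borel $\rho:X\to[0,\infty]$ with $\int_\gamma\rho\ge 1$ for all $\gamma\in\Gamma$. A Borel function $g:X\to[0,\infty]$ is an upper gradient (a $p$-weak upper gradient) of $u:X\to Y$ if $d(u(\gamma(1)),u(\gamma(0)))\le\int_\gamma g$ for every curve $\gamma$ (for every $\gamma$ outside a family $\Gamma_0$ with $\operatorname{Mod}_p\Gamma_0=0$). $N^{1,p}(X)$ consists of the functions $f\in L^p(X)$ with an upper gradient in $L^p(X)$; $u\in N^{1,p}_{\mathrm{loc}}(X,Y)$ means that $u$ is $\mu$-measurable and every point of $X$ has an open neighbourhood $U$ on which the distance of $u$ to some point of $Y$ is $p$-integrable and $u|_U$ has a $p$-integrable upper gradient.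 The minimal $p$-weak upper gradient $g_u$ is the $p$-weak upper gradient in $L^p_{\mathrm{loc}}$ that is, $\mu$-almost everywhere, at most every other one. A metric measure space has the *$Q$-Sobolev-to-Lipschitz property* if every $f\in N^{1,Q}$ whose minimal $Q$-weak upper gradient satisfies $g_f\le 1$ almost everywhere agrees almost everywhere with a $1$-Lipschitz function. A Borel map $v:(X,\mu)\to(Z,\lambda)$ has *Jacobian* $J$, where $J:X\to[0,\infty]$ is Borel, if $$\int_E J\,d\mu=\int_Z\#(v^{-1}(z)\cap E)\,d\lambda(z)\qquad\text{for every Borel set }E\subset X .$$ **Setting.** Let $Q\ge 1$ and let $(X,d,\mu)$ be a doubling metric measure space such that, for some $C>0$, $C(\operatorname{diam}B/\operatorname{diam}B')^Q\le\mu(B)/\mu(B')$ for all balls $B\subset B'$ in $X$, and which supports a weak $(1,Q)$-Poincaré inequality: there are $C,\sigma\ge1$ with $$\frac1{\mu(B)}\int_B|w-w_B|\,d\mu\le C\operatorname{diam}B\,\Big(\frac1{\mu(\sigma B)}\int_{\sigma B}g^Q\,d\mu\Big)^{1/Q}$$ for every ball $B$, every $w\in L^1_{\mathrm{loc}}(X)$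 and every upper gradient $g$ of $w$, where $w_B$ is the mean of $w$ over $B$. Let $(Y,d,\nu)$ be a metric measure space, let $p>Q$, and let $u\in N^{1,p}_{\mathrm{loc}}(X,Y)$ be continuous. For $x,y\in X$ put $$d_u'(x,y)=\lim_{\delta\to0}\ \sup_{\operatorname{Mod}_Q\Gamma_0=0}\ \inf\{\ell(u\circ\gamma):\gamma\in\Gamma_\delta(x,y)\setminus\Gamma_0\}\in[0,\infty],$$ where $\Gamma_\delta(x,y)$ is the family of Lipschitz curves $\gamma$ in $X$ with $\gamma(0)\in\bar B(x,\delta)$ and $\gamma(1)\in\bar B(y,\delta)$, and $\inf\varnothing=\infty$. **Theorem.** Assume that $u$ is proper (preimages of compact sets are compact), nonconstant, and has a locally integrable Jacobian $Ju$ such that, for some $K\ge1$, $g_u^Q\le K\,Ju$ holds $\mu$-almost everywhere. Then $d_u'$ is a finite-valued pseudometric on $X$. Let $(Y_u,d_u)$ be the metric space of the classes $[x]$ of points $x\in X$ with respect to the relation $d'_u(x,y)=0$, with $d_u([x],[y])=d_u'(x,y)$; let $\widehat P_u:X\to Y_u$, $x\mapsto[x]$, and let $\widehat u:Y_u\to Y$,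 $[x]\mapsto u(x)$, which is well defined. There is a (unique) Borel measure $\nu_u$ on $Y_u$ with $$\nu_u(E)=\int_Y\#(\widehat u^{-1}(y)\cap E)\,d\nu(y)\qquad\text{for every Borel set }E\subset Y_u,$$ and the following hold. 1. $(Y_u,d_u,\nu_u)$ is a metric measure space and has the $Q$-Sobolev-to-Lipschitz property. 2. $Ju$ is the locally integrable Jacobian of $\widehat P_u:(X,\mu)\to(Y_u,\nu_u)$, and $\#\widehat P_u^{-1}(z)=1$ for $\nu_u$-almost every $z\in Y_u$. -/

import Mathlib

open Set Filter Topology MeasureTheory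
open scoped ENNReal NNReal

namespace EssPullback

noncomputable section

/-! ## Metric measure spaces -/

/-- A proper metric space with a Borel measure for which all open balls have positive and finite
measure. -/
structure IsMetricMeasureSpace {X : Type*} [MetricSpace X] [MeasurableSpace X] [BorelSpace X]
    (μ : Measure X) : Prop where
  proper : ProperSpace X
  ball_pos : ∀ (x : X) (r : ℝ), 0 < r → 0 < μ (Metric.ball x r)
  ball_lt_top : ∀ (x : X) (r : ℝ), 0 < r → μ (Metric.ball x r) < ∞

/-- `μ(B(x,2r)) ≤ C μ(B(x,r))` for all `x` and all `0 < r < diam X`. -/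
def IsDoubling {X : Type*} [MetricSpace X] [MeasurableSpace X] (μ : Measure X) : Prop :=
  ∃ C : ℝ≥0, ∀ (x : X) (r : ℝ), 0 < r → ENNReal.ofReal r < Metric.ediam (univ : Set X) →
    μ (Metric.ball x (2 * r)) ≤ C * μ (Metric.ball x r)

/-- `C (diam B / diam B')^Q ≤ μ(B) / μ(B')` for all balls `B ⊆ B'`. -/
def RelativeVolumeLowerBound {X : Type*} [MetricSpace X] [MeasurableSpace X] (μ : Measure X)
    (Q : ℝ) : Prop :=
  ∃ C : ℝ, 0 < C ∧ ∀ (x x' : X) (r r' : ℝ), 0 < r → 0 < r' →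
    Metric.ball x r ⊆ Metric.ball x' r' →
    C * (Metric.diam (Metric.ball x r) / Metric.diam (Metric.ball x' r')) ^ Q ≤
      (μ (Metric.ball x r)).toReal / (μ (Metric.ball x' r')).toReal

/-! ## Curves, line integrals and modulus -/

/-- Continuous curves `[0,1] → X`. -/
abbrev Curve (X : Type*) [TopologicalSpace X] := C(unitInterval, X)

/-- The length of a map `[0,1] → X`. -/
def curveLength {X : Type*} [PseudoEMetricSpace X] (γ : unitInterval → X) : ℝ≥0∞ :=
  eVariationOn γ univ

/-- The line integral `∫_γ g = ∫_0^{ℓ(γ)} g(γ_s(t)) dt`, with `γ_s` the arc length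
parametrization, if `γ` is rectifiable, and `∞` otherwise. -/
def lineIntegral {X : Type*} [MetricSpace X] (g : X → ℝ≥0∞) (γ : Curve X) : ℝ≥0∞ :=
  open Classical in
  if curveLength γ = ∞ then ∞
  else ∫⁻ t in Icc (0 : ℝ) (curveLength γ).toReal, g (naturalParameterization γ univ 0 t)

/-- The `p`-modulus of a family of curves. -/
def modulus {X : Type*} [MetricSpace X] [MeasurableSpace X] (μ : Measure X) (p : ℝ)
    (Γ : Set (Curve X)) : ℝ≥0∞ :=
  ⨅ (ρ : X → ℝ≥0∞) (_ : Measurable ρ) (_ : ∀ γ ∈ Γ, 1 ≤ lineIntegral ρ γ), ∫⁻ x, ρ x ^ p ∂μ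

/-! ## Upper gradients and Newtonian spaces -/

/-- The upper gradient inequality along one curve. -/
def UpperGradientAlong {X Y : Type*} [MetricSpace X] [MetricSpace Y] (u : X → Y)
    (g : X → ℝ≥0∞) (γ : Curve X) : Prop :=
  edist (u (γ 1)) (u (γ 0)) ≤ lineIntegral g γ

/-- `g` is a (genuine) upper gradient of `u`. -/
def IsUpperGradient {X Y : Type*} [MetricSpace X] [MeasurableSpace X] [MetricSpace Y]
    (u : X → Y) (g : X → ℝ≥0∞) : Prop :=
  Measurable g ∧ ∀ γ : Curve X, UpperGradientAlong u g γ

/-- `g` is a `p`-weak upper gradient of `u`. -/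
def IsWeakUpperGradient {X Y : Type*} [MetricSpace X] [MeasurableSpace X] [MetricSpace Y]
    (μ : Measure X) (p : ℝ) (u : X → Y) (g : X → ℝ≥0∞) : Prop :=
  Measurable g ∧ ∃ Γ₀ : Set (Curve X), modulus μ p Γ₀ = 0 ∧
    ∀ γ, γ ∉ Γ₀ → UpperGradientAlong u g γ

/-- Every point has a neighbourhood on which `∫ g^p` is finite. -/
def LocallyLp {X : Type*} [MetricSpace X] [MeasurableSpace X] (μ : Measure X) (p : ℝ)
    (g : X → ℝ≥0∞) : Prop :=
  ∀ x : X, ∃ U ∈ 𝓝 x, ∫⁻ z in U, g z ^ p ∂μ < ∞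

/-- `g` is the minimal `p`-weak upper gradient `g_u` of `u`: it is the least one, up to null sets,
among the `p`-weak upper gradients in `L^p_loc`. -/
structure IsMinimalWeakUpperGradient {X Y : Type*} [MetricSpace X] [MeasurableSpace X]
    [MetricSpace Y] (μ : Measure X) (p : ℝ) (u : X → Y) (g : X → ℝ≥0∞) : Prop where
  weakUpperGradient : IsWeakUpperGradient μ p u g
  locallyLp : LocallyLp μ p g
  minimal : ∀ h : X → ℝ≥0∞, IsWeakUpperGradient μ p u h → LocallyLp μ p h → ∀ᵐ x ∂μ, g x ≤ h x

/-- `f ∈ N^{1,p}(X)` for a real function `f`. -/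
def IsNewtonian {X : Type*} [MetricSpace X] [MeasurableSpace X] (μ : Measure X) (p : ℝ)
    (f : X → ℝ) : Prop :=
  MemLp f (ENNReal.ofReal p) μ ∧ ∃ g : X → ℝ≥0∞, IsUpperGradient f g ∧ ∫⁻ x, g x ^ p ∂μ < ∞

/-- `u ∈ N^{1,p}_loc(X, Y)`: `u` is measurable, and every point of `X` has an open neighbourhood
`U` on which the distance of `u` to some point is `p`-integrable and on which `u` has a
`p`-integrable upper gradient (tested on the curves in `U`). -/
def IsLocallyNewtonian {X Y : Type*} [MetricSpace X] [MeasurableSpace X] [MetricSpace Y]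
    (μ : Measure X) (p : ℝ) (u : X → Y) : Prop :=
  AEStronglyMeasurable u μ ∧
  ∀ x : X, ∃ U : Set X, IsOpen U ∧ x ∈ U ∧
    (∃ y₀ : Y, ∫⁻ z in U, edist (u z) y₀ ^ p ∂μ < ∞) ∧
    ∃ g : X → ℝ≥0∞, Measurable g ∧ ∫⁻ z in U, g z ^ p ∂μ < ∞ ∧
      ∀ γ : Curve X, range γ ⊆ U → UpperGradientAlong u g γ

/-- `X` supports a (weak `(1,p)`-) Poincaré inequality. -/
def SupportsPoincare {X : Type*} [MetricSpace X] [MeasurableSpace X] (μ : Measure X) (p : ℝ) :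
    Prop :=
  ∃ C σ : ℝ, 1 ≤ C ∧ 1 ≤ σ ∧ ∀ (u : X → ℝ) (g : X → ℝ≥0∞),
    LocallyIntegrable u μ → IsUpperGradient u g → ∀ (x : X) (r : ℝ), 0 < r →
      ⨍⁻ y in Metric.ball x r, ‖u y - ⨍ z in Metric.ball x r, u z ∂μ‖ₑ ∂μ ≤
        ENNReal.ofReal (C * Metric.diam (Metric.ball x r)) *
          (⨍⁻ y in Metric.ball x (σ * r), g y ^ p ∂μ) ^ (1 / p)

/-- The `p`-Sobolev-to-Lipschitz property: every `f ∈ N^{1,p}` with minimal `p`-weak upper gradient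
`g_f ≤ 1` almost everywhere has a `1`-Lipschitz representative. -/
def SobolevToLipschitz {X : Type*} [MetricSpace X] [MeasurableSpace X] (μ : Measure X) (p : ℝ) :
    Prop :=
  ∀ (f : X → ℝ) (g : X → ℝ≥0∞), IsNewtonian μ p f → IsMinimalWeakUpperGradient μ p f g →
    (∀ᵐ x ∂μ, g x ≤ 1) → ∃ f' : X → ℝ, LipschitzWith 1 f' ∧ f =ᵐ[μ] f'

/-! ## The essential pull-back distance -/

/-- The Lipschitz curves `[0,1] → X` that start in `A` and end in `B`. -/
def joiningCurves {X : Type*} [MetricSpace X] (A B : Set X) : Set (Curve X) :=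
  {γ | (∃ L : ℝ≥0, LipschitzWith L γ) ∧ γ 0 ∈ A ∧ γ 1 ∈ B}

/-- The `p`-essential infimum of `F` over a family of curves. -/
def essInfCurves {X : Type*} [MetricSpace X] [MeasurableSpace X] (μ : Measure X) (p : ℝ)
    (F : Curve X → ℝ≥0∞) (Γ : Set (Curve X)) : ℝ≥0∞ :=
  ⨆ (Γ₀ : Set (Curve X)) (_ : modulus μ p Γ₀ = 0), ⨅ γ ∈ Γ \ Γ₀, F γ

/-- `essℓ_{u,p}(Γ)`, the `p`-essential infimum of `γ ↦ ℓ(u ∘ γ)` over `Γ`. -/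
def essLength {X Y : Type*} [MetricSpace X] [MeasurableSpace X] [MetricSpace Y] (μ : Measure X)
    (p : ℝ) (u : X → Y) (Γ : Set (Curve X)) : ℝ≥0∞ :=
  essInfCurves μ p (fun γ => curveLength (u ∘ γ)) Γ

/-- The essential pull-back distance `d'_{u,p}(x,y)`, the limit of `essℓ_{u,p}` of the curves from
the closed `δ`-ball at `x` to the closed `δ`-ball at `y` as `δ → 0`. The quantity is monotone in
`δ`, so that the limit is a supremum; see `tendsto_essLength`. -/
def essDist {X Y : Type*} [MetricSpace X] [MeasurableSpace X] [MetricSpace Y] (μ : Measure X)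
    (p : ℝ) (u : X → Y) (x y : X) : ℝ≥0∞ :=
  ⨆ (δ : ℝ) (_ : 0 < δ),
    essLength μ p u (joiningCurves (Metric.closedBall x δ) (Metric.closedBall y δ))

theorem essLength_anti {X Y : Type*} [MetricSpace X] [MeasurableSpace X] [MetricSpace Y]
    (μ : Measure X) (p : ℝ) (u : X → Y) (x y : X) {δ ε : ℝ} (h : δ ≤ ε) :
    essLength μ p u (joiningCurves (Metric.closedBall x ε) (Metric.closedBall y ε)) ≤
      essLength μ p u (joiningCurves (Metric.closedBall x δ) (Metric.closedBall y δ)) := by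
  refine iSup₂_mono fun Γ₀ _ => ?_
  refine biInf_mono fun γ hγ => ?_
  exact ⟨⟨hγ.1.1, Metric.closedBall_subset_closedBall h hγ.1.2.1,
    Metric.closedBall_subset_closedBall h hγ.1.2.2⟩, hγ.2⟩

theorem tendsto_essLength {X Y : Type*} [MetricSpace X] [MeasurableSpace X] [MetricSpace Y]
    (μ : Measure X) (p : ℝ) (u : X → Y) (x y : X) :
    Tendsto (fun δ : ℝ => essLength μ p u
      (joiningCurves (Metric.closedBall x δ) (Metric.closedBall y δ))) (𝓝[>] 0)
      (𝓝 (essDist μ p u x y)) := by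
  refine tendsto_order.2 ⟨fun a ha => ?_, fun a ha => ?_⟩
  · simp only [essDist, lt_iSup_iff] at ha
    obtain ⟨δ, hδ, h⟩ := ha
    filter_upwards [Ioo_mem_nhdsGT hδ] with ε hε
    exact h.trans_le (essLength_anti μ p u x y hε.2.le)
  · filter_upwards [self_mem_nhdsWithin] with ε hε
    exact lt_of_le_of_lt (le_iSup₂ (f := fun (δ : ℝ) (_ : 0 < δ) => essLength μ p u
      (joiningCurves (Metric.closedBall x δ) (Metric.closedBall y δ))) ε hε) ha

theorem modulus_empty {X : Type*} [MetricSpace X] [MeasurableSpace X] (μ : Measure X) {p : ℝ}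
    (hp : 0 < p) : modulus μ p (∅ : Set (Curve X)) = 0 := by
  refine le_antisymm ?_ bot_le
  refine (iInf_le _ (fun _ => 0)).trans ?_
  simp [hp]

/-- For continuous `u`, the essential pull-back distance dominates the distance of the images. -/
theorem edist_le_essDist {X Y : Type*} [MetricSpace X] [MeasurableSpace X] [MetricSpace Y]
    (μ : Measure X) {p : ℝ} (hp : 0 < p) {u : X → Y} (hu : Continuous u) (x y : X) :
    edist (u x) (u y) ≤ essDist μ p u x y := by
  refine ENNReal.le_of_forall_pos_le_add fun ε hε _ => ?_
  have hε2 : (0 : ℝ) < ε / 2 := by positivity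
  obtain ⟨δ₁, h₁, H₁⟩ := Metric.continuous_iff.1 hu x _ hε2
  obtain ⟨δ₂, h₂, H₂⟩ := Metric.continuous_iff.1 hu y _ hε2
  set δ := min δ₁ δ₂ / 2 with hδ
  have hδ0 : 0 < δ := by positivity
  have hd₁ : δ < δ₁ := by
    have := min_le_left δ₁ δ₂
    linarith
  have hd₂ : δ < δ₂ := by
    have := min_le_right δ₁ δ₂
    linarith
  rw [← tsub_le_iff_right]
  refine le_trans ?_ (le_iSup₂ (f := fun (δ : ℝ) (_ : 0 < δ) => essLength μ p u
      (joiningCurves (Metric.closedBall x δ) (Metric.closedBall y δ))) δ hδ0)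
  refine le_trans ?_ (le_iSup₂ (f := fun (Γ₀ : Set (Curve X)) (_ : modulus μ p Γ₀ = 0) =>
    ⨅ γ ∈ (joiningCurves (Metric.closedBall x δ) (Metric.closedBall y δ)) \ Γ₀,
      curveLength (u ∘ γ)) ∅ (modulus_empty μ hp))
  refine le_iInf₂ fun γ hγ => ?_
  obtain ⟨⟨-, hx, hy⟩, -⟩ := hγ
  have e₁ : edist (u x) (u (γ 0)) ≤ ENNReal.ofReal (ε / 2) := by
    rw [edist_comm, edist_dist]
    exact ENNReal.ofReal_le_ofReal (H₁ _ (lt_of_le_of_lt hx hd₁)).le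
  have e₂ : edist (u (γ 1)) (u y) ≤ ENNReal.ofReal (ε / 2) := by
    rw [edist_dist]
    exact ENNReal.ofReal_le_ofReal (H₂ _ (lt_of_le_of_lt hy hd₂)).le
  have e₃ : edist (u (γ 0)) (u (γ 1)) ≤ curveLength (u ∘ γ) :=
    eVariationOn.edist_le (u ∘ γ) (mem_univ (0 : unitInterval)) (mem_univ 1)
  have e₄ : ENNReal.ofReal (ε / 2) + ENNReal.ofReal (ε / 2) = (ε : ℝ≥0∞) := by
    rw [← ENNReal.ofReal_add hε2.le hε2.le, add_halves, ENNReal.ofReal_coe_nnreal]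
  rw [tsub_le_iff_right]
  calc edist (u x) (u y)
      ≤ edist (u x) (u (γ 0)) + edist (u (γ 0)) (u (γ 1)) + edist (u (γ 1)) (u y) :=
        edist_triangle4 _ _ _ _
    _ ≤ ENNReal.ofReal (ε / 2) + curveLength (u ∘ γ) + ENNReal.ofReal (ε / 2) := by gcongr
    _ = curveLength (u ∘ γ) + ε := by rw [← e₄]; ring

/-! ## The metric space of a finite pseudodistance -/

/-- `D` is a finite-valued pseudometric. -/
structure IsFinitePseudoDist {X : Type*} (D : X → X → ℝ≥0∞) : Prop where
  self : ∀ x, D x x = 0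
  comm : ∀ x y, D x y = D y x
  triangle : ∀ x y z, D x z ≤ D x y + D y z
  ne_top : ∀ x y, D x y ≠ ∞

/-- The set `X`, to be equipped with the pseudometric `D`. -/
def PseudoDistCopy {X : Type*} {D : X → X → ℝ≥0∞} (_h : IsFinitePseudoDist D) : Type _ := X

instance {X : Type*} {D : X → X → ℝ≥0∞} (h : IsFinitePseudoDist D) :
    PseudoMetricSpace (PseudoDistCopy h) where
  dist x y := (D x y).toReal
  dist_self x := by simp [h.self x]
  dist_comm x y := by rw [h.comm x y]
  dist_triangle x y z := by
    rw [← ENNReal.toReal_add (h.ne_top x y) (h.ne_top y z)]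
    exact ENNReal.toReal_mono (ENNReal.add_ne_top.2 ⟨h.ne_top x y, h.ne_top y z⟩)
      (h.triangle x y z)

/-- The set of classes `[x]` of points of `X`, where `x` and `y` are equivalent if `D x y = 0`,
as a metric space with the distance `D`; its Borel σ-algebra is used throughout. -/
def QuotientSpace {X : Type*} {D : X → X → ℝ≥0∞} (h : IsFinitePseudoDist D) : Type _ :=
  SeparationQuotient (PseudoDistCopy h)

instance {X : Type*} {D : X → X → ℝ≥0∞} (h : IsFinitePseudoDist D) :
    MetricSpace (QuotientSpace h) :=
  inferInstanceAs (MetricSpace (SeparationQuotient (PseudoDistCopy h)))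

instance {X : Type*} {D : X → X → ℝ≥0∞} (h : IsFinitePseudoDist D) :
    MeasurableSpace (QuotientSpace h) := borel _

instance {X : Type*} {D : X → X → ℝ≥0∞} (h : IsFinitePseudoDist D) :
    BorelSpace (QuotientSpace h) := ⟨rfl⟩

/-- The projection `x ↦ [x]`. -/
def proj {X : Type*} {D : X → X → ℝ≥0∞} (h : IsFinitePseudoDist D) (x : X) : QuotientSpace h :=
  SeparationQuotient.mk (X := PseudoDistCopy h) x

theorem edist_proj {X : Type*} {D : X → X → ℝ≥0∞} (h : IsFinitePseudoDist D) (x y : X) :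
    edist (proj h x) (proj h y) = D x y := by
  rw [edist_dist]
  exact ENNReal.ofReal_toReal (h.ne_top x y)

theorem proj_surjective {X : Type*} {D : X → X → ℝ≥0∞} (h : IsFinitePseudoDist D) :
    Function.Surjective (proj h) := fun z =>
  SeparationQuotient.surjective_mk (X := PseudoDistCopy h) z

theorem proj_eq_iff {X : Type*} {D : X → X → ℝ≥0∞} (h : IsFinitePseudoDist D) (x y : X) :
    proj h x = proj h y ↔ D x y = 0 := by
  rw [← edist_proj h, edist_eq_zero]

/-- The map `[x] ↦ u x`, for `u` that does not increase distances with respect to `D`. -/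
def factor {X Y : Type*} [MetricSpace Y] {D : X → X → ℝ≥0∞} (h : IsFinitePseudoDist D)
    (u : X → Y) (hu : ∀ x y, edist (u x) (u y) ≤ D x y) : QuotientSpace h → Y :=
  SeparationQuotient.lift (X := PseudoDistCopy h) u fun x y hxy => by
    have h0 : D x y = 0 := (proj_eq_iff h x y).1 (SeparationQuotient.mk_eq_mk.2 hxy)
    exact edist_le_zero.1 ((hu x y).trans h0.le)

theorem factor_proj {X Y : Type*} [MetricSpace Y] {D : X → X → ℝ≥0∞}
    (h : IsFinitePseudoDist D) (u : X → Y) (hu : ∀ x y, edist (u x) (u y) ≤ D x y) (x : X) :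
    factor h u hu (proj h x) = u x := rfl

/-! ## Multiplicities, pull-back measures and Jacobians -/

/-- `∫_Y #(f⁻¹(y) ∩ E) dν(y)`. -/
def multiplicityIntegral {Z Y : Type*} [MeasurableSpace Y] (ν : Measure Y) (f : Z → Y)
    (E : Set Z) : ℝ≥0∞ :=
  ∫⁻ y, ((f ⁻¹' {y} ∩ E).encard : ℝ≥0∞) ∂ν

/-- `m` is the pull-back measure `f^*ν`, that is, `m(E) = ∫_Y #(f⁻¹(y) ∩ E) dν(y)` for all
measurable `E`; there is at most one such measure, see `IsPullbackMeasure.unique`. -/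
def IsPullbackMeasure {Z Y : Type*} [MeasurableSpace Z] [MeasurableSpace Y] (ν : Measure Y)
    (f : Z → Y) (m : Measure Z) : Prop :=
  ∀ E : Set Z, MeasurableSet E → m E = multiplicityIntegral ν f E

theorem IsPullbackMeasure.unique {Z Y : Type*} [MeasurableSpace Z] [MeasurableSpace Y]
    {ν : Measure Y} {f : Z → Y} {m m' : Measure Z} (h : IsPullbackMeasure ν f m)
    (h' : IsPullbackMeasure ν f m') : m = m' :=
  Measure.ext fun E hE => (h E hE).trans (h' E hE).symm

/-- The Borel map `f` has the locally integrable Jacobian `J`: `J : X → [0,∞]` is Borel and locally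
integrable, and `∫_E J dμ = ∫_Y #(f⁻¹(y) ∩ E) dν(y)` for all Borel sets `E`. -/
structure HasLocIntJacobian {X Y : Type*} [MetricSpace X] [MeasurableSpace X]
    [MeasurableSpace Y] (μ : Measure X) (ν : Measure Y) (f : X → Y) (J : X → ℝ≥0∞) : Prop where
  measurable_map : Measurable f
  measurable : Measurable J
  area : ∀ E : Set X, MeasurableSet E → ∫⁻ x in E, J x ∂μ = multiplicityIntegral ν f E
  locallyIntegrable : LocallyLp μ 1 J

end

end EssPullback

open EssPullback

namespace EssPullback

noncomputable section

/-! ## Comparison of measures on the unit interval -/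

/-! Exceptional families are handled through densities: a family of curves has `Q`-modulus zero
exactly when some Borel `ρ` in `L^Q` has infinite integral along each of its members
(`exists_of_modulus_eq_zero`, `modulus_eq_zero_of_exists`). So an upper bound `d_u'(x,y) ≤ a`
amounts to finding, for each such `ρ` and all small `δ`, a curve between the `δ`-balls with finite
`ρ`-integral and `u`-length at most `a`.

Such curves come from the Poincaré inequality. For lower semicontinuous `h ≥ c > 0`, the least
`h`-cost of discrete chains starting at `z₁` has `h` as an upper gradient (after truncation), so
telescoping over dyadic balls bounds it at `z₂` by potentials of `h` at the two points. Chains with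
steps tending to zero converge to a curve of controlled `h`-integral
(`exists_curve_lineIntegral_le_pot`). This is applied to `h = g + ε(ρ + 1)`. As in Morrey's
inequality, `p > Q` makes the potential of `g` at scale `r` of order `r^(1-Q/p)`; that of `ρ` is
finite at almost every point, and `ε` is arbitrary. Hence points off a null set depending on `ρ` are
joined by curves of `u`-length at most a constant times `r^(1-Q/p)`, with a constant independent of
`ρ` (`exists_holder_curve`). Finiteness of `d_u'`, the triangle inequality and continuity of the
projection `P` onto the classes follow.

Since `d_u'` dominates the distance of `u`-images, `P` inherits properness from `u`. Its fibres are
connected, so a fibre with two points is infinite, and `u` is constant on it. As `J` is integrable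
on compact sets, the area formula forces the values of `u` on nontrivial classes into a `ν`-null set
`W` (`exists_null_forall_eq`). Off `u⁻¹(W)` the map `P` is injective, so `ν_u` is the push-forward
of `J μ`, and the Jacobian and multiplicity statements follow. A ball of measure zero would make
`J`, hence `g`, vanish over it, and then `P` and `u` would be constant on the connected space `X`.

For the Sobolev-to-Lipschitz property, `g^Q ≤ K J` turns a density `ρ` in `L^Q(ν_u)` into the
density `(ρ ∘ P) g` in `L^Q(μ)`. Therefore almost every curve `γ` projects to a curve that is not
exceptional and is no longer than `u ∘ γ` (`exists_testDensity_proj`). If `g_f ≤ 1`, then `f ∘ P`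
changes along almost every `γ` by at most the length of `u ∘ γ`, so it is `1`-Lipschitz for `d_u'`
off a null set, and `f` has a `1`-Lipschitz representative by extension. -/

theorem exists_monotone_partition {δ : ℝ} (hδ : 0 < δ) :
    ∃ (t : ℕ → unitInterval) (N : ℕ), Monotone t ∧ t 0 = 0 ∧ t N = 1 ∧
      ∀ n, ∀ s ∈ Icc (t n) (t (n + 1)), dist s (t n) ≤ δ := by
  have h01 : (0 : ℝ) ≤ 1 := zero_le_one
  refine ⟨Set.Icc.addNSMul h01 δ, ?_⟩
  obtain ⟨m, hm⟩ := Set.Icc.addNSMul_eq_right h01 hδ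
  refine ⟨m, Set.Icc.monotone_addNSMul h01 hδ.le, Subtype.ext (Set.Icc.addNSMul_zero h01),
    Subtype.ext (hm m le_rfl), fun n s hs => ?_⟩
  exact Set.Icc.abs_sub_addNSMul_le h01 hδ.le n hs

theorem iUnion_Icc_of_partition {t : ℕ → unitInterval} {N : ℕ} (h0 : t 0 = 0)
    (hN : t N = 1) (x : unitInterval) : ∃ n < N + 1, x ∈ Icc (t n) (t (n + 1)) := by
  by_cases hx : x = 0
  · exact ⟨0, Nat.succ_pos _, by rw [h0, hx]; exact ⟨le_rfl, unitInterval.nonneg'⟩⟩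
  have hex : ∃ n, x ≤ t n := ⟨N, hN ▸ unitInterval.le_one'⟩
  classical
  set k := Nat.find hex with hk
  have hk1 : x ≤ t k := Nat.find_spec hex
  have hk0 : k ≠ 0 := by
    intro h
    rw [h, h0] at hk1
    exact hx (le_antisymm hk1 unitInterval.nonneg')
  obtain ⟨j, hj⟩ := Nat.exists_eq_succ_of_ne_zero hk0
  refine ⟨j, ?_, ?_, ?_⟩
  · have : k ≤ N := Nat.find_min' hex (hN ▸ unitInterval.le_one')
    omega
  · have := Nat.find_min hex (m := j) (by omega)
    exact (not_le.1 this).le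
  · rw [← Nat.succ_eq_add_one, ← hj]
    exact hk1

theorem sum_measure_Icc {M : Measure unitInterval} (hM : ∀ t, M {t} = 0)
    {t : ℕ → unitInterval} (tm : Monotone t) (S : Finset ℕ) :
    ∑ n ∈ S, M (Icc (t n) (t (n + 1))) = M (⋃ n ∈ S, Icc (t n) (t (n + 1))) := by
  refine (measure_biUnion_finset₀ ?_ fun n _ => measurableSet_Icc.nullMeasurableSet).symm
  have key : ∀ m n : ℕ, m < n → AEDisjoint M (Icc (t m) (t (m + 1))) (Icc (t n) (t (n + 1))) := by
    intro m n hmn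
    refine measure_mono_null ?_ (hM (t n))
    rintro x ⟨hx, hx'⟩
    exact le_antisymm (hx.2.trans (tm hmn)) hx'.1
  intro m _ n _ hmn
  rcases lt_or_gt_of_ne hmn with hlt | hlt
  · exact key m n hlt
  · exact (key n m hlt).symm

/-- A compact subset of an open set is covered by short partition intervals inside the open set.
These overlap only at endpoints, which are null for `M₂`, so the bounds add up; inner and outer
regularity do the rest. -/
theorem measure_le_of_Icc_le {M₁ M₂ : Measure unitInterval} [IsFiniteMeasure M₁]
    [IsFiniteMeasure M₂] (hM : ∀ t, M₂ {t} = 0) {δ : ℝ} (hδ : 0 < δ)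
    (h : ∀ s t : unitInterval, s ≤ t → dist s t ≤ δ → M₁ (Icc s t) ≤ M₂ (Icc s t)) :
    M₁ ≤ M₂ := by
  have hopen : ∀ U : Set unitInterval, IsOpen U → M₁ U ≤ M₂ U := by
    intro U hU
    rw [hU.measure_eq_iSup_isCompact]
    refine iSup_le fun C => iSup_le fun hCU => iSup_le fun hC => ?_
    obtain ⟨η, hη, hthick⟩ := hC.exists_thickening_subset_open hU hCU
    -- With mesh at most `η / 3`, an interval that meets `C` stays within `2η / 3` of it.
    obtain ⟨t, N, tm, t0, tN, hdist⟩ := exists_monotone_partition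
      (show 0 < min δ (η / 3) by positivity)
    classical
    set S := (Finset.range (N + 1)).filter fun n => (Icc (t n) (t (n + 1)) ∩ C).Nonempty with hS
    have hsub : C ⊆ ⋃ n ∈ S, Icc (t n) (t (n + 1)) := by
      intro x hx
      obtain ⟨n, hn, hxn⟩ := iUnion_Icc_of_partition t0 tN x
      refine mem_iUnion₂.2 ⟨n, ?_, hxn⟩
      exact Finset.mem_filter.2 ⟨Finset.mem_range.2 hn, x, hxn, hx⟩
    have hsub' : (⋃ n ∈ S, Icc (t n) (t (n + 1))) ⊆ U := by
      refine iUnion₂_subset fun n hn x hx => hthick ?_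
      obtain ⟨-, c, hc, hcC⟩ := Finset.mem_filter.1 hn
      refine Metric.mem_thickening_iff.2 ⟨c, hcC, ?_⟩
      have h1 := (hdist n x hx).trans (min_le_right _ _)
      have h2 := (hdist n c hc).trans (min_le_right _ _)
      have := dist_triangle_right x c (t n)
      linarith
    calc M₁ C ≤ M₁ (⋃ n ∈ S, Icc (t n) (t (n + 1))) := measure_mono hsub
      _ ≤ ∑ n ∈ S, M₁ (Icc (t n) (t (n + 1))) := measure_biUnion_finset_le _ _
      _ ≤ ∑ n ∈ S, M₂ (Icc (t n) (t (n + 1))) := by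
        refine Finset.sum_le_sum fun n _ => h _ _ (tm n.le_succ) ?_
        rw [dist_comm]
        exact (hdist n _ (right_mem_Icc.2 (tm n.le_succ))).trans (min_le_left _ _)
      _ = M₂ (⋃ n ∈ S, Icc (t n) (t (n + 1))) := sum_measure_Icc hM tm S
      _ ≤ M₂ U := measure_mono hsub'
  refine Measure.le_iff.2 fun A _ => ?_
  rw [Set.measure_eq_iInf_isOpen A M₂]
  exact le_iInf fun U => le_iInf fun hAU => le_iInf fun hU => (measure_mono hAU).trans (hopen U hU)

/-- The intervals of a partition are disjoint up to points, which carry no mass, so the increments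
sum to at most the total mass. This upgrades bounds on endpoint distances to bounds on lengths. -/
theorem eVariationOn_le_measure {E : Type*} [PseudoEMetricSpace E] {M : Measure unitInterval}
    (hM : ∀ t, M {t} = 0) {c : unitInterval → E} {s t : unitInterval}
    (h : ∀ a b, a ≤ b → s ≤ a → b ≤ t → edist (c a) (c b) ≤ M (Icc a b)) :
    eVariationOn c (Icc s t) ≤ M (Icc s t) := by
  refine iSup_le fun p => ?_
  have hmem := p.2.2.2
  calc ∑ i ∈ Finset.range p.1, edist (c (p.2.1 (i + 1))) (c (p.2.1 i))
      ≤ ∑ i ∈ Finset.range p.1, M (Icc (p.2.1 i) (p.2.1 (i + 1))) := by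
        refine Finset.sum_le_sum fun i _ => ?_
        rw [edist_comm]
        exact h _ _ (p.2.2.1 i.le_succ) (hmem i).1 (hmem (i + 1)).2
    _ = M (⋃ i ∈ Finset.range p.1, Icc (p.2.1 i) (p.2.1 (i + 1))) :=
        sum_measure_Icc hM p.2.2.1 _
    _ ≤ M (Icc s t) :=
        measure_mono (iUnion₂_subset fun i _ => Icc_subset_Icc (hmem i).1 (hmem (i + 1)).2)

theorem edist_le_measure_of_short {E : Type*} [PseudoEMetricSpace E] {M : Measure unitInterval}
    (hM : ∀ t, M {t} = 0) {c : unitInterval → E} {δ : ℝ} (hδ : 0 < δ)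
    (h : ∀ a b, a ≤ b → dist a b ≤ δ → edist (c a) (c b) ≤ M (Icc a b)) :
    edist (c 0) (c 1) ≤ M univ := by
  obtain ⟨t, N, tm, t0, tN, hdist⟩ := exists_monotone_partition hδ
  calc edist (c 0) (c 1) ≤ ∑ i ∈ Finset.range N, edist (c (t i)) (c (t (i + 1))) := by
        rw [← t0, ← tN]
        exact edist_le_range_sum_edist (fun i => c (t i)) N
    _ ≤ ∑ i ∈ Finset.range N, M (Icc (t i) (t (i + 1))) := by
        refine Finset.sum_le_sum fun i _ => h _ _ (tm i.le_succ) ?_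
        rw [dist_comm]
        exact hdist i _ (right_mem_Icc.2 (tm i.le_succ))
    _ = M (⋃ i ∈ Finset.range N, Icc (t i) (t (i + 1))) := sum_measure_Icc hM tm _
    _ ≤ M univ := measure_mono (subset_univ _)

/-! ## The length measure of a rectifiable curve -/

section LengthMeasure

variable {X : Type*} [MetricSpace X]

/-- The variation of `γ` on `[0,t]`. -/
def varFun (γ : Curve X) : unitInterval → ℝ := variationOnFromTo γ univ 0

/-- The measure on `[0,1]` that gives an interval the length of `γ` on it. -/
def lenMeas (γ : Curve X) : Measure unitInterval :=
  (volume.restrict (Icc (0 : ℝ) (curveLength γ).toReal)).map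
    (@Function.invFunOn _ _ ⟨(0 : unitInterval)⟩ (varFun γ) univ)

instance (γ : Curve X) : IsFiniteMeasure (lenMeas γ) := by
  unfold lenMeas; infer_instance

variable {γ : Curve X}

theorem boundedVariationOn_of_rectifiable (hγ : curveLength γ ≠ ∞) :
    BoundedVariationOn γ univ := hγ

theorem varFun_mono (hγ : curveLength γ ≠ ∞) : Monotone (varFun γ) :=
  monotoneOn_univ.1 (variationOnFromTo.monotoneOn
    (boundedVariationOn_of_rectifiable hγ).locallyBoundedVariationOn (mem_univ 0))

theorem varFun_zero : varFun γ 0 = 0 := variationOnFromTo.self _ _ _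

theorem varFun_sub (hγ : curveLength γ ≠ ∞) {s t : unitInterval} (h : s ≤ t) :
    ENNReal.ofReal (varFun γ t - varFun γ s) = eVariationOn γ (Icc s t) := by
  have hb := boundedVariationOn_of_rectifiable hγ
  rw [varFun, variationOnFromTo.sub_right hb.locallyBoundedVariationOn (mem_univ _) (mem_univ _)
    (mem_univ _), variationOnFromTo.eq_of_le _ _ h, univ_inter]
  exact ENNReal.ofReal_toReal (hb.mono (subset_univ _))

theorem varFun_one (hγ : curveLength γ ≠ ∞) : varFun γ 1 = (curveLength γ).toReal := by
  have := varFun_sub hγ (s := 0) (t := 1) unitInterval.nonneg'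
  rw [varFun_zero, sub_zero, ← unitInterval.univ_eq_Icc] at this
  rw [curveLength, ← this, ENNReal.toReal_ofReal]
  rw [← varFun_zero (γ := γ)]
  exact varFun_mono hγ unitInterval.nonneg'

theorem continuous_varFun (hγ : curveLength γ ≠ ∞) : Continuous (varFun γ) := by
  have hb := boundedVariationOn_of_rectifiable hγ
  refine continuous_iff_continuousAt.2 fun x => ?_
  have hl := hb.tendsto_eVariationOn_Icc_zero_left (x := x) γ.continuous.continuousWithinAt
  have hr := hb.tendsto_eVariationOn_Icc_zero_right x γ.continuous.continuousWithinAt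
  rw [nhdsWithin_univ] at hl hr
  rw [ContinuousAt, tendsto_iff_edist_tendsto_0]
  refine tendsto_of_tendsto_of_tendsto_of_le_of_le tendsto_const_nhds
    (by simpa using hl.add hr) (fun _ => bot_le) fun y => ?_
  rcases le_total y x with h | h
  · rw [← varFun_sub hγ h, edist_comm, edist_dist, Real.dist_eq,
      abs_of_nonneg (sub_nonneg.2 (varFun_mono hγ h))]
    exact le_self_add
  · rw [← varFun_sub hγ h, edist_dist, Real.dist_eq,
      abs_of_nonneg (sub_nonneg.2 (varFun_mono hγ h))]
    exact le_add_self

theorem exists_varFun_eq (hγ : curveLength γ ≠ ∞) {t : ℝ}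
    (ht : t ∈ Icc (0 : ℝ) (curveLength γ).toReal) : ∃ s, varFun γ s = t := by
  rw [← varFun_one hγ, ← varFun_zero (γ := γ)] at ht
  obtain ⟨s, -, hs⟩ := intermediate_value_Icc unitInterval.nonneg'
    (continuous_varFun hγ).continuousOn ht
  exact ⟨s, hs⟩

/-- The right inverse of the variation function used by `naturalParameterization`. -/
def varInv (γ : Curve X) : ℝ → unitInterval :=
  @Function.invFunOn _ _ ⟨(0 : unitInterval)⟩ (varFun γ) univ

theorem varFun_varInv (hγ : curveLength γ ≠ ∞) {t : ℝ}
    (ht : t ∈ Icc (0 : ℝ) (curveLength γ).toReal) : varFun γ (varInv γ t) = t := by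
  obtain ⟨s, hs⟩ := exists_varFun_eq hγ ht
  have : Nonempty unitInterval := ⟨0⟩
  exact Function.invFunOn_eq ⟨s, mem_univ _, hs⟩

theorem varInv_strictMonoOn (hγ : curveLength γ ≠ ∞) :
    StrictMonoOn (varInv γ) (Icc (0 : ℝ) (curveLength γ).toReal) := by
  intro s hs t ht hst
  by_contra! h
  have := varFun_mono hγ h
  rw [varFun_varInv hγ hs, varFun_varInv hγ ht] at this
  exact absurd hst (not_lt.2 this)

theorem aemeasurable_varInv (hγ : curveLength γ ≠ ∞) :
    AEMeasurable (varInv γ) (volume.restrict (Icc (0 : ℝ) (curveLength γ).toReal)) :=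
  aemeasurable_restrict_of_monotoneOn measurableSet_Icc (varInv_strictMonoOn hγ).monotoneOn

/-- With `V = varFun γ`, the preimage of `[s,t]` under `varInv γ` lies between the open and the
closed interval with endpoints `V s` and `V t`, which have the same volume even where `V` is flat.
-/
theorem lenMeas_Icc (hγ : curveLength γ ≠ ∞) {s t : unitInterval} (h : s ≤ t) :
    lenMeas γ (Icc s t) = eVariationOn γ (Icc s t) := by
  have e : lenMeas γ (Icc s t) =
      volume.restrict (Icc (0 : ℝ) (curveLength γ).toReal) (varInv γ ⁻¹' Icc s t) :=
    Measure.map_apply_of_aemeasurable (aemeasurable_varInv hγ) measurableSet_Icc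
  have hs0 : 0 ≤ varFun γ s := varFun_zero (γ := γ) ▸ varFun_mono hγ unitInterval.nonneg'
  have ht1 : varFun γ t ≤ (curveLength γ).toReal :=
    varFun_one hγ ▸ varFun_mono hγ unitInterval.le_one'
  rw [e, ← varFun_sub hγ h, Measure.restrict_apply' measurableSet_Icc]
  apply le_antisymm
  · rw [← Real.volume_Icc]
    refine measure_mono ?_
    rintro r ⟨⟨h1, h2⟩, hr⟩
    rw [← varFun_varInv hγ hr]
    exact ⟨varFun_mono hγ h1, varFun_mono hγ h2⟩
  · rw [← Real.volume_Ioo]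
    refine measure_mono ?_
    rintro r ⟨h1, h2⟩
    have hr : r ∈ Icc (0 : ℝ) (curveLength γ).toReal := ⟨hs0.trans h1.le, h2.le.trans ht1⟩
    rw [← varFun_varInv hγ hr] at h1 h2
    refine ⟨⟨?_, ?_⟩, hr⟩
    · by_contra! hc
      exact absurd (varFun_mono hγ hc.le) (not_le.2 h1)
    · by_contra! hc
      exact absurd (varFun_mono hγ hc.le) (not_le.2 h2)

theorem lenMeas_univ (hγ : curveLength γ ≠ ∞) : lenMeas γ univ = curveLength γ := by
  rw [unitInterval.univ_eq_Icc, lenMeas_Icc hγ unitInterval.nonneg', ← unitInterval.univ_eq_Icc]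
  rfl

theorem lenMeas_singleton (hγ : curveLength γ ≠ ∞) (t : unitInterval) : lenMeas γ {t} = 0 := by
  rw [← Icc_self, lenMeas_Icc hγ le_rfl, Icc_self]
  exact eVariationOn.subsingleton _ subsingleton_singleton

theorem lineIntegral_eq_top {g : X → ℝ≥0∞} (hγ : curveLength γ = ∞) : lineIntegral g γ = ∞ := by
  simp [lineIntegral, hγ]

theorem rectifiable_of_lineIntegral_ne_top {g : X → ℝ≥0∞} (h : lineIntegral g γ ≠ ∞) :
    curveLength γ ≠ ∞ := fun hγ => h (lineIntegral_eq_top hγ)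

/-- `lenMeas` is the push-forward of Lebesgue measure under the very inverse that defines the arc
length parametrization. Integrals along subcurves and reparametrizations thereby become statements
about one measure on `[0,1]`. -/
theorem lineIntegral_eq [MeasurableSpace X] [BorelSpace X] (hγ : curveLength γ ≠ ∞)
    {g : X → ℝ≥0∞} (hg : Measurable g) :
    lineIntegral g γ = ∫⁻ t, g (γ t) ∂(lenMeas γ) := by
  have e : ∫⁻ t, g (γ t) ∂(lenMeas γ) =
      ∫⁻ t in Icc (0 : ℝ) (curveLength γ).toReal, g (γ (varInv γ t)) :=
    lintegral_map' (hg.comp γ.continuous.measurable).aemeasurable (aemeasurable_varInv hγ)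
  rw [e, lineIntegral, if_neg hγ]
  rfl

theorem lineIntegral_mono {g g' : X → ℝ≥0∞} (h : ∀ x, g x ≤ g' x) (γ : Curve X) :
    lineIntegral g γ ≤ lineIntegral g' γ := by
  unfold lineIntegral
  split_ifs
  · exact le_rfl
  · exact lintegral_mono fun t => h _

theorem mul_lineIntegral_le (c : ℝ≥0∞) (g : X → ℝ≥0∞) (γ : Curve X) :
    c * lineIntegral g γ ≤ lineIntegral (fun x => c * g x) γ := by
  unfold lineIntegral
  split_ifs
  · exact le_top
  · exact lintegral_const_mul_le _ _

theorem lineIntegral_ne_top_of_mul_le {c : ℝ≥0∞} (hc : c ≠ 0) {g g' : X → ℝ≥0∞}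
    (h : ∀ x, c * g x ≤ g' x) {γ : Curve X} (hγ : lineIntegral g' γ ≠ ∞) :
    lineIntegral g γ ≠ ∞ := by
  have h1 := ((mul_lineIntegral_le c g γ).trans (lineIntegral_mono h γ)).trans_lt hγ.lt_top
  exact (ENNReal.lt_top_of_mul_ne_top_right h1.ne hc).ne

theorem eq_lenMeas (hγ : curveLength γ ≠ ∞) {M : Measure unitInterval} [IsFiniteMeasure M]
    (h : ∀ s t, s ≤ t → M (Icc s t) = eVariationOn γ (Icc s t)) : M = lenMeas γ :=
  Measure.ext_of_Icc _ _ fun s t hst => (h s t hst).trans (lenMeas_Icc hγ hst).symm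

/-! ## Reparametrizations -/

theorem curveLength_comp_le {Y : Type*} [PseudoEMetricSpace Y] (c : unitInterval → Y)
    {σ : unitInterval → unitInterval} (hσ : Monotone σ) : curveLength (c ∘ σ) ≤ curveLength c :=
  eVariationOn.comp_le_of_monotoneOn _ _ (hσ.monotoneOn _) (mapsTo_univ _ _)

/-- Tested on initial intervals: the preimage of one under `σ` is some `[0,b]`, whose image is `[σ
0, σ b]` by the intermediate value theorem, and variation is invariant under monotone changes of
parameter. -/
theorem map_lenMeas_comp (hγ : curveLength γ ≠ ∞) (σ : C(unitInterval, unitInterval))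
    (hσ : Monotone σ) :
    (lenMeas (γ.comp σ)).map σ = (lenMeas γ).restrict (Icc (σ 0) (σ 1)) := by
  have hγσ : curveLength (γ.comp σ) ≠ ∞ := ne_top_of_le_ne_top hγ (curveLength_comp_le γ hσ)
  refine Measure.ext_of_Iic _ _ fun t => ?_
  rw [Measure.map_apply σ.continuous.measurable measurableSet_Iic,
    Measure.restrict_apply measurableSet_Iic]
  rcases lt_or_ge t (σ 0) with h | h
  · have e1 : σ ⁻¹' Iic t = ∅ := by
      refine eq_empty_of_forall_notMem fun r hr => ?_
      exact absurd (hσ (unitInterval.nonneg' (t := r))) (not_le.2 (lt_of_le_of_lt hr h))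
    have e2 : Iic t ∩ Icc (σ 0) (σ 1) = ∅ := by
      refine eq_empty_of_forall_notMem fun r hr => ?_
      exact absurd (hr.2.1.trans hr.1) (not_le.2 h)
    rw [e1, e2, measure_empty, measure_empty]
  · have hcpt : IsCompact (σ ⁻¹' Iic t) := (isClosed_Iic.preimage σ.continuous).isCompact
    obtain ⟨b, hb, hbmax⟩ := hcpt.exists_isGreatest ⟨0, h⟩
    have e1 : σ ⁻¹' Iic t = Icc 0 b := by
      ext r
      exact ⟨fun hr => ⟨unitInterval.nonneg', hbmax hr⟩, fun hr => (hσ hr.2).trans hb⟩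
    have e2 : Iic t ∩ Icc (σ 0) (σ 1) = Icc (σ 0) (σ b) := by
      ext r
      constructor
      · rintro ⟨h1, h2⟩
        obtain ⟨q, -, hq⟩ := intermediate_value_Icc (unitInterval.nonneg' (t := (1 : unitInterval)))
          σ.continuous.continuousOn h2
        refine ⟨h2.1, ?_⟩
        rw [← hq]
        exact hσ (hbmax (by rw [mem_preimage, hq]; exact h1))
      · rintro ⟨h1, h2⟩
        exact ⟨h2.trans hb, h1, h2.trans (hσ unitInterval.le_one')⟩
    have e3 : σ '' Icc 0 b = Icc (σ 0) (σ b) := by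
      apply Subset.antisymm
      · rintro _ ⟨r, hr, rfl⟩
        exact ⟨hσ hr.1, hσ hr.2⟩
      · exact intermediate_value_Icc unitInterval.nonneg' σ.continuous.continuousOn
    rw [e1, e2, lenMeas_Icc hγσ unitInterval.nonneg', lenMeas_Icc hγ (hσ unitInterval.nonneg'),
      ← e3]
    exact eVariationOn.comp_eq_of_monotoneOn γ σ (hσ.monotoneOn _)

theorem lineIntegral_comp [MeasurableSpace X] [BorelSpace X] (hγ : curveLength γ ≠ ∞)
    (σ : C(unitInterval, unitInterval)) (hσ : Monotone σ) {g : X → ℝ≥0∞} (hg : Measurable g) :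
    lineIntegral g (γ.comp σ) = ∫⁻ t in Icc (σ 0) (σ 1), g (γ t) ∂(lenMeas γ) := by
  have hγσ : curveLength (γ.comp σ) ≠ ∞ := ne_top_of_le_ne_top hγ (curveLength_comp_le γ hσ)
  rw [lineIntegral_eq hγσ hg, ← map_lenMeas_comp hγ σ hσ,
    lintegral_map (f := fun t => g (γ t)) (hg.comp γ.continuous.measurable)
      σ.continuous.measurable]
  rfl

theorem lineIntegral_comp_of_surj [MeasurableSpace X] [BorelSpace X] (hγ : curveLength γ ≠ ∞)
    (σ : C(unitInterval, unitInterval)) (hσ : Monotone σ) (h0 : σ 0 = 0) (h1 : σ 1 = 1)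
    {g : X → ℝ≥0∞} (hg : Measurable g) :
    lineIntegral g (γ.comp σ) = lineIntegral g γ := by
  rw [lineIntegral_comp hγ σ hσ hg, h0, h1, ← unitInterval.univ_eq_Icc, Measure.restrict_univ,
    lineIntegral_eq hγ hg]

/-- The reversed curve. -/
def reverse (γ : Curve X) : Curve X := γ.comp ⟨unitInterval.symm, unitInterval.continuous_symm⟩

theorem curveLength_comp_symm {Y : Type*} [PseudoEMetricSpace Y] (c : unitInterval → Y) :
    curveLength (c ∘ unitInterval.symm) = curveLength c := by
  unfold curveLength
  rw [eVariationOn.comp_eq_of_antitoneOn c _ (unitInterval.strictAnti_symm.antitone.antitoneOn _),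
    image_univ_of_surjective unitInterval.symm_bijective.surjective]

theorem lineIntegral_reverse [MeasurableSpace X] [BorelSpace X] (γ : Curve X)
    {g : X → ℝ≥0∞} (hg : Measurable g) : lineIntegral g (reverse γ) = lineIntegral g γ := by
  have e : curveLength (reverse γ) = curveLength γ := curveLength_comp_symm γ
  by_cases hγ : curveLength γ = ∞
  · rw [lineIntegral_eq_top hγ, lineIntegral_eq_top (e.trans hγ)]
  have hm : Measurable unitInterval.symm := unitInterval.continuous_symm.measurable
  have : (lenMeas (reverse γ)).map unitInterval.symm = lenMeas γ := by
    refine eq_lenMeas hγ fun s t hst => ?_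
    have hpre : unitInterval.symm ⁻¹' Icc s t =
        Icc (unitInterval.symm t) (unitInterval.symm s) := by
      ext r
      exact ⟨fun h => ⟨unitInterval.symm_le_comm.1 h.2, unitInterval.le_symm_comm.1 h.1⟩,
        fun h => ⟨unitInterval.le_symm_comm.1 h.2, unitInterval.symm_le_comm.1 h.1⟩⟩
    rw [Measure.map_apply hm measurableSet_Icc, hpre,
      lenMeas_Icc (by rwa [e]) (unitInterval.symm_le_symm.2 hst), ← hpre]
    refine (eVariationOn.comp_eq_of_antitoneOn γ _
      (unitInterval.strictAnti_symm.antitone.antitoneOn _)).trans ?_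
    rw [image_preimage_eq _ unitInterval.symm_bijective.surjective]
  rw [lineIntegral_eq (by rwa [e]) hg, lineIntegral_eq hγ hg, ← this,
    lintegral_map (f := fun t => g (γ t)) (hg.comp γ.continuous.measurable) hm]
  simp [reverse]

/-- The monotone affine map of `[0,1]` onto `[s,t]`. -/
def affineSub (s t : unitInterval) : C(unitInterval, unitInterval) :=
  ⟨Set.Icc.convexComb s t, Set.Icc.continuous_convexComb s t⟩

theorem affineSub_zero (s t : unitInterval) : affineSub s t 0 = s := Set.Icc.convexComb_zero s t

theorem affineSub_one (s t : unitInterval) : affineSub s t 1 = t := Set.Icc.convexComb_one s t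

theorem affineSub_mono {s t : unitInterval} (h : s ≤ t) : Monotone (affineSub s t) := by
  intro a b hab
  have hab' : (a : ℝ) ≤ b := hab
  have h' : (s : ℝ) ≤ t := h
  change ((Set.Icc.convexComb s t a : unitInterval) : ℝ) ≤ Set.Icc.convexComb s t b
  rw [Set.Icc.coe_convexComb, Set.Icc.coe_convexComb]
  nlinarith

theorem lineIntegral_affineSub [MeasurableSpace X] [BorelSpace X] (hγ : curveLength γ ≠ ∞)
    {s t : unitInterval} (h : s ≤ t) {g : X → ℝ≥0∞} (hg : Measurable g) :
    lineIntegral g (γ.comp (affineSub s t)) = ∫⁻ r in Icc s t, g (γ r) ∂(lenMeas γ) := by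
  rw [lineIntegral_comp hγ _ (affineSub_mono h) hg, affineSub_zero, affineSub_one]

theorem lineIntegral_affineSub_le [MeasurableSpace X] [BorelSpace X] (γ : Curve X)
    {s t : unitInterval} (h : s ≤ t) {g : X → ℝ≥0∞} (hg : Measurable g) :
    lineIntegral g (γ.comp (affineSub s t)) ≤ lineIntegral g γ := by
  by_cases hγ : curveLength γ = ∞
  · rw [lineIntegral_eq_top hγ]; exact le_top
  rw [lineIntegral_affineSub hγ h hg, lineIntegral_eq hγ hg]
  exact setLIntegral_le_lintegral _ _

/-- The reparametrization of a rectifiable curve with constant speed. -/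
theorem exists_lipschitz_reparam (γ : Curve X) (hγ : curveLength γ ≠ ∞) :
    ∃ (γ' : Curve X) (σ : C(unitInterval, unitInterval)), (∃ L : ℝ≥0, LipschitzWith L γ') ∧
      Monotone σ ∧ σ 0 = 0 ∧ σ 1 = 1 ∧ γ = γ'.comp σ := by
  set l := (curveLength γ).toReal with hl
  have hb := boundedVariationOn_of_rectifiable hγ
  rcases eq_or_lt_of_le (show 0 ≤ l from ENNReal.toReal_nonneg) with h0 | hpos
  · have hz : eVariationOn γ univ = 0 := by
      rcases (ENNReal.toReal_eq_zero_iff _).1 h0.symm with h | h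
      · exact h
      · exact absurd h hγ
    have hc : ∀ x y, γ x = γ y := fun x y =>
      edist_eq_zero.1 ((eVariationOn.eq_zero_iff _).1 hz x (mem_univ _) y (mem_univ _))
    refine ⟨γ, ContinuousMap.id _, ⟨0, fun x y => ?_⟩, monotone_id, rfl, rfl, rfl⟩
    simp [hc x y]
  · have hmem : ∀ t : unitInterval, l * t ∈ Icc (0 : ℝ) l := fun t =>
      ⟨mul_nonneg hpos.le t.2.1, mul_le_of_le_one_right hpos.le t.2.2⟩
    have hlip : LipschitzWith l.toNNReal fun t : unitInterval => γ (varInv γ (l * t)) := by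
      have key : ∀ s t : unitInterval, s ≤ t →
          edist (γ (varInv γ (l * s))) (γ (varInv γ (l * t))) ≤ l.toNNReal * edist s t := by
        intro s t hst
        have hle : varInv γ (l * s) ≤ varInv γ (l * t) :=
          (varInv_strictMonoOn hγ).monotoneOn (hmem s) (hmem t)
            (mul_le_mul_of_nonneg_left hst hpos.le)
        calc edist (γ (varInv γ (l * s))) (γ (varInv γ (l * t)))
            ≤ eVariationOn γ (Icc (varInv γ (l * s)) (varInv γ (l * t))) :=
              eVariationOn.edist_le _ (left_mem_Icc.2 hle) (right_mem_Icc.2 hle)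
          _ = ENNReal.ofReal (l * (t - s)) := by
              rw [← varFun_sub hγ hle, varFun_varInv hγ (hmem s), varFun_varInv hγ (hmem t),
                mul_sub]
          _ = l.toNNReal * edist s t := by
              rw [ENNReal.ofReal_mul hpos.le, edist_comm, Subtype.edist_eq, edist_dist,
                Real.dist_eq, abs_of_nonneg (sub_nonneg.2 (show (s : ℝ) ≤ t from hst))]
              rfl
      intro s t
      rcases le_total s t with h | h
      · exact key s t h
      · rw [edist_comm, edist_comm s t]
        exact key t s h
    have hV : ∀ t, varFun γ t / l ∈ unitInterval := fun t =>
      ⟨div_nonneg (varFun_zero (γ := γ) ▸ varFun_mono hγ unitInterval.nonneg') hpos.le,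
        (div_le_one hpos).2 ((varFun_mono hγ unitInterval.le_one').trans_eq (varFun_one hγ))⟩
    refine ⟨⟨_, hlip.continuous⟩, ⟨fun t => ⟨varFun γ t / l, hV t⟩,
      ((continuous_varFun hγ).div_const _).subtype_mk _⟩, ⟨_, hlip⟩, ?_, ?_, ?_, ?_⟩
    · intro s t hst
      exact Subtype.mk_le_mk.2 (div_le_div_of_nonneg_right (varFun_mono hγ hst) hpos.le)
    · exact Subtype.ext (by simp [varFun_zero])
    · exact Subtype.ext (by simp [varFun_one hγ, ← hl, hpos.ne'])
    · ext t
      -- The inverse need not return `t`, but `γ` has no variation between `t` and the parameter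
      -- returned.
      change γ t = γ (varInv γ (l * (varFun γ t / l)))
      rw [mul_div_cancel₀ _ hpos.ne']
      exact (edist_eq_zero.1 (edist_naturalParameterization_eq_zero
        hb.locallyBoundedVariationOn (mem_univ (0 : unitInterval)) (mem_univ t))).symm

/-! ## Concatenation -/

/-- The concatenation of two curves. -/
def concat (α β : Curve X) (h : α 1 = β 0) : Curve X :=
  (Path.trans (⟨α, rfl, rfl⟩ : Path (α 0) (α 1))
    (⟨β, h.symm, rfl⟩ : Path (α 1) (β 1))).toContinuousMap

theorem concat_zero (α β : Curve X) (h : α 1 = β 0) : concat α β h 0 = α 0 :=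
  (Path.trans (⟨α, rfl, rfl⟩ : Path (α 0) (α 1))
    (⟨β, h.symm, rfl⟩ : Path (α 1) (β 1))).source

theorem concat_one (α β : Curve X) (h : α 1 = β 0) : concat α β h 1 = β 1 :=
  (Path.trans (⟨α, rfl, rfl⟩ : Path (α 0) (α 1))
    (⟨β, h.symm, rfl⟩ : Path (α 1) (β 1))).target

/-- The midpoint of `[0,1]`. -/
def midI : unitInterval := ⟨1 / 2, by norm_num, by norm_num⟩

theorem concat_comp_left (α β : Curve X) (h : α 1 = β 0) :
    (concat α β h).comp (affineSub 0 midI) = α := by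
  ext t
  have hc : ((affineSub 0 midI t : unitInterval) : ℝ) = t / 2 := by
    change ((Set.Icc.convexComb 0 midI t : unitInterval) : ℝ) = _
    rw [Set.Icc.coe_convexComb]
    simp [midI]; ring
  change Path.trans _ _ (affineSub 0 midI t) = α t
  rw [Path.trans_apply, dif_pos (by rw [hc]; linarith [t.2.2])]
  change α _ = α t
  congr 1
  ext
  simp only [hc]; ring

theorem concat_comp_right (α β : Curve X) (h : α 1 = β 0) :
    (concat α β h).comp (affineSub midI 1) = β := by
  ext t
  have hc : ((affineSub midI 1 t : unitInterval) : ℝ) = 1 / 2 + t / 2 := by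
    change ((Set.Icc.convexComb midI 1 t : unitInterval) : ℝ) = _
    rw [Set.Icc.coe_convexComb]
    simp [midI]; ring
  change Path.trans _ _ (affineSub midI 1 t) = β t
  rw [Path.trans_apply]
  split_ifs with hle
  · have ht : t = 0 := by
      ext
      have := t.2.1
      rw [hc] at hle
      change (t : ℝ) = 0
      linarith
    subst ht
    rw [← h]
    change α _ = α 1
    congr 1
    ext
    simp [hc]
  · change β _ = β t
    congr 1
    ext
    simp only [hc]; ring

theorem affineSub_image_univ {s t : unitInterval} (hst : s ≤ t) :
    affineSub s t '' univ = Icc s t := by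
  apply Subset.antisymm
  · rintro _ ⟨r, -, rfl⟩
    exact ⟨Set.Icc.le_convexComb hst r, Set.Icc.convexComb_le hst r⟩
  · have := intermediate_value_Icc (unitInterval.nonneg' (t := (1 : unitInterval)))
      (affineSub s t).continuous.continuousOn
    rw [affineSub_zero, affineSub_one] at this
    exact this.trans (image_mono (subset_univ _))

theorem curveLength_affineSub {Y : Type*} [PseudoEMetricSpace Y] (c : unitInterval → Y)
    {s t : unitInterval} (hst : s ≤ t) :
    curveLength (c ∘ affineSub s t) = eVariationOn c (Icc s t) := by
  have := eVariationOn.comp_eq_of_monotoneOn c (t := univ) (affineSub s t)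
    ((affineSub_mono hst).monotoneOn _)
  rwa [affineSub_image_univ hst] at this

theorem curveLength_concat {Y : Type*} [PseudoEMetricSpace Y] (u : X → Y) (α β : Curve X)
    (h : α 1 = β 0) :
    curveLength (u ∘ concat α β h) = curveLength (u ∘ α) + curveLength (u ∘ β) := by
  have hm0 : (0 : unitInterval) ≤ midI := unitInterval.nonneg'
  have hm1 : midI ≤ (1 : unitInterval) := unitInterval.le_one'
  have h1 := curveLength_affineSub (u ∘ concat α β h) hm0
  have h2 := curveLength_affineSub (u ∘ concat α β h) hm1
  have h3 := eVariationOn.Icc_add_Icc (u ∘ concat α β h) (s := univ) hm0 hm1 (mem_univ _)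
  simp only [univ_inter, ← h1, ← h2, ← unitInterval.univ_eq_Icc] at h3
  have ea : (u ∘ concat α β h) ∘ affineSub 0 midI = u ∘ α := by
    rw [Function.comp_assoc, ← ContinuousMap.coe_comp, concat_comp_left]
  have eb : (u ∘ concat α β h) ∘ affineSub midI 1 = u ∘ β := by
    rw [Function.comp_assoc, ← ContinuousMap.coe_comp, concat_comp_right]
  rw [ea, eb] at h3
  exact h3.symm

theorem lineIntegral_concat_le [MeasurableSpace X] [BorelSpace X] (α β : Curve X)
    (h : α 1 = β 0) {g : X → ℝ≥0∞} (hg : Measurable g) :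
    lineIntegral g (concat α β h) ≤ lineIntegral g α + lineIntegral g β := by
  by_cases hα : curveLength α = ∞
  · rw [lineIntegral_eq_top hα, top_add]; exact le_top
  by_cases hβ : curveLength β = ∞
  · rw [lineIntegral_eq_top hβ, add_top]; exact le_top
  have hm0 : (0 : unitInterval) ≤ midI := unitInterval.nonneg'
  have hm1 : midI ≤ (1 : unitInterval) := unitInterval.le_one'
  have hγ : curveLength (concat α β h) ≠ ∞ :=
    ne_top_of_le_ne_top (ENNReal.add_ne_top.2 ⟨hα, hβ⟩) (curveLength_concat (id : X → X) α β h).le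
  have e1 := lineIntegral_affineSub hγ hm0 hg
  have e2 := lineIntegral_affineSub hγ hm1 hg
  rw [concat_comp_left] at e1
  rw [concat_comp_right] at e2
  have hu : (univ : Set unitInterval) = Icc 0 midI ∪ Icc midI 1 := by
    rw [Icc_union_Icc_eq_Icc hm0 hm1, unitInterval.univ_eq_Icc]
  rw [e1, e2, lineIntegral_eq hγ hg, ← setLIntegral_univ, hu]
  exact lintegral_union_le _ _ _

end LengthMeasure


/-! ## Exceptional families of curves and integrable functions -/

/-- Sum the `p`-th powers with weights that make the integrals summable, then take the `p`-th root.
It shows that countably many exceptional families can be avoided with a single density. -/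
theorem exists_dominating {X : Type*} [MeasurableSpace X] {μ : Measure X} {p : ℝ}
    (hp : 0 < p) {ρ : ℕ → X → ℝ≥0∞} (hm : ∀ n, Measurable (ρ n)) (h : ∀ n, ∫⁻ z, ρ n z ^ p ∂μ ≠ ∞) :
    ∃ ρ' : X → ℝ≥0∞, Measurable ρ' ∧ ∫⁻ z, ρ' z ^ p ∂μ ≠ ∞ ∧
      ∀ n, ∃ c : ℝ≥0∞, c ≠ 0 ∧ ∀ x, c * ρ n x ≤ ρ' x := by
  obtain ⟨δ, δ0, hδ⟩ := ENNReal.exists_pos_tsum_mul_lt_of_countable (ε := 1) one_ne_zero _ h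
  have hm' : ∀ n, Measurable fun x => (δ n : ℝ≥0∞) * ρ n x ^ p :=
    fun n => ((hm n).pow_const p).const_mul _
  refine ⟨fun x => (∑' n, (δ n : ℝ≥0∞) * ρ n x ^ p) ^ (1 / p),
    (Measurable.tsum hm').pow_const _, ?_, fun n => ⟨(δ n : ℝ≥0∞) ^ (1 / p), ?_, fun x => ?_⟩⟩
  · simp only [← ENNReal.rpow_mul, one_div_mul_cancel hp.ne', ENNReal.rpow_one]
    rw [lintegral_tsum fun n => (hm' n).aemeasurable]
    refine ne_top_of_lt (lt_of_le_of_lt (ENNReal.tsum_le_tsum fun n => ?_) hδ)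
    rw [lintegral_const_mul _ ((hm n).pow_const p), mul_comm]
  · have : (δ n : ℝ≥0∞) ≠ 0 := by simpa using (δ0 n).ne'
    exact (ENNReal.rpow_pos (pos_iff_ne_zero.2 this) ENNReal.coe_ne_top).ne'
  · calc (δ n : ℝ≥0∞) ^ (1 / p) * ρ n x = ((δ n : ℝ≥0∞) * ρ n x ^ p) ^ (1 / p) := by
          rw [ENNReal.mul_rpow_of_nonneg _ _ (by positivity), ← ENNReal.rpow_mul,
            mul_one_div_cancel hp.ne', ENNReal.rpow_one]
      _ ≤ _ := by
          exact ENNReal.rpow_le_rpow (ENNReal.le_tsum (f := fun n => (δ n : ℝ≥0∞) * ρ n x ^ p) n)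
            (by positivity)

section NullFamilies

variable {X : Type*} [MetricSpace X] [MeasurableSpace X]

/-! ### Local integrability, semicontinuous majorants and modulus zero -/

theorem IsMetricMeasureSpace.isLocallyFinite [BorelSpace X] {μ : Measure X}
    (hX : IsMetricMeasureSpace μ) : IsLocallyFiniteMeasure μ :=
  ⟨fun x => ⟨Metric.ball x 1, Metric.ball_mem_nhds x one_pos, hX.ball_lt_top x 1 one_pos⟩⟩

theorem lintegral_compact_lt_top {μ : Measure X} {f : X → ℝ≥0∞}
    (h : ∀ x : X, ∃ U ∈ 𝓝 x, ∫⁻ z in U, f z ∂μ < ∞) {C : Set X} (hC : IsCompact C) :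
    ∫⁻ z in C, f z ∂μ < ∞ := by
  refine hC.induction_on (p := fun s => ∫⁻ z in s, f z ∂μ < ∞) (by simp)
    (fun s t hst ht => lt_of_le_of_lt (lintegral_mono_set hst) ht)
    (fun s t hs ht => lt_of_le_of_lt (lintegral_union_le _ _ _) (ENNReal.add_lt_top.2 ⟨hs, ht⟩))
    fun x _ => ?_
  obtain ⟨U, hU, hfin⟩ := h x
  exact ⟨U, mem_nhdsWithin_of_mem_nhds hU, hfin⟩

theorem LocallyLp.lt_top_of_isCompact {μ : Measure X} {p : ℝ} {g : X → ℝ≥0∞}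
    (hg : LocallyLp μ p g) {C : Set X} (hC : IsCompact C) : ∫⁻ z in C, g z ^ p ∂μ < ∞ :=
  lintegral_compact_lt_top hg hC

theorem LocallyLp.lt_top_ball [ProperSpace X] {μ : Measure X} {p : ℝ} {g : X → ℝ≥0∞}
    (hg : LocallyLp μ p g) (x : X) (r : ℝ) : ∫⁻ z in Metric.ball x r, g z ^ p ∂μ < ∞ :=
  lt_of_le_of_lt (lintegral_mono_set Metric.ball_subset_closedBall)
    (hg.lt_top_of_isCompact (isCompact_closedBall x r))

theorem LocallyLp.of_lintegral_ne_top {μ : Measure X} {p : ℝ} {g : X → ℝ≥0∞}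
    (h : ∫⁻ z, g z ^ p ∂μ ≠ ∞) : LocallyLp μ p g := fun _ =>
  ⟨univ, univ_mem, lt_of_le_of_lt (setLIntegral_le_lintegral _ _) h.lt_top⟩

/-- The Vitali–Carathéodory theorem needs an integrable function. A weighted sum of the restrictions
of `μ` to balls is a finite measure for which `f` is integrable, and finiteness for it gives
finiteness on each ball for `μ`. -/
theorem exists_lowerSemicontinuous_ge_of_locally [BorelSpace X] [ProperSpace X] {μ : Measure X}
    [IsLocallyFiniteMeasure μ] {f : X → ℝ≥0∞} (hf : Measurable f)
    (h : ∀ x : X, ∃ U ∈ 𝓝 x, ∫⁻ z in U, f z ∂μ < ∞) :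
    ∃ F : X → ℝ≥0∞, (∀ x, f x ≤ F x) ∧ LowerSemicontinuous F ∧
      ∀ x : X, ∃ U ∈ 𝓝 x, ∫⁻ z in U, F z ∂μ < ∞ := by
  rcases isEmpty_or_nonempty X with hE | ⟨⟨x₀⟩⟩
  · exact ⟨f, fun _ => le_rfl, fun x => hE.elim x, h⟩
  set B : ℕ → Set X := fun n => Metric.closedBall x₀ n
  have hB : ∀ n, IsCompact (B n) := fun n => isCompact_closedBall _ _
  obtain ⟨δ, δ0, hδ⟩ := ENNReal.exists_pos_tsum_mul_lt_of_countable (ε := 1) one_ne_zero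
    (fun n => μ (B n) + ∫⁻ z in B n, f z ∂μ)
    fun n => ENNReal.add_ne_top.2 ⟨(hB n).measure_lt_top.ne, (lintegral_compact_lt_top h (hB n)).ne⟩
  let μ' : Measure X := Measure.sum fun n => (δ n : ℝ≥0∞) • μ.restrict (B n)
  have hint : ∀ F : X → ℝ≥0∞, ∫⁻ z, F z ∂μ' = ∑' n, (δ n : ℝ≥0∞) * ∫⁻ z in B n, F z ∂μ := by
    intro F
    rw [lintegral_sum_measure]
    simp only [lintegral_smul_measure, smul_eq_mul]
  have hfin : IsFiniteMeasure μ' := by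
    refine ⟨?_⟩
    rw [← setLIntegral_one, setLIntegral_univ, hint]
    refine lt_of_le_of_lt (ENNReal.tsum_le_tsum fun n => ?_) (hδ.trans ENNReal.one_lt_top)
    rw [setLIntegral_one, mul_comm]
    gcongr
    exact le_self_add
  have hfint : ∫⁻ z, f z ∂μ' < ∞ := by
    rw [hint]
    refine lt_of_le_of_lt (ENNReal.tsum_le_tsum fun n => ?_) (hδ.trans ENNReal.one_lt_top)
    rw [mul_comm]
    gcongr
    exact le_add_self
  obtain ⟨F, hfF, hF, hFint⟩ := exists_le_lowerSemicontinuous_lintegral_ge μ' f hf one_ne_zero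
  refine ⟨F, hfF, hF, fun x => ?_⟩
  obtain ⟨n, hn⟩ := exists_nat_gt (dist x x₀)
  refine ⟨B n, Metric.closedBall_mem_nhds_of_mem hn, ?_⟩
  have h1 : (δ n : ℝ≥0∞) * ∫⁻ z in B n, F z ∂μ < ∞ :=
    calc (δ n : ℝ≥0∞) * ∫⁻ z in B n, F z ∂μ
        ≤ ∑' n, (δ n : ℝ≥0∞) * ∫⁻ z in B n, F z ∂μ :=
          ENNReal.le_tsum (f := fun n => (δ n : ℝ≥0∞) * ∫⁻ z in B n, F z ∂μ) n
      _ = ∫⁻ z, F z ∂μ' := (hint F).symm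
      _ ≤ ∫⁻ z, f z ∂μ' + 1 := hFint
      _ < ∞ := ENNReal.add_lt_top.2 ⟨hfint, ENNReal.one_lt_top⟩
  exact ENNReal.lt_top_of_mul_ne_top_right h1.ne (by simpa using (δ0 n).ne')

/-- A function in `L^p_loc` is dominated by a lower semicontinuous function in `L^p_loc`. -/
theorem LocallyLp.exists_lowerSemicontinuous_ge [BorelSpace X] [ProperSpace X] {μ : Measure X}
    [IsLocallyFiniteMeasure μ] {p : ℝ} (hp : 0 < p) {g : X → ℝ≥0∞} (hg : Measurable g)
    (h : LocallyLp μ p g) :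
    ∃ g' : X → ℝ≥0∞, (∀ x, g x ≤ g' x) ∧ LowerSemicontinuous g' ∧ LocallyLp μ p g' := by
  obtain ⟨F, hF1, hF2, hF3⟩ := exists_lowerSemicontinuous_ge_of_locally (hg.pow_const p) h
  refine ⟨fun x => F x ^ (1 / p), fun x => ?_, ?_, ?_⟩
  · calc g x = (g x ^ p) ^ (1 / p) := by
          rw [← ENNReal.rpow_mul, mul_one_div_cancel hp.ne', ENNReal.rpow_one]
      _ ≤ F x ^ (1 / p) := ENNReal.rpow_le_rpow (hF1 x) (by positivity)
  · exact ENNReal.continuous_rpow_const.comp_lowerSemicontinuous hF2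
      (ENNReal.monotone_rpow_of_nonneg (by positivity))
  · intro x
    obtain ⟨U, hU, hfin⟩ := hF3 x
    refine ⟨U, hU, ?_⟩
    simpa only [← ENNReal.rpow_mul, one_div_mul_cancel hp.ne', ENNReal.rpow_one] using hfin

/-- A curve has compact range, hence lies in one of countably many balls; the cut-offs of `ρ` to
these balls are dominated by one function in `L^p`. -/
theorem exists_global_of_locally [BorelSpace X] [ProperSpace X] {μ : Measure X} {p : ℝ}
    (hp : 0 < p) {ρ : X → ℝ≥0∞} (hm : Measurable ρ) (h : LocallyLp μ p ρ) :
    ∃ ρ' : X → ℝ≥0∞, Measurable ρ' ∧ ∫⁻ z, ρ' z ^ p ∂μ ≠ ∞ ∧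
      ∀ γ : Curve X, lineIntegral ρ' γ ≠ ∞ → lineIntegral ρ γ ≠ ∞ := by
  rcases isEmpty_or_nonempty X with hE | ⟨⟨x₀⟩⟩
  · exact ⟨ρ, hm, by simp [Measure.eq_zero_of_isEmpty μ], fun _ h => h⟩
  have hmB : ∀ n : ℕ, MeasurableSet (Metric.closedBall x₀ (n : ℝ)) :=
    fun n => Metric.isClosed_closedBall.measurableSet
  obtain ⟨ρ', h1, h2, h3⟩ := exists_dominating (μ := μ) hp
    (ρ := fun n : ℕ => (Metric.closedBall x₀ (n : ℝ)).indicator ρ)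
    (fun n => hm.indicator (hmB n)) (by
      intro n
      have e : ∀ z, (Metric.closedBall x₀ (n : ℝ)).indicator ρ z ^ p =
          (Metric.closedBall x₀ (n : ℝ)).indicator (fun z => ρ z ^ p) z := by
        intro z
        by_cases hz : z ∈ Metric.closedBall x₀ (n : ℝ)
        · simp only [indicator_of_mem hz]
        · simp only [indicator_of_notMem hz, ENNReal.zero_rpow_of_pos hp]
      simp only [e]
      rw [lintegral_indicator (hmB n)]
      exact (h.lt_top_of_isCompact (isCompact_closedBall _ _)).ne)
  refine ⟨ρ', h1, h2, fun γ hγ => ?_⟩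
  obtain ⟨r, hr⟩ := (isCompact_range γ.continuous).isBounded.subset_closedBall x₀
  obtain ⟨n, hn⟩ := exists_nat_ge r
  obtain ⟨c, hc, hle⟩ := h3 n
  have hfin := lineIntegral_ne_top_of_mul_le hc hle hγ
  have hrect := rectifiable_of_lineIntegral_ne_top hγ
  rw [lineIntegral_eq hrect (hm.indicator (hmB n))] at hfin
  rw [lineIntegral_eq hrect hm]
  convert hfin using 4 with t
  rw [indicator_of_mem]
  exact Metric.closedBall_subset_closedBall hn (hr (mem_range_self t))

/-- A family of curves is exceptional if and only if some `L^p` function has infinite integral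
along each of its curves. -/
theorem exists_of_modulus_eq_zero {μ : Measure X} {p : ℝ} (hp : 0 < p) {Γ : Set (Curve X)}
    (h : modulus μ p Γ = 0) :
    ∃ ρ : X → ℝ≥0∞, Measurable ρ ∧ ∫⁻ z, ρ z ^ p ∂μ ≠ ∞ ∧ ∀ γ ∈ Γ, lineIntegral ρ γ = ∞ := by
  -- `δ n` bounds the energy of an admissible `ρ n` that is then multiplied by `n + 1`: the energies
  -- stay summable, while the integral along each curve of `Γ` exceeds every `n`.
  obtain ⟨δ, δ0, hδ⟩ := ENNReal.exists_pos_tsum_mul_lt_of_countable (ε := 1) one_ne_zero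
    (fun n : ℕ => ((n : ℝ≥0∞) + 1) ^ p)
    fun n => ENNReal.rpow_ne_top_of_nonneg hp.le (ENNReal.add_ne_top.2 ⟨ENNReal.natCast_ne_top n,
      ENNReal.one_ne_top⟩)
  have hex : ∀ n : ℕ, ∃ ρ : X → ℝ≥0∞, Measurable ρ ∧ (∀ γ ∈ Γ, 1 ≤ lineIntegral ρ γ) ∧
      ∫⁻ x, ρ x ^ p ∂μ < δ n := by
    intro n
    have : modulus μ p Γ < δ n := by rw [h]; exact_mod_cast δ0 n
    simp only [modulus, iInf_lt_iff] at this
    obtain ⟨ρ, h1, h2, h3⟩ := this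
    exact ⟨ρ, h1, h2, h3⟩
  choose ρ hm hadm hint using hex
  have hm' : ∀ n : ℕ, Measurable fun x => ((n : ℝ≥0∞) + 1) ^ p * ρ n x ^ p :=
    fun n => ((hm n).pow_const p).const_mul _
  refine ⟨fun x => (∑' n : ℕ, ((n : ℝ≥0∞) + 1) ^ p * ρ n x ^ p) ^ (1 / p),
    (Measurable.tsum hm').pow_const _, ?_, fun γ hγ => ?_⟩
  · simp only [← ENNReal.rpow_mul, one_div_mul_cancel hp.ne', ENNReal.rpow_one]
    rw [lintegral_tsum fun n => (hm' n).aemeasurable]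
    refine ne_top_of_lt (lt_of_le_of_lt (ENNReal.tsum_le_tsum fun n => ?_) hδ)
    rw [lintegral_const_mul _ ((hm n).pow_const p)]
    gcongr
    exact (hint n).le
  · refine ENNReal.eq_top_of_forall_nnreal_le fun r => ?_
    obtain ⟨n, hn⟩ := exists_nat_ge r
    have hle : ∀ x, ((n : ℝ≥0∞) + 1) * ρ n x ≤
        (∑' n : ℕ, ((n : ℝ≥0∞) + 1) ^ p * ρ n x ^ p) ^ (1 / p) := by
      intro x
      calc ((n : ℝ≥0∞) + 1) * ρ n x = (((n : ℝ≥0∞) + 1) ^ p * ρ n x ^ p) ^ (1 / p) := by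
            rw [← ENNReal.mul_rpow_of_nonneg _ _ hp.le, ← ENNReal.rpow_mul,
              mul_one_div_cancel hp.ne', ENNReal.rpow_one]
        _ ≤ _ := by
            gcongr
            exact ENNReal.le_tsum (f := fun n : ℕ => ((n : ℝ≥0∞) + 1) ^ p * ρ n x ^ p) n
    calc (r : ℝ≥0∞) ≤ (n : ℝ≥0∞) := by exact_mod_cast hn
      _ ≤ ((n : ℝ≥0∞) + 1) * 1 := by rw [mul_one]; exact le_self_add
      _ ≤ ((n : ℝ≥0∞) + 1) * lineIntegral (ρ n) γ := by
          gcongr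
          exact hadm n γ hγ
      _ ≤ _ := (mul_lineIntegral_le _ _ _).trans (lineIntegral_mono hle γ)

/-- Every positive multiple `c ρ` is admissible, and its energy `c ^ p ∫ ρ ^ p` tends to zero with
`c`. -/
theorem modulus_eq_zero_of_exists {μ : Measure X} {p : ℝ} (hp : 0 < p) {Γ : Set (Curve X)}
    {ρ : X → ℝ≥0∞} (hm : Measurable ρ) (hint : ∫⁻ z, ρ z ^ p ∂μ ≠ ∞)
    (h : ∀ γ ∈ Γ, lineIntegral ρ γ = ∞) : modulus μ p Γ = 0 := by
  have key : ∀ c : ℝ≥0∞, c ≠ 0 → modulus μ p Γ ≤ c ^ p * ∫⁻ z, ρ z ^ p ∂μ := by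
    intro c hc
    refine (iInf_le _ (fun x => c * ρ x)).trans ((iInf_le _ (hm.const_mul c)).trans
      ((iInf_le _ fun γ hγ => ?_).trans ?_))
    · refine le_trans ?_ (mul_lineIntegral_le c ρ γ)
      rw [h γ hγ, ENNReal.mul_top hc]
      exact le_top
    · simp only [ENNReal.mul_rpow_of_nonneg _ _ hp.le]
      rw [lintegral_const_mul _ (hm.pow_const p)]
  have hlim : Tendsto (fun c : ℝ≥0∞ => c ^ p * ∫⁻ z, ρ z ^ p ∂μ) (𝓝[>] 0) (𝓝 0) := by
    have h1 : Tendsto (fun c : ℝ≥0∞ => c ^ p) (𝓝 0) (𝓝 0) := by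
      have := (ENNReal.continuous_rpow_const (y := p)).tendsto 0
      rwa [ENNReal.zero_rpow_of_pos hp] at this
    have h2 := ENNReal.Tendsto.mul_const (b := ∫⁻ z, ρ z ^ p ∂μ) h1 (Or.inr hint)
    rw [zero_mul] at h2
    exact h2.mono_left nhdsWithin_le_nhds
  have : (𝓝[>] (0 : ℝ≥0∞)).NeBot := nhdsGT_neBot_of_exists_gt ⟨1, one_pos⟩
  exact le_antisymm (ge_of_tendsto hlim
    (eventually_mem_nhdsWithin.mono fun c hc => key c (ne_of_gt hc))) bot_le

end NullFamilies


/-! ## Curves as limits of discrete chains -/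

section Chains

variable {X : Type*} [MetricSpace X]

/-- The infimum of `h` over the ball of radius `r`, truncated at the level `n`. -/
def truncEnv (h : X → ℝ≥0∞) (n : ℕ) (r : ℝ) (x : X) : ℝ≥0∞ :=
  min (n : ℝ≥0∞) (⨅ y ∈ Metric.ball x r, h y)

theorem truncEnv_le_nat (h : X → ℝ≥0∞) (n : ℕ) (r : ℝ) (x : X) : truncEnv h n r x ≤ n :=
  min_le_left _ _

theorem truncEnv_le {h : X → ℝ≥0∞} {n : ℕ} {r : ℝ} {x y : X} (hy : dist y x < r) :
    truncEnv h n r x ≤ h y := (min_le_right _ _).trans (iInf₂_le y hy)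

theorem truncEnv_le_truncEnv {h : X → ℝ≥0∞} {n m : ℕ} (hnm : n ≤ m) {r s : ℝ} {x y : X}
    (hxy : Metric.ball y s ⊆ Metric.ball x r) : truncEnv h n r x ≤ truncEnv h m s y :=
  min_le_min (by exact_mod_cast hnm) (biInf_mono hxy)

theorem le_truncEnv {h : X → ℝ≥0∞} {c : ℝ≥0∞} (hc : ∀ x, c ≤ h x) {n : ℕ} (hn : c ≤ n) (r : ℝ)
    (x : X) : c ≤ truncEnv h n r x := le_min hn (le_iInf₂ fun y _ => hc y)

theorem measurable_truncEnv [MeasurableSpace X] [BorelSpace X] (h : X → ℝ≥0∞) (n : ℕ) (r : ℝ) :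
    Measurable (truncEnv h n r) := by
  refine measurable_const.min (measurable_of_Iio fun a => ?_)
  have : (fun x => ⨅ y ∈ Metric.ball x r, h y) ⁻¹' Iio a =
      ⋃ y ∈ {y | h y < a}, Metric.ball y r := by
    ext x
    simp only [mem_preimage, mem_Iio, iInf_lt_iff, mem_iUnion, Metric.mem_ball, mem_ofPred_eq,
      exists_prop]
    exact ⟨fun ⟨y, h1, h2⟩ => ⟨y, h2, by rwa [dist_comm]⟩,
      fun ⟨y, h1, h2⟩ => ⟨y, by rwa [dist_comm], h1⟩⟩
  rw [this]
  exact (isOpen_biUnion fun _ _ => Metric.isOpen_ball).measurableSet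

theorem monotone_truncEnv (h : X → ℝ≥0∞) :
    Monotone fun k : ℕ => truncEnv h k (1 / ((k : ℝ) + 1)) := by
  intro k l hkl x
  refine truncEnv_le_truncEnv hkl (Metric.ball_subset_ball ?_)
  exact one_div_le_one_div_of_le (by positivity) (by gcongr)

/-- Lower semicontinuity keeps the infimum over small balls above any number less than `h x`. The
envelopes are bounded and increase to `h`, so estimates for them pass to `h` by monotone
convergence. -/
theorem iSup_truncEnv {h : X → ℝ≥0∞} (hh : LowerSemicontinuous h) (x : X) :
    ⨆ k : ℕ, truncEnv h k (1 / ((k : ℝ) + 1)) x = h x := by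
  apply le_antisymm
  · refine iSup_le fun k => truncEnv_le ?_
    rw [dist_self]
    positivity
  · refine le_of_forall_lt fun a ha => ?_
    obtain ⟨b, hab, hb⟩ := exists_between ha
    obtain ⟨r, hr, hball⟩ := Metric.eventually_nhds_iff.1 (hh x b hb)
    obtain ⟨k₁, hk₁⟩ := exists_nat_one_div_lt hr
    obtain ⟨k₂, hk₂⟩ := ENNReal.exists_nat_gt (ne_top_of_lt hab)
    refine lt_of_lt_of_le ?_ (le_iSup (fun k : ℕ => truncEnv h k (1 / ((k : ℝ) + 1)) x) (max k₁ k₂))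
    refine lt_min (hk₂.trans_le (by exact_mod_cast le_max_right _ _)) (hab.trans_le ?_)
    refine le_iInf₂ fun y hy => (hball ?_).le
    refine (Metric.mem_ball.1 hy).trans_le
      ((one_div_le_one_div_of_le (by positivity) ?_).trans hk₁.le)
    have : (k₁ : ℝ) ≤ (max k₁ k₂ : ℕ) := by exact_mod_cast le_max_left _ _
    linarith

/-- The cost of the first `k` steps of a chain, a step from `a` to `b` having cost `w(a)d(a,b)`. -/
def chainCost (w : X → ℝ≥0∞) (x : ℕ → X) (k : ℕ) : ℝ≥0∞ :=
  ∑ i ∈ Finset.range k, w (x i) * edist (x i) (x (i + 1))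

theorem chainCost_succ (w : X → ℝ≥0∞) (x : ℕ → X) (k : ℕ) :
    chainCost w x (k + 1) = chainCost w x k + w (x k) * edist (x k) (x (k + 1)) :=
  Finset.sum_range_succ _ _

theorem chainCost_mono (w : X → ℝ≥0∞) (x : ℕ → X) : Monotone (chainCost w x) :=
  monotone_nat_of_le_succ fun k => by rw [chainCost_succ]; exact le_self_add

theorem chainCost_add_le {w : X → ℝ≥0∞} {x : ℕ → X} {a : ℝ≥0∞} {i j : ℕ} (hij : i ≤ j)
    (h : ∀ l, i ≤ l → l < j → a ≤ w (x l)) :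
    chainCost w x i + a * edist (x i) (x j) ≤ chainCost w x j := by
  induction j, hij using Nat.le_induction with
  | base => simp
  | succ j hij ih =>
    rw [chainCost_succ]
    calc chainCost w x i + a * edist (x i) (x (j + 1))
        ≤ chainCost w x i + a * (edist (x i) (x j) + edist (x j) (x (j + 1))) := by
          gcongr
          exact edist_triangle _ _ _
      _ = (chainCost w x i + a * edist (x i) (x j)) + a * edist (x j) (x (j + 1)) := by ring
      _ ≤ chainCost w x j + w (x j) * edist (x j) (x (j + 1)) := by
          gcongr
          · exact ih fun l h1 h2 => h l h1 (h2.trans j.lt_succ_self)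
          · exact h j hij j.lt_succ_self

/-- A chain of small cost, parametrized proportionally to the cost. -/
theorem exists_stepFunction_of_chain {h : X → ℝ≥0∞} {c : ℝ≥0} (hc0 : 0 < c)
    (hc : ∀ x, (c : ℝ≥0∞) ≤ h x) {n : ℕ} (hn : (c : ℝ≥0∞) ≤ n) {ε : ℝ} {η : ℝ≥0∞}
    (hη : (n : ℝ≥0∞) * ENNReal.ofReal ε ≤ η) {M : ℝ≥0} {x : ℕ → X} {k : ℕ}
    (hx : ∀ i < k, dist (x i) (x (i + 1)) < ε) (hM : chainCost (truncEnv h n ε) x k ≤ M) :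
    ∃ φ : unitInterval → X, φ 0 = x 0 ∧ φ 1 = x k ∧ ∀ s t : unitInterval, s ≤ t →
      c * edist (φ s) (φ t) ≤ ENNReal.ofReal (t - s) * M + η ∧
      ∀ R : ℝ, ENNReal.ofReal (t - s) * M + η + c * ENNReal.ofReal ε ≤ c * ENNReal.ofReal R →
        truncEnv h n R (φ s) * edist (φ s) (φ t) ≤ ENNReal.ofReal (t - s) * M + η := by
  classical
  set w := truncEnv h n ε with hw
  set S := chainCost w x with hS
  have hcw : ∀ y, (c : ℝ≥0∞) ≤ w y := le_truncEnv hc hn ε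
  -- At time `s` the path sits at the last vertex reached at cost at most `s M`. One further step
  -- costs at most `n ε ≤ η`, which is the error in all the estimates.
  let idx : unitInterval → ℕ := fun s => Nat.findGreatest (fun i => S i ≤ ENNReal.ofReal s * M) k
  have hS0 : S 0 = 0 := by simp [hS, chainCost]
  have idx_le : ∀ s, idx s ≤ k := fun s => Nat.findGreatest_le _
  have idx_spec : ∀ s : unitInterval, S (idx s) ≤ ENNReal.ofReal s * M := fun s =>
    Nat.findGreatest_spec (P := fun i => S i ≤ ENNReal.ofReal s * M) (Nat.zero_le k)
      (by rw [hS0]; exact bot_le)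
  have idx_mono : Monotone idx := by
    intro s t hst
    refine Nat.le_findGreatest (idx_le s) ((idx_spec s).trans ?_)
    gcongr
  have hS_ne_top : ∀ i ≤ k, S i ≠ ∞ := fun i hi =>
    ne_top_of_le_ne_top ENNReal.coe_ne_top ((chainCost_mono w x hi).trans hM)
  have hc0' : (c : ℝ≥0∞) ≠ 0 := by simpa using hc0.ne'
  have key : ∀ s t : unitInterval, s ≤ t →
      S (idx t) ≤ S (idx s) + (ENNReal.ofReal (t - s) * M + η) := by
    intro s t hst
    rcases (idx_le s).lt_or_eq with hlt | heq
    · have h1 : ENNReal.ofReal s * M ≤ S (idx s + 1) := by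
        by_contra! hcon
        have := Nat.le_findGreatest (P := fun i => S i ≤ ENNReal.ofReal s * M)
          (m := idx s + 1) hlt hcon.le
        exact absurd this (not_le.2 (Nat.lt_succ_self _))
      have h2 : w (x (idx s)) * edist (x (idx s)) (x (idx s + 1)) ≤ η := by
        refine le_trans ?_ hη
        gcongr
        · exact truncEnv_le_nat _ _ _ _
        · rw [edist_dist]
          exact ENNReal.ofReal_le_ofReal (hx _ hlt).le
      calc S (idx t) ≤ ENNReal.ofReal t * M := idx_spec t
        _ = ENNReal.ofReal s * M + ENNReal.ofReal (t - s) * M := by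
            rw [← add_mul, ← ENNReal.ofReal_add s.2.1 (sub_nonneg.2 hst), add_sub_cancel]
        _ ≤ S (idx s + 1) + ENNReal.ofReal (t - s) * M := by gcongr
        _ ≤ S (idx s) + η + ENNReal.ofReal (t - s) * M := by
            rw [hS, chainCost_succ]
            gcongr
        _ = _ := by ring
    · have : idx t = idx s := le_antisymm ((idx_le t).trans heq.ge) (idx_mono hst)
      rw [this]
      exact le_self_add
  refine ⟨fun s => x (idx s), ?_, ?_, fun s t hst => ?_⟩
  · have h1 := idx_spec 0
    have h2 := chainCost_add_le (w := w) (x := x) (a := c) (Nat.zero_le (idx 0)) fun l _ _ => hcw _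
    have h3 : (c : ℝ≥0∞) * edist (x 0) (x (idx 0)) ≤ 0 := by
      refine (le_add_self.trans h2).trans (h1.trans ?_)
      simp
    rcases mul_eq_zero.1 (le_zero_iff.1 h3) with h | h
    · exact absurd h hc0'
    · exact (edist_eq_zero.1 h).symm
  · have : idx 1 = k := by
      refine le_antisymm (idx_le 1) (Nat.le_findGreatest le_rfl ?_)
      simpa using hM
    simp only [this]
  · have hst' := idx_mono hst
    have hfin : S (idx s) ≠ ∞ := hS_ne_top _ (idx_le s)
    have hA : ∀ l, idx s ≤ l → l ≤ idx t →
        c * edist (x (idx s)) (x l) ≤ ENNReal.ofReal (t - s) * M + η := by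
      intro l h1 h2
      have := (chainCost_add_le (w := w) (x := x) (a := c) h1 fun l _ _ => hcw _).trans
        ((chainCost_mono w x h2).trans (key s t hst))
      exact (ENNReal.add_le_add_iff_left hfin).1 this
    refine ⟨hA _ hst' le_rfl, fun R hR => ?_⟩
    -- By the lower bound `c` on the weights, the vertices between times `s` and `t` stay so close
    -- to `x (idx s)` that their `ε`-balls lie in its `R`-ball; hence their weights are at least the
    -- envelope of radius `R` there.
    have := (chainCost_add_le (w := w) (x := x) (a := truncEnv h n R (x (idx s))) hst'
      fun l h1 h2 => truncEnv_le_truncEnv le_rfl fun y hy => ?_).trans (key s t hst)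
    · exact (ENNReal.add_le_add_iff_left hfin).1 this
    · have h4 : edist y (x l) < ENNReal.ofReal ε := by
        rw [edist_dist]
        exact (ENNReal.ofReal_lt_ofReal_iff (lt_of_le_of_lt dist_nonneg hy)).2 hy
      have h5 : c * edist y (x (idx s)) < c * ENNReal.ofReal R := by
        calc c * edist y (x (idx s)) ≤ c * (edist y (x l) + edist (x l) (x (idx s))) := by
              gcongr
              exact edist_triangle _ _ _
          _ = c * edist (x (idx s)) (x l) + c * edist y (x l) := by
              rw [mul_add, add_comm, edist_comm (x l)]
          _ < (ENNReal.ofReal (t - s) * M + η) + c * ENNReal.ofReal ε := by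
              refine ENNReal.add_lt_add_of_le_of_lt ?_ (hA l h1 h2.le) ?_
              · exact ENNReal.mul_ne_top ENNReal.coe_ne_top (edist_ne_top _ _)
              · exact ENNReal.mul_lt_mul_right hc0' ENNReal.coe_ne_top h4
          _ ≤ _ := hR
      have h6 : edist y (x (idx s)) < ENNReal.ofReal R := lt_of_mul_lt_mul_left' h5
      rw [edist_dist] at h6
      exact (ENNReal.ofReal_lt_ofReal_iff_of_nonneg dist_nonneg).1 h6

/-- A Lipschitz curve whose speed is controlled by `1 / h` has `h`-length at most `M`. -/
theorem lineIntegral_le_of_edist_le [MeasurableSpace X] [BorelSpace X] {h : X → ℝ≥0∞}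
    (hh : LowerSemicontinuous h) {c M : ℝ≥0} (hc0 : 0 < c) {γ : Curve X}
    (h1 : ∀ s t : unitInterval, s ≤ t → c * edist (γ s) (γ t) ≤ ENNReal.ofReal (t - s) * M)
    (h2 : ∀ s t : unitInterval, s ≤ t → ∀ R : ℝ,
      ENNReal.ofReal (t - s) * M < c * ENNReal.ofReal R → ∀ m : ℕ,
        truncEnv h m R (γ s) * edist (γ s) (γ t) ≤ ENNReal.ofReal (t - s) * M) :
    lineIntegral h γ ≤ M := by
  have hc0' : (c : ℝ≥0∞) ≠ 0 := by simpa using hc0.ne'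
  have hvol : ∀ a : ℝ≥0∞, ∀ t : unitInterval, (a • (volume : Measure unitInterval)) {t} = 0 := by
    intro a t
    simp
  have hvolI : ∀ (a : ℝ≥0∞) (s t : unitInterval), (a • (volume : Measure unitInterval)) (Icc s t) =
      a * ENNReal.ofReal (t - s) := by
    intro a s t
    rw [Measure.smul_apply, unitInterval.volume_Icc, smul_eq_mul]
  have hrect : curveLength γ ≠ ∞ := by
    have := eVariationOn_le_measure (hvol ((M : ℝ≥0∞) / c)) (c := γ) (s := 0) (t := 1)
      fun a b hab _ _ => by
        rw [hvolI, mul_comm, ← mul_div_assoc, ENNReal.le_div_iff_mul_le (Or.inl hc0')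
          (Or.inl ENNReal.coe_ne_top), mul_comm]
        exact h1 a b hab
    rw [← unitInterval.univ_eq_Icc] at this
    refine ne_top_of_le_ne_top ?_ this
    rw [Measure.smul_apply, smul_eq_mul, measure_univ, mul_one]
    exact ENNReal.div_ne_top ENNReal.coe_ne_top hc0'
  set H : ℕ → X → ℝ≥0∞ := fun k => truncEnv h k (1 / ((k : ℝ) + 1)) with hH
  have hHm : ∀ k, Measurable fun t => H k (γ t) := fun k =>
    (measurable_truncEnv h k _).comp γ.continuous.measurable
  have hle : ∀ k, ∫⁻ t, H k (γ t) ∂(lenMeas γ) ≤ M := by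
    intro k
    have hfinH : ∫⁻ t, H k (γ t) ∂(lenMeas γ) ≠ ∞ := by
      refine ne_top_of_le_ne_top ?_ (lintegral_mono fun t => truncEnv_le_nat h k _ (γ t))
      rw [lintegral_const]
      exact ENNReal.mul_ne_top (ENNReal.natCast_ne_top k) (measure_ne_top _ _)
    have : IsFiniteMeasure ((lenMeas γ).withDensity fun t => H k (γ t)) :=
      isFiniteMeasure_withDensity hfinH
    have : IsFiniteMeasure ((M : ℝ≥0∞) • (volume : Measure unitInterval)) :=
      Measure.smul_finite _ ENNReal.coe_ne_top
    -- On a parameter interval of length `δ` the curve moves by less than half of the radius `1 / (k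
    -- + 1)`.
    obtain ⟨δ, hδ, hδM⟩ : ∃ δ : ℝ, 0 < δ ∧ 2 * (δ * M) < c * (1 / ((k : ℝ) + 1)) / 2 := by
      have hpos : 0 < c * (1 / ((k : ℝ) + 1)) / 2 := by positivity
      refine ⟨c * (1 / ((k : ℝ) + 1)) / 2 / (4 * (M + 1)), by positivity, ?_⟩
      set A := c * (1 / ((k : ℝ) + 1)) / 2
      rw [div_mul_eq_mul_div, ← mul_div_assoc, div_lt_iff₀ (by positivity)]
      nlinarith [(NNReal.coe_nonneg M), mul_nonneg hpos.le (NNReal.coe_nonneg M)]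
    have hmeas := measure_le_of_Icc_le (M₁ := (lenMeas γ).withDensity fun t => H k (γ t))
      (hvol M) hδ fun s t hst hd => ?_
    · have := hmeas univ
      rwa [withDensity_apply _ MeasurableSet.univ, setLIntegral_univ, Measure.smul_apply,
        measure_univ, smul_eq_mul, mul_one] at this
    rw [withDensity_apply _ measurableSet_Icc, hvolI]
    have hts : (t : ℝ) - s ≤ δ := by
      rw [dist_comm, Subtype.dist_eq, Real.dist_eq] at hd
      exact (le_abs_self _).trans hd
    -- The speed near `γ r` is at most `M / H k (γ r)`: for `a` in `[s,t]`, the ball of half the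
    -- radius about `γ a` lies in the full ball about `γ r`, so the hypothesis with half the radius
    -- applies at `γ a`.
    have hpt : ∀ r ∈ Icc s t, H k (γ r) * lenMeas γ (Icc s t) ≤ M * ENNReal.ofReal (t - s) := by
      intro r hr
      rcases eq_or_ne (H k (γ r)) 0 with h0 | h0
      · rw [h0, zero_mul]; exact bot_le
      have hHfin : H k (γ r) ≠ ∞ :=
        ne_top_of_le_ne_top (ENNReal.natCast_ne_top k) (truncEnv_le_nat h k _ (γ r))
      have hv := eVariationOn_le_measure (hvol ((M : ℝ≥0∞) / H k (γ r))) (c := γ) (s := s) (t := t)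
        fun a b hab hsa hbt => by
          rw [hvolI, mul_comm, ← mul_div_assoc, ENNReal.le_div_iff_mul_le (Or.inl h0)
            (Or.inl hHfin), mul_comm]
          have hba : (b : ℝ) - a ≤ δ := by
            have h3 : (s : ℝ) ≤ a := hsa
            have h4 : (b : ℝ) ≤ t := hbt
            linarith
          have hba0 : (0 : ℝ) ≤ (b : ℝ) - a := sub_nonneg.2 hab
          have hR : ENNReal.ofReal (b - a) * M <
              c * ENNReal.ofReal ((1 / ((k : ℝ) + 1)) / 2) := by
            rw [← ENNReal.ofReal_coe_nnreal, ← ENNReal.ofReal_coe_nnreal (p := c),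
              ← ENNReal.ofReal_mul hba0, ← ENNReal.ofReal_mul (NNReal.coe_nonneg c)]
            refine (ENNReal.ofReal_lt_ofReal_iff (by positivity)).2 ?_
            have : ((b : ℝ) - a) * M ≤ δ * M := mul_le_mul_of_nonneg_right hba (NNReal.coe_nonneg M)
            have : 0 ≤ δ * M := mul_nonneg hδ.le (NNReal.coe_nonneg M)
            linarith
          refine le_trans ?_ (h2 a b hab _ hR k)
          gcongr
          refine truncEnv_le_truncEnv le_rfl (Metric.ball_subset_ball' ?_)
          have hda : dist (γ a) (γ r) ≤ (1 / ((k : ℝ) + 1)) / 2 := by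
            have hgen : ∀ p q : unitInterval, p ≤ q → s ≤ p → q ≤ t →
                dist (γ p) (γ q) ≤ (1 / ((k : ℝ) + 1)) / 2 := by
              intro p q hpq hsp hqt
              have h3 : (s : ℝ) ≤ p := hsp
              have h4 : (q : ℝ) ≤ t := hqt
              have h5 : (0 : ℝ) ≤ (q : ℝ) - p := sub_nonneg.2 hpq
              have h6 := h1 p q hpq
              rw [edist_dist, ← ENNReal.ofReal_coe_nnreal, ← ENNReal.ofReal_coe_nnreal (p := M),
                ← ENNReal.ofReal_mul (NNReal.coe_nonneg c), ← ENNReal.ofReal_mul h5,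
                ENNReal.ofReal_le_ofReal_iff (mul_nonneg h5 (NNReal.coe_nonneg M))] at h6
              have h7 : ((q : ℝ) - p) * M ≤ δ * M :=
                mul_le_mul_of_nonneg_right (by linarith) (NNReal.coe_nonneg M)
              have h8 : 0 ≤ δ * M := mul_nonneg hδ.le (NNReal.coe_nonneg M)
              have h9 : c * dist (γ p) (γ q) ≤ c * ((1 / ((k : ℝ) + 1)) / 2) := by
                linarith
              exact le_of_mul_le_mul_left h9 hc0
            rcases le_total a r with har | har
            · exact hgen a r har hsa hr.2
            · rw [dist_comm]
              exact hgen r a har hr.1 (hab.trans hbt)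
          linarith
      rw [← lenMeas_Icc hrect hst, hvolI] at hv
      calc H k (γ r) * lenMeas γ (Icc s t)
          ≤ H k (γ r) * ((M : ℝ≥0∞) / H k (γ r) * ENNReal.ofReal (t - s)) := by gcongr
        _ = M * ENNReal.ofReal (t - s) := by
            rw [← mul_assoc, ENNReal.mul_div_cancel h0 hHfin]
    calc ∫⁻ r in Icc s t, H k (γ r) ∂(lenMeas γ)
        ≤ ∫⁻ _ in Icc s t, (⨆ r ∈ Icc s t, H k (γ r)) ∂(lenMeas γ) :=
          setLIntegral_mono' measurableSet_Icc fun r hr => le_iSup₂ (f := fun r (_ : r ∈ Icc s t) =>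
            H k (γ r)) r hr
      _ = (⨆ r ∈ Icc s t, H k (γ r)) * lenMeas γ (Icc s t) := by
          rw [lintegral_const, Measure.restrict_apply_univ]
      _ ≤ M * ENNReal.ofReal (t - s) := by
          simp only [ENNReal.iSup_mul]
          exact iSup₂_le hpt
  rw [lineIntegral_eq hrect hh.measurable]
  have : ∀ t, h (γ t) = ⨆ k, H k (γ t) := fun t => (iSup_truncEnv hh (γ t)).symm
  simp only [this]
  rw [lintegral_iSup hHm fun k l hkl t => monotone_truncEnv h hkl (γ t)]
  exact iSup_le hle

/-- Parametrized by cost, the chains become step functions that are Lipschitz with constant `M / c`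
up to a vanishing error. Steps shorter than `1 / (n + 1) ^ 2` are used because the error is `n`
times the step length. Pointwise limits exist by properness and inherit both the Lipschitz bound and
the envelope bounds. -/
theorem exists_curve_of_chains [ProperSpace X] [MeasurableSpace X] [BorelSpace X] {h : X → ℝ≥0∞}
    (hh : LowerSemicontinuous h) {c M : ℝ≥0} (hc0 : 0 < c) (hc : ∀ x, (c : ℝ≥0∞) ≤ h x) {z₁ z₂ : X}
    (H : ∀ n : ℕ, ∃ (x : ℕ → X) (k : ℕ), x 0 = z₁ ∧ x k = z₂ ∧
      (∀ i < k, dist (x i) (x (i + 1)) < 1 / ((n : ℝ) + 1) ^ 2) ∧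
      chainCost (truncEnv h n (1 / ((n : ℝ) + 1) ^ 2)) x k ≤ M) :
    ∃ γ : Curve X, γ 0 = z₁ ∧ γ 1 = z₂ ∧ lineIntegral h γ ≤ M := by
  -- Starting at index `N ≥ c` ensures that truncation does not destroy the lower bound `c` of the
  -- weights.
  obtain ⟨N, hN⟩ := exists_nat_ge (c : ℝ)
  have hc0' : (c : ℝ≥0∞) ≠ 0 := by simpa using hc0.ne'
  let ε : ℕ → ℝ := fun n => 1 / (((n + N : ℕ) : ℝ) + 1) ^ 2
  let η : ℕ → ℝ≥0∞ := fun n => ENNReal.ofReal (1 / (((n + N : ℕ) : ℝ) + 1))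
  have hη : ∀ n, ((n + N : ℕ) : ℝ≥0∞) * ENNReal.ofReal (ε n) ≤ η n := by
    intro n
    rw [← ENNReal.ofReal_natCast, ← ENNReal.ofReal_mul (by positivity)]
    refine ENNReal.ofReal_le_ofReal ?_
    simp only [ε]
    rw [mul_one_div, div_le_div_iff₀ (by positivity) (by positivity)]
    nlinarith [(Nat.cast_nonneg (n + N) : (0 : ℝ) ≤ ((n + N : ℕ) : ℝ))]
  have hstep : ∀ n : ℕ, ∃ φ : unitInterval → X, φ 0 = z₁ ∧ φ 1 = z₂ ∧
      ∀ s t : unitInterval, s ≤ t →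
      c * edist (φ s) (φ t) ≤ ENNReal.ofReal (t - s) * M + η n ∧
      ∀ R : ℝ, ENNReal.ofReal (t - s) * M + η n + c * ENNReal.ofReal (ε n) ≤ c * ENNReal.ofReal R →
        truncEnv h (n + N) R (φ s) * edist (φ s) (φ t) ≤ ENNReal.ofReal (t - s) * M + η n := by
    intro n
    obtain ⟨x, k, h0, hk, hx, hcost⟩ := H (n + N)
    rw [← h0, ← hk]
    refine exists_stepFunction_of_chain hc0 hc ?_ (hη n) hx hcost
    have : (c : ℝ) ≤ ((n + N : ℕ) : ℝ) := by
      push_cast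
      linarith [(Nat.cast_nonneg n : (0 : ℝ) ≤ (n : ℝ))]
    exact_mod_cast this
  choose φ φ0 φ1 hφ using hstep
  let 𝒰 : Ultrafilter ℕ := hyperfilter ℕ
  have h𝒰 : (𝒰 : Filter ℕ) ≤ atTop := Nat.hyperfilter_le_atTop
  have hη1 : ∀ n, η n ≤ 1 := by
    intro n
    rw [← ENNReal.ofReal_one]
    refine ENNReal.ofReal_le_ofReal ?_
    rw [div_le_one (by positivity)]
    linarith [(Nat.cast_nonneg (n + N) : (0 : ℝ) ≤ ((n + N : ℕ) : ℝ))]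
  have hshift : Tendsto (fun n : ℕ => n + N) atTop atTop := tendsto_add_atTop_nat N
  have hηlim : Tendsto η atTop (𝓝 0) := by
    have h1 := (tendsto_one_div_add_atTop_nhds_zero_nat (𝕜 := ℝ)).comp hshift
    have := ENNReal.tendsto_ofReal h1
    rwa [ENNReal.ofReal_zero] at this
  have hεlim : Tendsto (fun n => ENNReal.ofReal (ε n)) atTop (𝓝 0) := by
    have h1 := ((tendsto_one_div_add_atTop_nhds_zero_nat (𝕜 := ℝ)).comp hshift).pow 2
    have := ENNReal.tendsto_ofReal h1
    rw [zero_pow two_ne_zero, ENNReal.ofReal_zero] at this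
    refine this.congr fun n => ?_
    simp only [ε, Function.comp, one_div, inv_pow]
  have hlim : ∀ s, ∃ a, Tendsto (fun n => φ n s) 𝒰 (𝓝 a) := by
    intro s
    have hK := isCompact_closedBall z₁ (((M : ℝ) + 1) / c)
    obtain ⟨a, -, ha⟩ := hK.ultrafilter_le_nhds (𝒰.map fun n => φ n s) (by
      rw [le_principal_iff]
      change ∀ᶠ n in (𝒰 : Filter ℕ), φ n s ∈ Metric.closedBall z₁ (((M : ℝ) + 1) / c)
      refine Eventually.of_forall fun n => ?_
      have h1 := (hφ n 0 s unitInterval.nonneg').1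
      rw [φ0] at h1
      have h2 : (c : ℝ≥0∞) * edist z₁ (φ n s) ≤ ENNReal.ofReal (M + 1) := by
        refine h1.trans ?_
        rw [ENNReal.ofReal_add (NNReal.coe_nonneg M) zero_le_one, ENNReal.ofReal_one]
        refine add_le_add ?_ (hη1 n)
        rw [ENNReal.ofReal_coe_nnreal]
        refine mul_le_of_le_one_left' ?_
        rw [← ENNReal.ofReal_one]
        refine ENNReal.ofReal_le_ofReal ?_
        simpa using s.2.2
      rw [edist_dist, ← ENNReal.ofReal_coe_nnreal, ← ENNReal.ofReal_mul (NNReal.coe_nonneg c),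
        ENNReal.ofReal_le_ofReal_iff (by positivity)] at h2
      change dist (φ n s) z₁ ≤ _
      rw [dist_comm, le_div_iff₀ (by exact_mod_cast hc0), mul_comm]
      exact h2)
    exact ⟨a, ha⟩
  choose ψ hψ using hlim
  have hed : ∀ s t, Tendsto (fun n => edist (φ n s) (φ n t)) 𝒰 (𝓝 (edist (ψ s) (ψ t))) :=
    fun s t => (hψ s).edist (hψ t)
  have hrhs : ∀ s t : unitInterval, Tendsto (fun n => ENNReal.ofReal (t - s) * (M : ℝ≥0∞) + η n) 𝒰
      (𝓝 (ENNReal.ofReal (t - s) * M)) := by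
    intro s t
    have := (tendsto_const_nhds (x := ENNReal.ofReal ((t : ℝ) - s) * (M : ℝ≥0∞))).add
      (hηlim.mono_left h𝒰)
    rwa [add_zero] at this
  have h1 : ∀ s t : unitInterval, s ≤ t →
      c * edist (ψ s) (ψ t) ≤ ENNReal.ofReal (t - s) * M := by
    intro s t hst
    exact le_of_tendsto_of_tendsto' (ENNReal.Tendsto.const_mul (hed s t)
      (Or.inr ENNReal.coe_ne_top)) (hrhs s t) fun n => (hφ n s t hst).1
  have hlip : LipschitzWith (M / c) ψ := by
    have hgen : ∀ s t : unitInterval, s ≤ t → edist (ψ s) (ψ t) ≤ (M / c : ℝ≥0) * edist s t := by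
      intro s t hst
      have h3 : edist s t = ENNReal.ofReal (t - s) := by
        rw [edist_comm, Subtype.edist_eq, edist_dist, Real.dist_eq,
          abs_of_nonneg (sub_nonneg.2 (show (s : ℝ) ≤ t from hst))]
      rw [h3, ENNReal.coe_div hc0.ne', mul_comm, ← mul_div_assoc,
        ENNReal.le_div_iff_mul_le (Or.inl hc0') (Or.inl ENNReal.coe_ne_top), mul_comm]
      exact h1 s t hst
    intro s t
    rcases le_total s t with h | h
    · exact hgen s t h
    · rw [edist_comm, edist_comm s t]
      exact hgen t s h
  have hψ0 : ψ 0 = z₁ := tendsto_nhds_unique (hψ 0) (by simp only [φ0]; exact tendsto_const_nhds)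
  have hψ1 : ψ 1 = z₂ := tendsto_nhds_unique (hψ 1) (by simp only [φ1]; exact tendsto_const_nhds)
  refine ⟨⟨ψ, hlip.continuous⟩, hψ0, hψ1, lineIntegral_le_of_edist_le hh hc0 h1 ?_⟩
  intro s t hst R hR m
  change truncEnv h m R (ψ s) * edist (ψ s) (ψ t) ≤ _
  have hR0 : 0 < R := by
    by_contra! hneg
    rw [ENNReal.ofReal_of_nonpos hneg, mul_zero] at hR
    exact absurd hR not_lt_bot
  -- A slightly smaller radius leaves room to move the centre from `ψ s` to the nearby point `φ n
  -- s`.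
  obtain ⟨R', hR'R, hR'⟩ : ∃ R' < R, ENNReal.ofReal (t - s) * M < c * ENNReal.ofReal R' := by
    have hcont : Tendsto (fun r => (c : ℝ≥0∞) * ENNReal.ofReal r) (𝓝[<] R)
        (𝓝 (c * ENNReal.ofReal R)) :=
      (ENNReal.Tendsto.const_mul (ENNReal.continuous_ofReal.tendsto R)
        (Or.inr ENNReal.coe_ne_top)).mono_left nhdsWithin_le_nhds
    obtain ⟨r, hr1, hr2⟩ := ((hcont.eventually (lt_mem_nhds hR)).and self_mem_nhdsWithin).exists
    exact ⟨r, hr2, hr1⟩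
  have hsum : Tendsto (fun n => ENNReal.ofReal (t - s) * (M : ℝ≥0∞) + η n +
      c * ENNReal.ofReal (ε n)) 𝒰 (𝓝 (ENNReal.ofReal (t - s) * M)) := by
    have h3 := ENNReal.Tendsto.const_mul (a := (c : ℝ≥0∞)) (hεlim.mono_left h𝒰)
      (Or.inr ENNReal.coe_ne_top)
    have := (hrhs s t).add h3
    rwa [mul_zero, add_zero] at this
  refine le_of_tendsto_of_tendsto (ENNReal.Tendsto.const_mul (hed s t) (Or.inr ?_)) (hrhs s t) ?_
  · exact ne_top_of_le_ne_top (ENNReal.natCast_ne_top m) (truncEnv_le_nat _ _ _ _)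
  · have hball := (hψ s).eventually (Metric.ball_mem_nhds (ψ s) (sub_pos.2 hR'R))
    filter_upwards [hball, hsum.eventually (gt_mem_nhds hR'),
      (eventually_ge_atTop m).filter_mono h𝒰] with n hn1 hn2 hn3
    refine le_trans ?_ ((hφ n s t hst).2 R' hn2.le)
    gcongr
    refine truncEnv_le_truncEnv (hn3.trans (Nat.le_add_right n N)) (Metric.ball_subset_ball' ?_)
    have := Metric.mem_ball.1 hn1
    linarith

end Chains


/-! ## Curves from the Poincaré inequality -/

/-- The deviation of the mean over `B'` from `a` is at most the mean of the deviation, and enlarging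
the domain to `B` costs the ratio of the measures. This is the single step of the telescoping
argument. -/
theorem edist_setAverage_le {X : Type*} [MeasurableSpace X] {μ : Measure X} {v : X → ℝ}
    {B B' : Set X} (hsub : B' ⊆ B) {D : ℝ≥0∞}
    (hB'0 : μ B' ≠ 0) (hB : μ B ≠ ∞) (hD : μ B ≤ D * μ B') (hv : IntegrableOn v B μ) (a : ℝ) :
    edist (⨍ y in B', v y ∂μ) a ≤ D * ⨍⁻ y in B, ‖v y - a‖ₑ ∂μ := by
  have hB'fin : μ B' ≠ ∞ := ne_top_of_le_ne_top hB (measure_mono hsub)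
  have hB0 : μ B ≠ 0 := fun h => hB'0 (measure_mono_null hsub h)
  have hv' : IntegrableOn v B' μ := hv.mono_set hsub
  have hreal : μ.real B' ≠ 0 := (ENNReal.toReal_pos hB'0 hB'fin).ne'
  have e1 : (⨍ y in B', v y ∂μ) - a = ⨍ y in B', (v y - a) ∂μ := by
    rw [setAverage_eq, setAverage_eq, integral_sub hv' (integrableOn_const hB'fin),
      setIntegral_const, smul_sub, smul_smul, inv_mul_cancel₀ hreal, one_smul]
  have e2 : ‖⨍ y in B', (v y - a) ∂μ‖ₑ ≤ (∫⁻ y in B', ‖v y - a‖ₑ ∂μ) / μ B' := by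
    rw [setAverage_eq, enorm_smul, div_eq_mul_inv, mul_comm]
    refine mul_le_mul' (enorm_integral_le_lintegral_enorm _) ?_
    rw [Real.enorm_eq_ofReal (by positivity), measureReal_def, ← ENNReal.toReal_inv,
      ENNReal.ofReal_toReal (ENNReal.inv_ne_top.2 hB'0)]
  rw [edist_eq_enorm_sub, e1, setLAverage_eq]
  refine e2.trans ?_
  rw [ENNReal.div_le_iff hB'0 hB'fin]
  calc ∫⁻ y in B', ‖v y - a‖ₑ ∂μ ≤ ∫⁻ y in B, ‖v y - a‖ₑ ∂μ := lintegral_mono_set hsub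
    _ = (∫⁻ y in B, ‖v y - a‖ₑ ∂μ) / μ B * μ B := (ENNReal.div_mul_cancel hB0 hB).symm
    _ ≤ (∫⁻ y in B, ‖v y - a‖ₑ ∂μ) / μ B * (D * μ B') := by gcongr
    _ = _ := by ring

section Poincare

variable {X : Type*} [MetricSpace X]

/-- Truncation does not increase differences. It is needed because the chain cost is infinite at
points that no chain reaches. -/
theorem edist_toReal_min_le {a b d : ℝ≥0∞} (T : ℝ≥0) (h1 : a ≤ b + d) (h2 : b ≤ a + d) :
    edist (min a T).toReal (min b T).toReal ≤ d := by
  rcases eq_or_ne d ∞ with rfl | hd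
  · exact le_top
  have ha : min a (T : ℝ≥0∞) ≠ ∞ := ne_top_of_le_ne_top ENNReal.coe_ne_top (min_le_right _ _)
  have hb : min b (T : ℝ≥0∞) ≠ ∞ := ne_top_of_le_ne_top ENNReal.coe_ne_top (min_le_right _ _)
  have key : ∀ {a b : ℝ≥0∞}, a ≤ b + d → min b (T : ℝ≥0∞) ≠ ∞ →
      (min a (T : ℝ≥0∞)).toReal ≤ (min b (T : ℝ≥0∞)).toReal + d.toReal := by
    intro a b h hb
    rw [← ENNReal.toReal_add hb hd]
    refine ENNReal.toReal_mono (ENNReal.add_ne_top.2 ⟨hb, hd⟩) ?_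
    rcases le_total b T with h' | h'
    · rw [min_eq_left h']
      exact (min_le_left _ _).trans h
    · rw [min_eq_right h']
      exact (min_le_right _ _).trans le_self_add
  rw [edist_dist, Real.dist_eq]
  refine ENNReal.ofReal_le_of_le_toReal (abs_sub_le_iff.2 ⟨?_, ?_⟩)
  · linarith [key h1 hb]
  · linarith [key h2 ha]

/-- The least cost of a chain with steps shorter than `ε` from `z₁` to `z`. -/
def chainInf (w : X → ℝ≥0∞) (ε : ℝ) (z₁ z : X) : ℝ≥0∞ :=
  ⨅ (x : ℕ → X) (k : ℕ) (_ : x 0 = z₁ ∧ x k = z ∧ ∀ i < k, dist (x i) (x (i + 1)) < ε),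
    chainCost w x k

theorem chainInf_self (w : X → ℝ≥0∞) (ε : ℝ) (z : X) : chainInf w ε z z = 0 := by
  refine le_antisymm ((iInf_le _ fun _ => z).trans ((iInf_le _ 0).trans
    ((iInf_le _ ⟨rfl, rfl, fun i hi => absurd hi (Nat.not_lt_zero i)⟩).trans ?_))) bot_le
  simp [chainCost]

theorem chainInf_step (w : X → ℝ≥0∞) {ε : ℝ} (z₁ : X) {a b : X} (hab : dist a b < ε) :
    chainInf w ε z₁ b ≤ chainInf w ε z₁ a + w a * edist a b := by
  have : chainInf w ε z₁ a + w a * edist a b = ⨅ (x : ℕ → X) (k : ℕ)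
      (_ : x 0 = z₁ ∧ x k = a ∧ ∀ i < k, dist (x i) (x (i + 1)) < ε),
      (chainCost w x k + w a * edist a b) := by
    simp only [chainInf, ENNReal.iInf_add]
  rw [this]
  refine le_iInf fun x => le_iInf fun k => le_iInf fun ⟨h0, hk, hx⟩ => ?_
  let x' : ℕ → X := fun i => if i ≤ k then x i else b
  have e : ∀ i ≤ k, x' i = x i := fun i hi => if_pos hi
  have ek : x' (k + 1) = b := if_neg (by omega)
  refine (iInf_le _ x').trans ((iInf_le _ (k + 1)).trans ((iInf_le _ ⟨?_, ek, ?_⟩).trans ?_))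
  · rw [chainCost_succ, e k le_rfl, ek, hk]
    gcongr
    refine (Finset.sum_congr rfl fun i hi => ?_).le
    have := Finset.mem_range.1 hi
    rw [e i this.le, e (i + 1) this]
  · rw [e 0 (Nat.zero_le k), h0]
  · intro i hi
    rcases Nat.lt_succ_iff_lt_or_eq.1 hi with h | rfl
    · rw [e i h.le, e (i + 1) h]
      exact hx i h
    · rw [e i le_rfl, ek, hk]
      exact hab

/-- On a short subinterval the increment of `v` is at most `h (γ s)` times the length of `γ` there,
for every `s` in it. Averaging over `s` gives the integral of `h`, and the subintervals add up. -/
theorem isUpperGradient_of_forall_near [MeasurableSpace X] [BorelSpace X] {Y : Type*}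
    [MetricSpace Y] {v : X → Y} {h : X → ℝ≥0∞} (hm : Measurable h) {r : ℝ} (hr : 0 < r)
    (hv : ∀ a b y, dist a y < r → dist b y < r → edist (v a) (v b) ≤ h y * edist a b) :
    IsUpperGradient v h := by
  refine ⟨hm, fun γ => ?_⟩
  unfold UpperGradientAlong
  by_cases hγ : curveLength γ = ∞
  · rw [lineIntegral_eq_top hγ]; exact le_top
  have hmγ : Measurable fun t => h (γ t) := hm.comp γ.continuous.measurable
  obtain ⟨δ, hδ, hδr⟩ := Metric.uniformContinuous_iff.1
    (CompactSpace.uniformContinuous_of_continuous γ.continuous) r hr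
  have hM : ∀ t, (lenMeas γ).withDensity (fun t => h (γ t)) {t} = 0 := fun t =>
    withDensity_absolutelyContinuous _ _ (lenMeas_singleton hγ t)
  have := edist_le_measure_of_short hM (c := v ∘ γ) (half_pos hδ) fun a b hab hd => by
    rw [withDensity_apply _ measurableSet_Icc]
    set m := lenMeas γ (Icc a b) with hm'
    have hmfin : m ≠ ∞ := measure_ne_top _ _
    have hpt : ∀ s ∈ Icc a b, edist (v (γ a)) (v (γ b)) ≤ h (γ s) * m := by
      intro s hs
      have hsa : dist (γ a) (γ s) < r := hδr (by
        rw [Subtype.dist_eq, Real.dist_eq] at hd ⊢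
        have h1 : (a : ℝ) ≤ s := hs.1
        have h2 : (s : ℝ) ≤ b := hs.2
        rw [abs_sub_comm, abs_of_nonneg (by linarith)] at hd ⊢
        linarith)
      have hsb : dist (γ b) (γ s) < r := hδr (by
        rw [Subtype.dist_eq, Real.dist_eq] at hd ⊢
        have h1 : (a : ℝ) ≤ s := hs.1
        have h2 : (s : ℝ) ≤ b := hs.2
        rw [abs_sub_comm, abs_of_nonneg (by linarith)] at hd
        rw [abs_of_nonneg (by linarith)]
        linarith)
      refine (hv _ _ _ hsa hsb).trans ?_
      gcongr
      rw [hm', lenMeas_Icc hγ hab]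
      exact eVariationOn.edist_le _ (left_mem_Icc.2 hab) (right_mem_Icc.2 hab)
    change edist (v (γ a)) (v (γ b)) ≤ _
    rcases eq_or_ne m 0 with h0 | h0
    · have := hpt a (left_mem_Icc.2 hab)
      rw [h0, mul_zero] at this
      exact this.trans bot_le
    · calc edist (v (γ a)) (v (γ b)) = edist (v (γ a)) (v (γ b)) / m * m :=
            (ENNReal.div_mul_cancel h0 hmfin).symm
        _ = ∫⁻ _ in Icc a b, edist (v (γ a)) (v (γ b)) / m ∂(lenMeas γ) := by
            rw [lintegral_const, Measure.restrict_apply_univ]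
        _ ≤ ∫⁻ s in Icc a b, h (γ s) ∂(lenMeas γ) :=
            setLIntegral_mono' measurableSet_Icc fun s hs => ENNReal.div_le_of_le_mul (hpt s hs)
  rw [edist_comm, lineIntegral_eq hγ hm]
  rwa [withDensity_apply _ MeasurableSet.univ, setLIntegral_univ] at this

/-! ### Doubling, telescoping and dyadic potentials -/

variable [MeasurableSpace X] {μ : Measure X}

theorem IsDoubling.exists_forall_ball (hd : IsDoubling μ) [Nontrivial X] :
    ∃ D : ℝ≥0, ∀ (x : X) (r : ℝ), 0 < r → μ (Metric.ball x (2 * r)) ≤ D * μ (Metric.ball x r) := by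
  obtain ⟨C, hC⟩ := hd
  refine ⟨C, fun x r hr => ?_⟩
  by_cases h : ENNReal.ofReal r < Metric.ediam (univ : Set X)
  · exact hC x r hr h
  push Not at h
  set d := (Metric.ediam (univ : Set X)).toReal with hdd
  have hfin : Metric.ediam (univ : Set X) ≠ ∞ := ne_top_of_le_ne_top ENNReal.ofReal_ne_top h
  have hd0 : 0 < d := ENNReal.toReal_pos (Metric.ediam_pos_iff.2 Set.nontrivial_univ).ne' hfin
  have hdr : d ≤ r := ENNReal.toReal_le_of_le_ofReal hr.le h
  -- Any factor strictly between `1/2` and `1` works: the radius is below the diameter, and the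
  -- doubled ball is the whole space.
  have h1 := hC x (3 / 4 * d) (by positivity) (by
    rw [← ENNReal.ofReal_toReal hfin, ← hdd]
    exact (ENNReal.ofReal_lt_ofReal_iff hd0).2 (by linarith))
  have h2 : Metric.ball x (2 * r) ⊆ Metric.ball x (2 * (3 / 4 * d)) := by
    intro y _
    have : dist y x ≤ d := by
      rw [dist_edist]
      exact ENNReal.toReal_mono hfin (Metric.edist_le_ediam_of_mem (mem_univ _) (mem_univ _))
    rw [Metric.mem_ball]
    linarith
  calc μ (Metric.ball x (2 * r)) ≤ μ (Metric.ball x (2 * (3 / 4 * d))) := measure_mono h2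
    _ ≤ C * μ (Metric.ball x (3 / 4 * d)) := h1
    _ ≤ C * μ (Metric.ball x r) := by
        gcongr
        linarith

variable [BorelSpace X]

/-- The sum over dyadic scales of the radii times the `L^Q`-means of `h`. -/
def pot {X : Type*} [MetricSpace X] [MeasurableSpace X] (μ : Measure X) (Q σ : ℝ) (h : X → ℝ≥0∞)
    (z : X) (r : ℝ) : ℝ≥0∞ :=
  ∑' i : ℕ, ENNReal.ofReal ((1 / 2) ^ i * r) *
    (⨍⁻ y in Metric.ball z (σ * ((1 / 2) ^ i * r)), h y ^ Q ∂μ) ^ (1 / Q)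

/-- By continuity `v z` is the limit of its means over shrinking dyadic balls, and consecutive means
differ by at most `D` times the oscillation bounded in the Poincaré inequality. The two telescoping
sums account for `D` each, the passage between the two centres for `D * D`. -/
theorem edist_le_pot (hX : IsMetricMeasureSpace μ) {D : ℝ≥0}
    (hD : ∀ (x : X) (r : ℝ), 0 < r → μ (Metric.ball x (2 * r)) ≤ D * μ (Metric.ball x r))
    {C σ Q : ℝ} (hC : 1 ≤ C) {v : X → ℝ} (hv : Continuous v) {h : X → ℝ≥0∞}
    (hPI : ∀ (x : X) (r : ℝ), 0 < r →
      ⨍⁻ y in Metric.ball x r, ‖v y - ⨍ z in Metric.ball x r, v z ∂μ‖ₑ ∂μ ≤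
        ENNReal.ofReal (C * Metric.diam (Metric.ball x r)) *
          (⨍⁻ y in Metric.ball x (σ * r), h y ^ Q ∂μ) ^ (1 / Q))
    (z₁ z₂ : X) {r : ℝ} (hr : 0 < r) (hz : dist z₁ z₂ ≤ r) :
    edist (v z₁) (v z₂) ≤ (D + D * D + D) * ENNReal.ofReal (2 * C) *
      (pot μ Q σ h z₁ (2 * r) + pot μ Q σ h z₂ r) := by
  have := hX.proper
  have := hX.isLocallyFinite
  have hC0 : 0 ≤ C := zero_le_one.trans hC
  have hint : ∀ (x : X) (s : ℝ), IntegrableOn v (Metric.ball x s) μ := fun x s =>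
    (hv.continuousOn.integrableOn_compact (isCompact_closedBall x s)).mono_set
      Metric.ball_subset_closedBall
  set P : X → ℝ → ℝ≥0∞ := fun x s => ENNReal.ofReal s *
    (⨍⁻ y in Metric.ball x (σ * s), h y ^ Q ∂μ) ^ (1 / Q) with hP
  have hosc : ∀ (x : X) (s : ℝ), 0 < s →
      ⨍⁻ y in Metric.ball x s, ‖v y - ⨍ z in Metric.ball x s, v z ∂μ‖ₑ ∂μ ≤
        ENNReal.ofReal (2 * C) * P x s := by
    intro x s hs
    refine (hPI x s hs).trans ?_
    rw [hP, ← mul_assoc, ← ENNReal.ofReal_mul (by positivity)]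
    refine mul_le_mul' (ENNReal.ofReal_le_ofReal ?_) le_rfl
    have := Metric.diam_ball (x := x) hs.le
    nlinarith
  set A : X → ℝ → ℝ := fun x s => ⨍ y in Metric.ball x s, v y ∂μ with hA
  have hA2 : ∀ (x : X) (s : ℝ), 0 < s →
      edist (A x s) (A x (1 / 2 * s)) ≤ D * (ENNReal.ofReal (2 * C) * P x s) := by
    intro x s hs
    rw [edist_comm]
    refine (edist_setAverage_le (Metric.ball_subset_ball (by linarith))
      (hX.ball_pos x _ (by linarith)).ne' (hX.ball_lt_top x s hs).ne ?_ (hint x s) _).trans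
      (mul_le_mul' le_rfl (hosc x s hs))
    have := hD x (1 / 2 * s) (by linarith)
    rwa [← mul_assoc, show (2 : ℝ) * (1 / 2) = 1 by norm_num, one_mul] at this
  have hlim : ∀ (x : X) (s : ℝ), 0 < s →
      Tendsto (fun i : ℕ => A x ((1 / 2) ^ i * s)) atTop (𝓝 (v x)) := by
    intro x s hs
    rw [EMetric.tendsto_atTop]
    intro ε hε
    obtain ⟨ε', hε'0, hε'⟩ := exists_between hε
    obtain ⟨δ, hδ, hball⟩ := Metric.eventually_nhds_iff.1
      (hv.continuousAt (x := x) (Metric.eball_mem_nhds (v x) hε'0))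
    have hpow : Tendsto (fun i : ℕ => (1 / 2 : ℝ) ^ i * s) atTop (𝓝 0) := by
      have := (tendsto_pow_atTop_nhds_zero_of_lt_one (r := (1 / 2 : ℝ)) (by norm_num)
        (by norm_num)).mul_const s
      rwa [zero_mul] at this
    obtain ⟨N, hN⟩ := eventually_atTop.1 (hpow.eventually (gt_mem_nhds hδ))
    refine ⟨N, fun n hn => ?_⟩
    have hn0 : 0 < (1 / 2 : ℝ) ^ n * s := by positivity
    have h1 := edist_setAverage_le (μ := μ) (D := 1) (Subset.refl (Metric.ball x ((1 / 2) ^ n * s)))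
      (hX.ball_pos x _ hn0).ne' (hX.ball_lt_top x _ hn0).ne (by rw [one_mul]) (hint x _) (v x)
    refine lt_of_le_of_lt (h1.trans ?_) hε'
    rw [one_mul, setLAverage_eq, ENNReal.div_le_iff (hX.ball_pos x _ hn0).ne'
      (hX.ball_lt_top x _ hn0).ne, ← setLIntegral_const]
    refine setLIntegral_mono' Metric.isOpen_ball.measurableSet fun y hy => ?_
    rw [← edist_eq_enorm_sub]
    have hy' : dist y x < δ := (Metric.mem_ball.1 hy).trans (hN n hn)
    exact (hball hy').le
  have htel : ∀ (x : X) (s : ℝ), 0 < s →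
      edist (A x s) (v x) ≤ D * (ENNReal.ofReal (2 * C) * pot μ Q σ h x s) := by
    intro x s hs
    have := edist_le_tsum_of_edist_le_of_tendsto₀ (f := fun i : ℕ => A x ((1 / 2) ^ i * s))
      (fun i => D * (ENNReal.ofReal (2 * C) * P x ((1 / 2) ^ i * s))) (fun i => by
        have := hA2 x ((1 / 2) ^ i * s) (by positivity)
        rwa [← mul_assoc, ← pow_succ'] at this) (hlim x s hs)
    rw [pow_zero, one_mul, ENNReal.tsum_mul_left, ENNReal.tsum_mul_left] at this
    exact this
  have hP0 : ∀ (x : X) (s : ℝ), P x s ≤ pot μ Q σ h x s := by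
    intro x s
    have := ENNReal.le_tsum (f := fun i : ℕ => P x ((1 / 2) ^ i * s)) 0
    simp only [pow_zero, one_mul] at this
    exact this
  -- `B(z₂, r) ⊆ B(z₁, 2r) ⊆ B(z₂, 4r)`, so two doublings compare the measures.
  have hcross : edist (A z₁ (2 * r)) (A z₂ r) ≤
      D * D * (ENNReal.ofReal (2 * C) * pot μ Q σ h z₁ (2 * r)) := by
    rw [edist_comm]
    refine (edist_setAverage_le (D := D * D) (Metric.ball_subset_ball' ?_)
      (hX.ball_pos z₂ _ hr).ne' (hX.ball_lt_top z₁ _ (by linarith)).ne ?_ (hint z₁ _) _).trans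
      (mul_le_mul' le_rfl ((hosc z₁ _ (by linarith)).trans (mul_le_mul' le_rfl (hP0 _ _))))
    · rw [dist_comm]; linarith
    · calc μ (Metric.ball z₁ (2 * r)) ≤ μ (Metric.ball z₂ (2 * (2 * r))) :=
            measure_mono (Metric.ball_subset_ball' (by linarith))
        _ ≤ D * μ (Metric.ball z₂ (2 * r)) := hD _ _ (by linarith)
        _ ≤ D * (D * μ (Metric.ball z₂ r)) := by gcongr; exact hD _ _ hr
        _ = _ := by ring
  calc edist (v z₁) (v z₂)
      ≤ edist (v z₁) (A z₁ (2 * r)) + edist (A z₁ (2 * r)) (A z₂ r) + edist (A z₂ r) (v z₂) :=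
        edist_triangle4 _ _ _ _
    _ ≤ D * (ENNReal.ofReal (2 * C) * pot μ Q σ h z₁ (2 * r)) +
        D * D * (ENNReal.ofReal (2 * C) * pot μ Q σ h z₁ (2 * r)) +
        D * (ENNReal.ofReal (2 * C) * pot μ Q σ h z₂ r) := by
        gcongr
        · rw [edist_comm]; exact htel _ _ (by linarith)
        · exact htel _ _ hr
    _ = D * (ENNReal.ofReal (2 * C) * (pot μ Q σ h z₁ (2 * r) + pot μ Q σ h z₂ r)) +
        D * D * (ENNReal.ofReal (2 * C) * pot μ Q σ h z₁ (2 * r)) := by ring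
    _ ≤ D * (ENNReal.ofReal (2 * C) * (pot μ Q σ h z₁ (2 * r) + pot μ Q σ h z₂ r)) +
        D * D * (ENNReal.ofReal (2 * C) * (pot μ Q σ h z₁ (2 * r) + pot μ Q σ h z₂ r)) := by
        gcongr
        exact le_self_add
    _ ≤ D * (ENNReal.ofReal (2 * C) * (pot μ Q σ h z₁ (2 * r) + pot μ Q σ h z₂ r)) +
        D * D * (ENNReal.ofReal (2 * C) * (pot μ Q σ h z₁ (2 * r) + pot μ Q σ h z₂ r)) +
        D * (ENNReal.ofReal (2 * C) * (pot μ Q σ h z₁ (2 * r) + pot μ Q σ h z₂ r)) := le_self_add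
    _ = _ := by ring

/-- In a doubling space with a Poincaré inequality, two points are joined by a curve along which
the integral of a lower semicontinuous function is bounded by its potentials at the points. -/
theorem exists_curve_lineIntegral_le_pot (hX : IsMetricMeasureSpace μ) (hd : IsDoubling μ)
    [Nontrivial X] {Q : ℝ} (hP : SupportsPoincare μ Q) :
    ∃ (A : ℝ≥0) (σ : ℝ), 1 ≤ σ ∧ ∀ (h : X → ℝ≥0∞), LowerSemicontinuous h →
      ∀ c : ℝ≥0, 0 < c → (∀ x, (c : ℝ≥0∞) ≤ h x) → ∀ (z₁ z₂ : X) (r : ℝ), 0 < r → dist z₁ z₂ ≤ r →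
      ∀ M : ℝ≥0, A * (pot μ Q σ h z₁ (2 * r) + pot μ Q σ h z₂ r) < M →
        ∃ γ : Curve X, γ 0 = z₁ ∧ γ 1 = z₂ ∧ lineIntegral h γ ≤ M := by
  obtain ⟨D, hD⟩ := hd.exists_forall_ball
  obtain ⟨C, σ, hC, hσ, hPI⟩ := hP
  have := hX.proper
  have := hX.isLocallyFinite
  refine ⟨(D + D * D + D) * (2 * C).toNNReal, σ, hσ, fun h hh c hc0 hc z₁ z₂ r hr hz M hM => ?_⟩
  refine exists_curve_of_chains hh hc0 hc fun n => ?_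
  set ε : ℝ := 1 / ((n : ℝ) + 1) ^ 2 with hε
  have hε0 : 0 < ε := by positivity
  set w := truncEnv h n ε with hw
  set f := chainInf w ε z₁ with hf
  -- Truncation at `M` makes the chain cost real-valued. As the potentials bound `v z₂` strictly
  -- below `M`, the truncation is inactive at `z₂`, and a chain of cost less than `M` exists.
  set v : X → ℝ := fun z => (min (f z) M).toReal with hv
  have hstep : ∀ a b, dist a b < ε → ∀ m, w a ≤ m → w b ≤ m →
      edist (v a) (v b) ≤ m * edist a b := by
    intro a b hab m ha hb
    refine edist_toReal_min_le M ?_ ?_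
    · refine (chainInf_step w z₁ (by rwa [dist_comm])).trans ?_
      rw [edist_comm]
      gcongr
    · refine (chainInf_step w z₁ hab).trans ?_
      gcongr
  have hcont : Continuous v := by
    refine continuous_iff_continuousAt.2 fun a => ?_
    rw [ContinuousAt, tendsto_iff_edist_tendsto_0]
    have h1 : Tendsto (fun b => (n : ℝ≥0∞) * edist b a) (𝓝 a) (𝓝 0) := by
      have := ENNReal.Tendsto.const_mul (a := (n : ℝ≥0∞))
        (tendsto_iff_edist_tendsto_0.1 (tendsto_id (x := 𝓝 a))) (Or.inr (ENNReal.natCast_ne_top n))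
      rwa [mul_zero] at this
    refine tendsto_of_tendsto_of_tendsto_of_le_of_le' tendsto_const_nhds h1
      (Eventually.of_forall fun _ => bot_le) ?_
    filter_upwards [Metric.ball_mem_nhds a hε0] with b hb
    exact hstep b a hb n (truncEnv_le_nat _ _ _ _) (truncEnv_le_nat _ _ _ _)
  -- If `a` and `b` lie within `ε / 2` of `y`, then `[a, b]` is an admissible step, and `y` is a
  -- competitor in the infima defining `w a` and `w b`.
  have hug : IsUpperGradient v h := by
    refine isUpperGradient_of_forall_near hh.measurable (half_pos hε0) fun a b y ha hb => ?_
    refine hstep a b ?_ _ (truncEnv_le ?_) (truncEnv_le ?_)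
    · linarith [dist_triangle_right a b y]
    · rw [dist_comm]; linarith
    · rw [dist_comm]; linarith
  have hle := edist_le_pot hX hD hC hcont
    (fun x r hr => hPI v h hcont.locallyIntegrable hug x r hr) z₁ z₂ hr hz
  have hv1 : v z₁ = 0 := by simp [hv, hf, chainInf_self]
  have hlt : min (f z₂) (M : ℝ≥0∞) < M := by
    have hfin : min (f z₂) (M : ℝ≥0∞) ≠ ∞ :=
      ne_top_of_le_ne_top ENNReal.coe_ne_top (min_le_right _ _)
    have e : edist (v z₁) (v z₂) = min (f z₂) (M : ℝ≥0∞) := by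
      rw [hv1, edist_comm, edist_dist, Real.dist_eq, sub_zero, abs_of_nonneg ENNReal.toReal_nonneg,
        ENNReal.ofReal_toReal hfin]
    rw [← e]
    refine hle.trans_lt (lt_of_le_of_lt (le_of_eq ?_) hM)
    push_cast
    rfl
  have hf2 : f z₂ < M := by
    rcases min_lt_iff.1 hlt with h | h
    · exact h
    · exact absurd h (lt_irrefl _)
  simp only [hf, chainInf, iInf_lt_iff] at hf2
  obtain ⟨x, k, ⟨h0, hk, hx⟩, hcost⟩ := hf2
  exact ⟨x, k, h0, hk, hx, hcost.le⟩

end Poincare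


/-! ## Estimates for potentials -/

section Potentials

variable {X : Type*} [MetricSpace X] [MeasurableSpace X] {μ : Measure X}

/-- The dyadic terms are dominated by a geometric series of ratio `(1/2) ^ (1 - β)`, which converges
as `β < 1`. -/
theorem pot_le_of_forall_le {Q σ : ℝ} {h : X → ℝ≥0∞} {z : X} {r β : ℝ} (hr : 0 < r) (hβ : β < 1)
    {B : ℝ≥0∞} (hB : ∀ s, 0 < s → s ≤ r →
      (⨍⁻ y in Metric.ball z (σ * s), h y ^ Q ∂μ) ^ (1 / Q) ≤ B * ENNReal.ofReal (s ^ (-β))) :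
    pot μ Q σ h z r ≤ B * ENNReal.ofReal ((1 - (1 / 2 : ℝ) ^ (1 - β))⁻¹ * r ^ (1 - β)) := by
  have hq0 : (0 : ℝ) ≤ (1 / 2 : ℝ) ^ (1 - β) := by positivity
  have hq1 : (1 / 2 : ℝ) ^ (1 - β) < 1 :=
    Real.rpow_lt_one (by norm_num) (by norm_num) (by linarith)
  have hterm : ∀ i : ℕ, ENNReal.ofReal ((1 / 2) ^ i * r) *
      (⨍⁻ y in Metric.ball z (σ * ((1 / 2) ^ i * r)), h y ^ Q ∂μ) ^ (1 / Q) ≤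
      B * ENNReal.ofReal (((1 / 2 : ℝ) ^ (1 - β)) ^ i * r ^ (1 - β)) := by
    intro i
    have hs : (0 : ℝ) < (1 / 2) ^ i * r := by positivity
    have hsr : (1 / 2 : ℝ) ^ i * r ≤ r :=
      mul_le_of_le_one_left hr.le (pow_le_one₀ (by norm_num) (by norm_num))
    calc _ ≤ ENNReal.ofReal ((1 / 2) ^ i * r) * (B * ENNReal.ofReal (((1 / 2) ^ i * r) ^ (-β))) :=
          mul_le_mul' le_rfl (hB _ hs hsr)
      _ = B * ENNReal.ofReal (((1 / 2) ^ i * r) * ((1 / 2) ^ i * r) ^ (-β)) := by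
          rw [ENNReal.ofReal_mul hs.le]; ring
      _ = _ := by
          congr 2
          nth_rewrite 1 [← Real.rpow_one ((1 / 2 : ℝ) ^ i * r)]
          rw [← Real.rpow_add hs, ← sub_eq_add_neg, Real.mul_rpow (by positivity) hr.le,
            ← Real.rpow_natCast, ← Real.rpow_natCast, ← Real.rpow_mul (by norm_num),
            ← Real.rpow_mul (by norm_num), mul_comm (i : ℝ)]
  refine (ENNReal.tsum_le_tsum hterm).trans (le_of_eq ?_)
  rw [ENNReal.tsum_mul_left, ← ENNReal.ofReal_tsum_of_nonneg (fun i => by positivity)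
    ((summable_geometric_of_lt_one hq0 hq1).mul_right _), tsum_mul_right,
    tsum_geometric_of_lt_one hq0 hq1]

/-- The means of `ρ ^ Q` over the balls centred at `z` are bounded. -/
def MaxFinite (μ : Measure X) (Q : ℝ) (ρ : X → ℝ≥0∞) (z : X) : Prop :=
  ∃ B : ℝ≥0∞, B ≠ ∞ ∧ ∀ r : ℝ, 0 < r → ⨍⁻ y in Metric.ball z r, ρ y ^ Q ∂μ ≤ B

theorem MaxFinite.pot_ne_top {Q σ : ℝ} (hQ : 1 ≤ Q) (hσ : 1 ≤ σ) {ρ : X → ℝ≥0∞} {z : X}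
    (h : MaxFinite μ Q ρ z) {r : ℝ} (hr : 0 < r) : pot μ Q σ ρ z r ≠ ∞ := by
  obtain ⟨B, hB, hle⟩ := h
  refine ne_top_of_le_ne_top ?_ (pot_le_of_forall_le (B := B ^ (1 / Q)) hr zero_lt_one
    fun s hs _ => ?_)
  · exact ENNReal.mul_ne_top (ENNReal.rpow_ne_top_of_nonneg (by positivity) hB)
      ENNReal.ofReal_ne_top
  · rw [neg_zero, Real.rpow_zero, ENNReal.ofReal_one, mul_one]
    exact ENNReal.rpow_le_rpow (hle _ (by positivity)) (by positivity)

theorem maxFinite_const [BorelSpace X] (hX : IsMetricMeasureSpace μ) {Q : ℝ} (hQ : 1 ≤ Q)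
    {c : ℝ≥0∞} (hc : c ≠ ∞) (z : X) : MaxFinite μ Q (fun _ => c) z :=
  ⟨c ^ Q, ENNReal.rpow_ne_top_of_nonneg (by linarith) hc, fun r hr =>
    (setLAverage_const (hX.ball_pos z r hr).ne' (hX.ball_lt_top z r hr).ne _).le⟩

theorem pot_add_le {Q σ : ℝ} (hQ : 1 ≤ Q) {f g : X → ℝ≥0∞} (hf : Measurable f)
    (hg : Measurable g) (z : X) (r : ℝ) :
    pot μ Q σ (fun y => f y + g y) z r ≤ pot μ Q σ f z r + pot μ Q σ g z r := by
  unfold pot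
  rw [← ENNReal.tsum_add]
  refine ENNReal.tsum_le_tsum fun i => ?_
  rw [← mul_add]
  gcongr
  exact ENNReal.lintegral_Lp_add_le hf.aemeasurable hg.aemeasurable hQ

theorem pot_const_mul {Q σ : ℝ} (hQ : 1 ≤ Q) {f : X → ℝ≥0∞} (hf : Measurable f) (c : ℝ≥0∞) (z : X)
    (r : ℝ) : pot μ Q σ (fun y => c * f y) z r = c * pot μ Q σ f z r := by
  unfold pot
  rw [← ENNReal.tsum_mul_left]
  congr 1
  ext i
  have hQ0 : 0 ≤ Q := by linarith
  simp only [laverage, ENNReal.mul_rpow_of_nonneg _ _ hQ0]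
  rw [lintegral_const_mul _ (hf.pow_const Q), ENNReal.mul_rpow_of_nonneg _ _ (by positivity),
    ← ENNReal.rpow_mul, mul_one_div_cancel (by linarith), ENNReal.rpow_one]
  ring

/-! ### Finite maximal functions, lower mass bounds and a Morrey estimate -/

variable [BorelSpace X]

/-- At a Lebesgue point the means over small balls are bounded by differentiation of integrals,
which doubling provides; for large balls the total integral and the measure of one fixed ball
suffice. -/
theorem ae_maxFinite (hX : IsMetricMeasureSpace μ) (hd : IsDoubling μ) [Nontrivial X] {Q : ℝ}
    {ρ : X → ℝ≥0∞} (hm : Measurable ρ) (hρ : ∫⁻ z, ρ z ^ Q ∂μ ≠ ∞) :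
    ∀ᵐ z ∂μ, MaxFinite μ Q ρ z := by
  have := hX.proper
  have := hX.isLocallyFinite
  obtain ⟨D, hD⟩ := hd.exists_forall_ball
  have hcb : ∀ (x : X) (r : ℝ), 0 < r →
      μ (Metric.closedBall x r) ≤ D * μ (Metric.ball x r) := fun x r hr =>
    (measure_mono (Metric.closedBall_subset_ball (by linarith))).trans (hD x r hr)
  have : IsUnifLocDoublingMeasure μ := by
    refine ⟨⟨D * D, ?_⟩⟩
    filter_upwards [self_mem_nhdsWithin] with ε hε x
    have hε : (0 : ℝ) < ε := hε
    calc μ (Metric.closedBall x (2 * ε)) ≤ D * μ (Metric.ball x (2 * ε)) := hcb x _ (by linarith)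
      _ ≤ D * (D * μ (Metric.ball x ε)) := by gcongr; exact hD x ε hε
      _ ≤ D * (D * μ (Metric.closedBall x ε)) := by gcongr; exact Metric.ball_subset_closedBall
      _ = _ := by push_cast; ring
  have hmQ := hm.pow_const Q
  filter_upwards [(IsUnifLocDoublingMeasure.vitaliFamily μ 1).ae_tendsto_lintegral_div
    hmQ.aemeasurable hρ, ae_lt_top hmQ hρ] with z hz hztop
  have hball := IsUnifLocDoublingMeasure.tendsto_closedBall_filterAt (μ := μ) (K := 1) (x := z)
    (l := 𝓝[>] (0 : ℝ)) (fun _ => z) id tendsto_id (by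
      filter_upwards [self_mem_nhdsWithin] with r hr
      have hr : (0 : ℝ) < r := hr
      simpa using hr.le)
  have hev := (hz.comp hball).eventually (gt_mem_nhds (ENNReal.lt_add_right hztop.ne one_ne_zero))
  obtain ⟨r₀, hr₀, hr⟩ := mem_nhdsGT_iff_exists_Ioo_subset.1 hev
  have hr₀ : 0 < r₀ := hr₀
  refine ⟨D * (ρ z ^ Q + 1) + (∫⁻ z, ρ z ^ Q ∂μ) / μ (Metric.ball z r₀), ?_, fun r hr' => ?_⟩
  · exact ENNReal.add_ne_top.2 ⟨ENNReal.mul_ne_top ENNReal.coe_ne_top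
      (ENNReal.add_ne_top.2 ⟨hztop.ne, ENNReal.one_ne_top⟩),
      ENNReal.div_ne_top hρ (hX.ball_pos z r₀ hr₀).ne'⟩
  · rw [setLAverage_eq]
    rcases lt_or_ge r r₀ with hlt | hge
    · refine le_trans ?_ le_self_add
      have h1 : (∫⁻ y in Metric.closedBall z r, ρ y ^ Q ∂μ) / μ (Metric.closedBall z r) <
          ρ z ^ Q + 1 := hr ⟨hr', hlt⟩
      have hpos : μ (Metric.closedBall z r) ≠ 0 := fun h0 =>
        (hX.ball_pos z r hr').ne' (measure_mono_null Metric.ball_subset_closedBall h0)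
      have hfin : μ (Metric.closedBall z r) ≠ ∞ := (isCompact_closedBall z r).measure_lt_top.ne
      rw [ENNReal.div_le_iff (hX.ball_pos z r hr').ne' (hX.ball_lt_top z r hr').ne]
      calc ∫⁻ y in Metric.ball z r, ρ y ^ Q ∂μ ≤ ∫⁻ y in Metric.closedBall z r, ρ y ^ Q ∂μ :=
            lintegral_mono_set Metric.ball_subset_closedBall
        _ ≤ (ρ z ^ Q + 1) * μ (Metric.closedBall z r) := by
            rw [← ENNReal.div_le_iff hpos hfin]
            exact h1.le
        _ ≤ (ρ z ^ Q + 1) * (D * μ (Metric.ball z r)) := by gcongr; exact hcb z r hr'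
        _ = _ := by ring
    · refine le_trans ?_ le_add_self
      refine ENNReal.div_le_div (setLIntegral_le_lintegral _ _) ?_
      exact measure_mono (Metric.ball_subset_ball hge)

/-- The constant density `1` has finite potentials, so any two points are joined by a curve. -/
theorem connectedSpace_of_poincare (hX : IsMetricMeasureSpace μ) (hd : IsDoubling μ) [Nontrivial X]
    {Q : ℝ} (hQ : 1 ≤ Q) (hP : SupportsPoincare μ Q) : ConnectedSpace X := by
  obtain ⟨A, σ, hσ, H⟩ := exists_curve_lineIntegral_le_pot hX hd hP
  have hpre : PreconnectedSpace X := by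
    refine ⟨isPreconnected_of_forall_pair fun x _ y _ => ?_⟩
    have hr : 0 < dist x y + 1 := by positivity
    have hfin : A * (pot μ Q σ (fun _ => 1) x (2 * (dist x y + 1)) +
        pot μ Q σ (fun _ => 1) y (dist x y + 1)) ≠ ∞ := by
      have h1 := maxFinite_const (μ := μ) hX hQ ENNReal.one_ne_top
      exact ENNReal.mul_ne_top ENNReal.coe_ne_top (ENNReal.add_ne_top.2
        ⟨(h1 x).pot_ne_top hQ hσ (by positivity), (h1 y).pot_ne_top hQ hσ hr⟩)
    obtain ⟨M, hM⟩ := ENNReal.lt_iff_exists_nnreal_btwn.1 hfin.lt_top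
    obtain ⟨γ, h0, h1, -⟩ := H (fun _ => 1) lowerSemicontinuous_const 1 one_pos (by simp) x y _ hr
      (by linarith) M hM.1
    exact ⟨range γ, subset_univ _, ⟨0, h0⟩, ⟨1, h1⟩, isPreconnected_range γ.continuous⟩
  exact { toNonempty := inferInstance }

/-- In a connected space a small ball has diameter comparable to its radius, since the distance from
the centre takes all intermediate values. The relative volume bound against one large ball then
becomes a lower mass bound. -/
theorem exists_mul_rpow_le_measure_ball (hX : IsMetricMeasureSpace μ) [Nontrivial X]
    [ConnectedSpace X] {Q : ℝ} (hQ : 1 ≤ Q) (hvol : RelativeVolumeLowerBound μ Q) (x₀ : X)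
    {R S : ℝ} (hR : 0 < R) (hS : 0 < S) :
    ∃ c : ℝ, 0 < c ∧ ∀ z ∈ Metric.ball x₀ R, ∀ s, 0 < s → s ≤ S →
      ENNReal.ofReal (c * s ^ Q) ≤ μ (Metric.ball z s) := by
  obtain ⟨C, hC, hvol⟩ := hvol
  obtain ⟨a, b, hab⟩ := exists_pair_ne X
  have := hX.proper
  set D := dist a b with hDd
  have hD : 0 < D := dist_pos.2 hab
  have hsmall : ∀ (z : X) (s : ℝ), 0 < s → s ≤ D / 2 → s / 2 ≤ Metric.diam (Metric.ball z s) := by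
    intro z s hs hsD
    obtain ⟨w, hw⟩ : ∃ w, s ≤ dist z w := by
      by_contra! hcon
      have := dist_triangle_left a b z
      linarith [hcon a, hcon b]
    have hmem : s / 2 ∈ range fun y => dist z y := by
      refine mem_range_of_exists_le_of_exists_ge (continuous_const.dist continuous_id)
        ⟨z, ?_⟩ ⟨w, by linarith⟩
      rw [dist_self]; linarith
    obtain ⟨y, hy⟩ := hmem
    have hy : dist z y = s / 2 := hy
    rw [← hy]
    refine Metric.dist_le_diam_of_mem Metric.isBounded_ball (Metric.mem_ball_self hs) ?_
    rw [Metric.mem_ball, dist_comm, hy]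
    linarith
  -- Every ball of this radius centred in `B(x₀, R)` contains `B(x₀, R)`, whose measure `m` is
  -- fixed.
  set S' := S + 2 * R with hS'
  have hS'0 : 0 < S' := by positivity
  set c₁ := min (1 / 2) (D / (4 * S')) with hc₁
  have hc₁0 : 0 < c₁ := by positivity
  have hdiam : ∀ (z : X) (s : ℝ), 0 < s → s ≤ S' → c₁ * s ≤ Metric.diam (Metric.ball z s) := by
    intro z s hs hsS
    rcases le_total s (D / 2) with h | h
    · refine le_trans ?_ (hsmall z s hs h)
      have : c₁ * s ≤ 1 / 2 * s := by gcongr; exact min_le_left _ _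
      linarith
    · calc c₁ * s ≤ D / (4 * S') * S' := by gcongr; exact min_le_right _ _
        _ = D / 2 / 2 := by field_simp; norm_num
        _ ≤ Metric.diam (Metric.ball z (D / 2)) := hsmall z _ (by positivity) le_rfl
        _ ≤ Metric.diam (Metric.ball z s) :=
            Metric.diam_mono (Metric.ball_subset_ball h) Metric.isBounded_ball
  set m := (μ (Metric.ball x₀ R)).toReal with hm
  have hm0 : 0 < m := ENNReal.toReal_pos (hX.ball_pos x₀ R hR).ne' (hX.ball_lt_top x₀ R hR).ne
  refine ⟨C * (c₁ / (2 * S')) ^ Q * m, by positivity, fun z hz s hs hsS => ?_⟩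
  have hsS' : s ≤ S' := by linarith
  have hv := hvol z z s S' hs hS'0 (Metric.ball_subset_ball hsS')
  have hbig : m ≤ (μ (Metric.ball z S')).toReal := by
    refine ENNReal.toReal_mono (hX.ball_lt_top z S' hS'0).ne (measure_mono ?_)
    refine Metric.ball_subset_ball' ?_
    have := Metric.mem_ball'.1 hz
    linarith
  have hd0 : 0 < Metric.diam (Metric.ball z S') :=
    lt_of_lt_of_le (by positivity) (hdiam z S' hS'0 le_rfl)
  have hratio : c₁ / (2 * S') * s ≤
      Metric.diam (Metric.ball z s) / Metric.diam (Metric.ball z S') := by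
    rw [div_mul_eq_mul_div]
    exact div_le_div₀ Metric.diam_nonneg (hdiam z s hs hsS') hd0 (Metric.diam_ball hS'0.le)
  rw [le_div_iff₀ (lt_of_lt_of_le hm0 hbig)] at hv
  refine ENNReal.ofReal_le_of_le_toReal ?_
  calc C * (c₁ / (2 * S')) ^ Q * m * s ^ Q = C * (c₁ / (2 * S') * s) ^ Q * m := by
        rw [Real.mul_rpow (by positivity) hs.le]; ring
    _ ≤ C * (Metric.diam (Metric.ball z s) / Metric.diam (Metric.ball z S')) ^ Q *
        (μ (Metric.ball z S')).toReal := by gcongr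
    _ ≤ _ := hv

/-- Jensen's inequality replaces the exponent `Q` by `p`, and the lower mass bound shows that the
mean at scale `s` is of order `s ^ (-Q/p)`. As `Q / p < 1`, the potential sums to order `r ^ (1 -
Q/p)`. -/
theorem exists_pot_le_of_locallyLp (hX : IsMetricMeasureSpace μ) [Nontrivial X] [ConnectedSpace X]
    {Q p σ : ℝ} (hQ : 1 ≤ Q) (hp : Q < p) (hσ : 1 ≤ σ) (hvol : RelativeVolumeLowerBound μ Q)
    {g : X → ℝ≥0∞} (hm : Measurable g) (hg : LocallyLp μ p g) (x₀ : X) {R : ℝ} (hR : 0 < R) :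
    ∃ M : ℝ≥0, ∀ z ∈ Metric.ball x₀ R, ∀ r, 0 < r → r ≤ R →
      pot μ Q σ g z r ≤ M * ENNReal.ofReal (r ^ (1 - Q / p)) := by
  have := hX.proper
  have hQ0 : 0 < Q := by linarith
  have hp0 : 0 < p := by linarith
  have hσ0 : 0 < σ := by linarith
  have hβ : Q / p < 1 := (div_lt_one hp0).2 hp
  obtain ⟨c, hc, hmass⟩ := exists_mul_rpow_le_measure_ball hX hQ hvol x₀ hR
    (show 0 < σ * R by positivity)
  set G := ∫⁻ y in Metric.ball x₀ (R + σ * R), g y ^ p ∂μ with hG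
  have hGfin : G ≠ ∞ := (hg.lt_top_ball x₀ _).ne
  have hB : G ^ (1 / p) * ENNReal.ofReal ((c * σ ^ Q) ^ (-(1 / p))) *
      ENNReal.ofReal (1 - (1 / 2 : ℝ) ^ (1 - Q / p))⁻¹ ≠ ∞ :=
    ENNReal.mul_ne_top (ENNReal.mul_ne_top (ENNReal.rpow_ne_top_of_nonneg (by positivity) hGfin)
      ENNReal.ofReal_ne_top) ENNReal.ofReal_ne_top
  refine ⟨(G ^ (1 / p) * ENNReal.ofReal ((c * σ ^ Q) ^ (-(1 / p))) *
      ENNReal.ofReal (1 - (1 / 2 : ℝ) ^ (1 - Q / p))⁻¹).toNNReal, fun z hz r hr hrR =>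
    (pot_le_of_forall_le (B := G ^ (1 / p) * ENNReal.ofReal ((c * σ ^ Q) ^ (-(1 / p)))) hr hβ
      fun s hs hsr => ?_).trans (le_of_eq ?_)⟩
  · have hσs : 0 < σ * s := by positivity
    have hb0 := hX.ball_pos z (σ * s) hσs
    have hbfin := hX.ball_lt_top z (σ * s) hσs
    have hprob : IsProbabilityMeasure ((μ.restrict (Metric.ball z (σ * s)) univ)⁻¹ •
        μ.restrict (Metric.ball z (σ * s))) := by
      refine ⟨?_⟩
      rw [Measure.smul_apply, Measure.restrict_apply_univ, smul_eq_mul,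
        ENNReal.inv_mul_cancel hb0.ne' hbfin.ne]
    have hjensen : (⨍⁻ y in Metric.ball z (σ * s), g y ^ Q ∂μ) ^ (1 / Q) ≤
        (⨍⁻ y in Metric.ball z (σ * s), g y ^ p ∂μ) ^ (1 / p) :=
      eLpNorm'_le_eLpNorm'_of_exponent_le hQ0 hp.le _ hm.aestronglyMeasurable
    refine hjensen.trans ?_
    rw [setLAverage_eq]
    have hsR : s ≤ R := hsr.trans hrR
    have hsub : Metric.ball z (σ * s) ⊆ Metric.ball x₀ (R + σ * R) := by
      refine Metric.ball_subset_ball' ?_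
      have h1 := Metric.mem_ball.1 hz
      have h2 : σ * s ≤ σ * R := by gcongr
      linarith
    have hcs : 0 < c * (σ * s) ^ Q := by positivity
    calc ((∫⁻ y in Metric.ball z (σ * s), g y ^ p ∂μ) / μ (Metric.ball z (σ * s))) ^ (1 / p)
        ≤ (G / ENNReal.ofReal (c * (σ * s) ^ Q)) ^ (1 / p) := by
          gcongr
          · exact lintegral_mono_set hsub
          · exact hmass z hz _ hσs (by gcongr)
      _ = G ^ (1 / p) * ENNReal.ofReal ((c * (σ * s) ^ Q) ^ (-(1 / p))) := by
          rw [div_eq_mul_inv, ENNReal.mul_rpow_of_nonneg _ _ (by positivity), ENNReal.inv_rpow,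
            ← ENNReal.rpow_neg, ENNReal.ofReal_rpow_of_pos hcs]
      _ = _ := by
          rw [mul_assoc, ← ENNReal.ofReal_mul (by positivity)]
          congr 2
          rw [Real.mul_rpow hσ0.le hs.le, ← mul_assoc,
            Real.mul_rpow (by positivity) (by positivity),
            ← Real.rpow_mul hs.le]
          congr 2
          ring
  · have hpos : (0 : ℝ) ≤ (1 - (1 / 2 : ℝ) ^ (1 - Q / p))⁻¹ := by
      have : (1 / 2 : ℝ) ^ (1 - Q / p) < 1 :=
        Real.rpow_lt_one (by norm_num) (by norm_num) (by linarith)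
      exact inv_nonneg.2 (by linarith)
    rw [ENNReal.coe_toNNReal hB, ENNReal.ofReal_mul hpos, mul_assoc, mul_assoc, mul_assoc]

/-- Points that are not exceptional for `ρ` are joined by a curve along which `ρ` is integrable and
the integral of `g ∈ L^p_loc`, where `p > Q`, is small. -/
theorem exists_curve_lineIntegral_le (hX : IsMetricMeasureSpace μ) (hd : IsDoubling μ)
    [Nontrivial X] {Q p : ℝ} (hQ : 1 ≤ Q) (hp : Q < p) (hvol : RelativeVolumeLowerBound μ Q)
    (hP : SupportsPoincare μ Q) {g : X → ℝ≥0∞} (hg : LowerSemicontinuous g)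
    (hgp : LocallyLp μ p g) (x₀ : X) {R : ℝ} (hR : 0 < R) :
    ∃ M : ℝ≥0, ∀ ρ : X → ℝ≥0∞, LowerSemicontinuous ρ →
      ∀ z₁ ∈ Metric.ball x₀ R, ∀ z₂ ∈ Metric.ball x₀ R, MaxFinite μ Q ρ z₁ → MaxFinite μ Q ρ z₂ →
      ∀ r, 0 < r → 2 * r ≤ R → dist z₁ z₂ ≤ r → ∀ η : ℝ≥0, 0 < η →
        ∃ γ : Curve X, γ 0 = z₁ ∧ γ 1 = z₂ ∧ lineIntegral ρ γ ≠ ∞ ∧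
          lineIntegral g γ ≤ M * ENNReal.ofReal (r ^ (1 - Q / p)) + η := by
  have := connectedSpace_of_poincare hX hd hQ hP
  obtain ⟨A, σ, hσ, H⟩ := exists_curve_lineIntegral_le_pot hX hd hP
  obtain ⟨M, hM⟩ := exists_pot_le_of_locallyLp hX hQ hp hσ hvol hg.measurable hgp x₀ hR
  set α := 1 - Q / p with hα
  refine ⟨A * (M * (2 ^ α + 1)), fun ρ hρ z₁ hz₁ z₂ hz₂ h₁ h₂ r hr hrR hz η hη => ?_⟩
  have h2r : 0 < 2 * r := by positivity
  set K : ℝ≥0∞ := pot μ Q σ ρ z₁ (2 * r) + pot μ Q σ (fun _ => 1) z₁ (2 * r) +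
    (pot μ Q σ ρ z₂ r + pot μ Q σ (fun _ => 1) z₂ r) with hK
  have hone := maxFinite_const (μ := μ) hX hQ ENNReal.one_ne_top
  have hKfin : K ≠ ∞ := by
    simp only [hK, ENNReal.add_ne_top]
    exact ⟨⟨h₁.pot_ne_top hQ hσ h2r, (hone z₁).pot_ne_top hQ hσ h2r⟩,
      h₂.pot_ne_top hQ hσ hr, (hone z₂).pot_ne_top hQ hσ hr⟩
  obtain ⟨ε, hε0, hε⟩ : ∃ ε : ℝ≥0, 0 < ε ∧ ε * (A * K) < η := by
    have hAK : (A : ℝ≥0∞) * K ≠ ∞ := ENNReal.mul_ne_top ENNReal.coe_ne_top hKfin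
    obtain ⟨ε, hε, h⟩ := ENNReal.exists_nnreal_pos_mul_lt hAK
      (show (η : ℝ≥0∞) ≠ 0 by simpa using hη.ne')
    exact ⟨ε, hε, h⟩
  have hε0' : (ε : ℝ≥0∞) ≠ 0 := by simpa using hε0.ne'
  -- The constant `1` provides the positive lower bound, `ρ` forces its own integral along the curve
  -- to be finite, and `ε` makes both contribute at most `η`.
  set h : X → ℝ≥0∞ := fun y => g y + ε * (ρ y + 1) with hh
  have hρ1 : LowerSemicontinuous fun y => ρ y + 1 := hρ.add lowerSemicontinuous_const
  have hερ : LowerSemicontinuous fun y => (ε : ℝ≥0∞) * (ρ y + 1) :=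
    (ENNReal.continuous_const_mul ENNReal.coe_ne_top).comp_lowerSemicontinuous hρ1
      fun a b hab => mul_le_mul' le_rfl hab
  have hlsc : LowerSemicontinuous h := hg.add hερ
  have hpot : ∀ z s, pot μ Q σ h z s ≤
      pot μ Q σ g z s + ε * (pot μ Q σ ρ z s + pot μ Q σ (fun _ => 1) z s) := by
    intro z s
    refine (pot_add_le hQ hg.measurable hερ.measurable z s).trans ?_
    rw [pot_const_mul hQ hρ1.measurable]
    gcongr
    exact pot_add_le hQ hρ.measurable measurable_const z s
  set B : ℝ≥0 := A * (M * (2 ^ α + 1)) * (r ^ α).toNNReal + η with hBdef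
  have hα2 : ENNReal.ofReal ((2 * r) ^ α) = ((2 ^ α : ℝ≥0) : ℝ≥0∞) * ENNReal.ofReal (r ^ α) := by
    rw [Real.mul_rpow (by norm_num) hr.le, ENNReal.ofReal_mul (by positivity)]
    congr 1
    rw [ENNReal.ofReal, ENNReal.coe_inj]
    ext
    rw [Real.coe_toNNReal _ (by positivity), NNReal.coe_rpow]
    rfl
  obtain ⟨γ, h0, h1, hγ⟩ := H h hlsc ε hε0 (fun x => by
      rw [hh]
      refine le_trans ?_ le_add_self
      calc (ε : ℝ≥0∞) = ε * 1 := (mul_one _).symm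
        _ ≤ ε * (ρ x + 1) := by gcongr; exact le_add_self) z₁ z₂ r hr hz B (by
      calc A * (pot μ Q σ h z₁ (2 * r) + pot μ Q σ h z₂ r)
          ≤ A * ((M * ENNReal.ofReal ((2 * r) ^ α) + ε * (pot μ Q σ ρ z₁ (2 * r) +
              pot μ Q σ (fun _ => 1) z₁ (2 * r))) + (M * ENNReal.ofReal (r ^ α) +
              ε * (pot μ Q σ ρ z₂ r + pot μ Q σ (fun _ => 1) z₂ r))) := by
            gcongr
            · refine (hpot _ _).trans ?_
              gcongr
              exact hM z₁ hz₁ _ h2r hrR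
            · refine (hpot _ _).trans ?_
              gcongr
              exact hM z₂ hz₂ _ hr (by linarith)
        _ = A * (M * (ENNReal.ofReal ((2 * r) ^ α) + ENNReal.ofReal (r ^ α))) + ε * (A * K) := by
            rw [hK]; ring
        _ < A * (M * (ENNReal.ofReal ((2 * r) ^ α) + ENNReal.ofReal (r ^ α))) + η := by
            refine ENNReal.add_lt_add_left ?_ hε
            exact ENNReal.mul_ne_top ENNReal.coe_ne_top (ENNReal.mul_ne_top ENNReal.coe_ne_top
              (ENNReal.add_ne_top.2 ⟨ENNReal.ofReal_ne_top, ENNReal.ofReal_ne_top⟩))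
        _ = B := by
            rw [hα2, hBdef]
            push_cast
            rw [← ENNReal.ofReal]
            ring)
  refine ⟨γ, h0, h1, ?_, ?_⟩
  · refine lineIntegral_ne_top_of_mul_le hε0' (g' := h) (fun x => ?_)
      (ne_top_of_le_ne_top ENNReal.coe_ne_top hγ)
    refine le_trans ?_ le_add_self
    gcongr
    exact le_self_add
  · refine (lineIntegral_mono (fun x => le_self_add) γ).trans (hγ.trans (le_of_eq ?_))
    rw [hBdef]
    push_cast
    rfl

end Potentials


/-! ## Test densities -/

section TestDensity

/-- The Borel functions in `L^Q`, which detect the exceptional families of curves. -/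
structure IsTestDensity {X : Type*} [MeasurableSpace X] (μ : Measure X) (Q : ℝ)
    (ρ : X → ℝ≥0∞) : Prop where
  measurable : Measurable ρ
  lintegral_ne_top : ∫⁻ x, ρ x ^ Q ∂μ ≠ ∞

theorem isTestDensity_zero {X : Type*} [MeasurableSpace X] {μ : Measure X} {Q : ℝ} (hQ : 0 < Q) :
    IsTestDensity μ Q (fun _ => 0) :=
  ⟨measurable_const, by simp [hQ]⟩

variable {X : Type*} [MetricSpace X] [MeasurableSpace X] {μ : Measure X} {Q : ℝ}

theorem exists_testDensity_forall {ι : Type*} [Countable ι] (hQ : 0 < Q) {ρ : ι → X → ℝ≥0∞}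
    (h : ∀ i, IsTestDensity μ Q (ρ i)) :
    ∃ ρ', IsTestDensity μ Q ρ' ∧
      ∀ γ : Curve X, lineIntegral ρ' γ ≠ ∞ → ∀ i, lineIntegral (ρ i) γ ≠ ∞ := by
  rcases isEmpty_or_nonempty ι with hι | hι
  · exact ⟨_, isTestDensity_zero hQ, fun γ _ i => hι.elim i⟩
  · obtain ⟨e, he⟩ := exists_surjective_nat ι
    obtain ⟨ρ', hm, hint, hle⟩ := exists_dominating (ρ := fun n => ρ (e n)) hQ
      (fun n => (h _).measurable) (fun n => (h _).lintegral_ne_top)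
    refine ⟨ρ', ⟨hm, hint⟩, fun γ hγ i => ?_⟩
    obtain ⟨n, rfl⟩ := he i
    obtain ⟨c, hc, hcle⟩ := hle n
    exact lineIntegral_ne_top_of_mul_le hc hcle hγ

theorem exists_testDensity_pair (hQ : 0 < Q) {ρ₁ ρ₂ : X → ℝ≥0∞}
    (h₁ : IsTestDensity μ Q ρ₁) (h₂ : IsTestDensity μ Q ρ₂) :
    ∃ ρ', IsTestDensity μ Q ρ' ∧ ∀ γ : Curve X, lineIntegral ρ' γ ≠ ∞ →
      lineIntegral ρ₁ γ ≠ ∞ ∧ lineIntegral ρ₂ γ ≠ ∞ := by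
  obtain ⟨ρ', h, H⟩ := exists_testDensity_forall (ρ := fun b : Bool => cond b ρ₁ ρ₂) hQ
    (by rintro (_ | _) <;> assumption)
  exact ⟨ρ', h, fun γ hγ => ⟨H γ hγ true, H γ hγ false⟩⟩

variable [BorelSpace X]

theorem IsTestDensity.exists_lowerSemicontinuous (hX : IsMetricMeasureSpace μ) (hQ : 0 < Q)
    {ρ : X → ℝ≥0∞} (h : IsTestDensity μ Q ρ) :
    ∃ ρ', (∀ x, ρ x ≤ ρ' x) ∧ LowerSemicontinuous ρ' ∧ IsTestDensity μ Q ρ' := by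
  have := hX.proper
  have := hX.isLocallyFinite
  obtain ⟨f, hle, hf, hint⟩ := exists_le_lowerSemicontinuous_lintegral_ge μ (fun x => ρ x ^ Q)
    (h.measurable.pow_const Q) one_ne_zero
  have hlsc : LowerSemicontinuous fun x => f x ^ (1 / Q) :=
    (ENNReal.continuous_rpow_const (y := 1 / Q)).comp_lowerSemicontinuous hf
      (ENNReal.monotone_rpow_of_nonneg (by positivity))
  have hpow : ∀ x, (f x ^ (1 / Q)) ^ Q = f x := fun x => by
    rw [← ENNReal.rpow_mul, one_div_mul_cancel hQ.ne', ENNReal.rpow_one]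
  refine ⟨_, fun x => ?_, hlsc, hlsc.measurable, ?_⟩
  · calc ρ x = (ρ x ^ Q) ^ (1 / Q) := by
          rw [← ENNReal.rpow_mul, mul_one_div_cancel hQ.ne', ENNReal.rpow_one]
      _ ≤ _ := ENNReal.rpow_le_rpow (hle x) (by positivity)
  · simp only [hpow]
    exact ne_top_of_le_ne_top (ENNReal.add_ne_top.2 ⟨h.lintegral_ne_top, ENNReal.one_ne_top⟩) hint

theorem LocallyLp.exists_testDensity (hX : IsMetricMeasureSpace μ) (hQ : 0 < Q) {ρ : X → ℝ≥0∞}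
    (hm : Measurable ρ) (h : LocallyLp μ Q ρ) :
    ∃ ρ', IsTestDensity μ Q ρ' ∧
      ∀ γ : Curve X, lineIntegral ρ' γ ≠ ∞ → lineIntegral ρ γ ≠ ∞ := by
  have := hX.proper
  obtain ⟨ρ', hm', hint, H⟩ := exists_global_of_locally hQ hm h
  exact ⟨ρ', ⟨hm', hint⟩, H⟩

theorem LocallyLp.mono_exponent (hX : IsMetricMeasureSpace μ) {p : ℝ} (hQ : 0 ≤ Q) (hp : Q ≤ p)
    {ρ : X → ℝ≥0∞} (h : LocallyLp μ p ρ) : LocallyLp μ Q ρ := by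
  intro x
  obtain ⟨U, hU, hfin⟩ := h x
  refine ⟨U ∩ Metric.ball x 1, inter_mem hU (Metric.ball_mem_nhds x one_pos), ?_⟩
  have hle : ∀ z, ρ z ^ Q ≤ 1 + ρ z ^ p := fun z => by
    rcases le_total (ρ z) 1 with h1 | h1
    · exact (ENNReal.rpow_le_one h1 hQ).trans le_self_add
    · exact (ENNReal.rpow_le_rpow_of_exponent_le h1 hp).trans le_add_self
  calc ∫⁻ z in U ∩ Metric.ball x 1, ρ z ^ Q ∂μ
      ≤ ∫⁻ z in U ∩ Metric.ball x 1, 1 + ρ z ^ p ∂μ := lintegral_mono hle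
    _ = μ (U ∩ Metric.ball x 1) + ∫⁻ z in U ∩ Metric.ball x 1, ρ z ^ p ∂μ := by
        rw [lintegral_add_left measurable_const, setLIntegral_one]
    _ ≤ μ (Metric.ball x 1) + ∫⁻ z in U, ρ z ^ p ∂μ := by
        gcongr
        · exact inter_subset_right
        · exact inter_subset_left
    _ < ∞ := ENNReal.add_lt_top.2 ⟨hX.ball_lt_top x 1 one_pos, hfin⟩

/-- Almost every curve meets a given null set in a set of vanishing length. -/
theorem exists_testDensity_null (hQ : 0 < Q) {N : Set X} (hN : μ N = 0) :
    ∃ ρ, IsTestDensity μ Q ρ ∧ ∀ γ : Curve X, lineIntegral ρ γ ≠ ∞ →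
      ∀ᵐ t ∂lenMeas γ, γ t ∉ N := by
  set N' := toMeasurable μ N with hN'
  have hN'm : MeasurableSet N' := measurableSet_toMeasurable μ N
  have hm : Measurable (N'.indicator fun _ => (∞ : ℝ≥0∞)) := measurable_const.indicator hN'm
  refine ⟨N'.indicator fun _ => ∞, ⟨hm, ?_⟩, fun γ hγ => ?_⟩
  · have h0 : (fun x => (N'.indicator (fun _ => (∞ : ℝ≥0∞)) x) ^ Q) =ᵐ[μ] fun _ => 0 := by
      have hN0 : μ N' = 0 := (measure_toMeasurable N).trans hN
      filter_upwards [compl_mem_ae_iff.2 hN0] with x hx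
      rw [indicator_of_notMem hx, ENNReal.zero_rpow_of_pos hQ]
    rw [lintegral_congr_ae h0]
    simp
  · have hrect := rectifiable_of_lineIntegral_ne_top hγ
    rw [lineIntegral_eq hrect hm] at hγ
    filter_upwards [ae_lt_top (hm.comp γ.continuous.measurable) hγ] with t ht htN
    have : γ t ∈ N' := subset_toMeasurable μ N htN
    simp [this] at ht

end TestDensity

/-! ## Subcurves -/

section Subcurve

variable {X Y : Type*} [MetricSpace X] [PseudoEMetricSpace Y]

theorem curveLength_comp_of_surj (c : unitInterval → Y) {σ : unitInterval → unitInterval}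
    (hσ : Monotone σ) (hs : Function.Surjective σ) : curveLength (c ∘ σ) = curveLength c := by
  unfold curveLength
  rw [eVariationOn.comp_eq_of_monotoneOn _ _ (hσ.monotoneOn _), image_univ, hs.range_eq]

theorem exists_subcurve [MeasurableSpace X] [BorelSpace X] (u : X → Y) (γ : Curve X)
    (s t : unitInterval) :
    ∃ γ' : Curve X, γ' 0 = γ s ∧ γ' 1 = γ t ∧
      (∀ ρ : X → ℝ≥0∞, Measurable ρ → lineIntegral ρ γ' ≤ lineIntegral ρ γ) ∧
      curveLength (u ∘ γ') ≤ curveLength (u ∘ γ) := by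
  rcases le_total s t with h | h
  · refine ⟨γ.comp (affineSub s t), by simp [affineSub_zero], by simp [affineSub_one],
      fun ρ hρ => lineIntegral_affineSub_le γ h hρ, ?_⟩
    exact curveLength_comp_le (u ∘ γ) (affineSub_mono h)
  · refine ⟨reverse (γ.comp (affineSub t s)), ?_, ?_, fun ρ hρ => ?_, ?_⟩
    · simp [reverse, affineSub_one]
    · simp [reverse, affineSub_zero]
    · rw [lineIntegral_reverse _ hρ]
      exact lineIntegral_affineSub_le γ h hρ
    · refine le_trans (le_of_eq ?_) (curveLength_comp_le (u ∘ γ) (affineSub_mono h))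
      exact curveLength_comp_symm (u ∘ γ ∘ affineSub t s)

/-- Before it first reaches distance `δ` from `x`, the curve covers positive length, so it cannot
stay in a set that it meets in zero length. -/
theorem exists_notMem_of_exits {γ : Curve X} (hγ : curveLength γ ≠ ∞) {N : Set X}
    (hN : ∀ᵐ t ∂lenMeas γ, γ t ∉ N) {x : X} {δ δ' : ℝ} (hδ : δ' < δ)
    (h0 : dist (γ 0) x ≤ δ') (h1 : δ ≤ dist (γ 1) x) :
    ∃ t, dist (γ t) x < δ ∧ γ t ∉ N := by
  by_contra! hcon
  have hcont : Continuous fun t => dist (γ t) x := γ.continuous.dist continuous_const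
  obtain ⟨s, hs, hmin⟩ := (isClosed_le continuous_const hcont).isCompact.exists_isLeast
    (s := {t : unitInterval | δ ≤ dist (γ t) x}) ⟨1, h1⟩
  have hs : δ ≤ dist (γ s) x := hs
  have hzero : lenMeas γ (Icc 0 s) = 0 := by
    have hsub : Icc 0 s ⊆ {t | ¬ γ t ∉ N} ∪ {s} := by
      intro t ht
      rcases eq_or_lt_of_le ht.2 with h | h
      · exact Or.inr h
      · refine Or.inl (not_not.2 (hcon t ?_))
        by_contra! hlt
        exact absurd (hmin hlt) (not_le.2 h)
    exact measure_mono_null hsub (measure_union_null hN (lenMeas_singleton hγ s))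
  rw [lenMeas_Icc hγ s.2.1] at hzero
  have hle := eVariationOn.edist_le γ (s := Icc 0 s) (x := 0) (y := s)
    (left_mem_Icc.2 s.2.1) (right_mem_Icc.2 s.2.1)
  rw [hzero, nonpos_iff_eq_zero, edist_eq_zero] at hle
  rw [← hle] at hs
  linarith

end Subcurve

/-! ## Curves that compute the essential pull-back distance -/

section EssDist

variable {X Y : Type*} [MetricSpace X] [MeasurableSpace X] [MetricSpace Y]
  {μ : Measure X} {Q : ℝ} {u : X → Y}

theorem essLength_mono {A B A' B' : Set X} (hA : A ⊆ A') (hB : B ⊆ B') :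
    essLength μ Q u (joiningCurves A' B') ≤ essLength μ Q u (joiningCurves A B) :=
  iSup₂_mono fun _ _ => biInf_mono fun _ hγ => ⟨⟨hγ.1.1, hA hγ.1.2.1, hB hγ.1.2.2⟩, hγ.2⟩

/-- The curves of infinite `ρ`-integral are exceptional, so they may be discarded in the essential
infimum. -/
theorem exists_curve_of_essLength_lt (hQ : 0 < Q) {A B : Set X} {a : ℝ≥0∞}
    (h : essLength μ Q u (joiningCurves A B) < a) {ρ : X → ℝ≥0∞} (hρ : IsTestDensity μ Q ρ) :
    ∃ γ : Curve X, γ 0 ∈ A ∧ γ 1 ∈ B ∧ lineIntegral ρ γ ≠ ∞ ∧ curveLength (u ∘ γ) < a := by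
  have h0 : modulus μ Q {γ : Curve X | lineIntegral ρ γ = ∞} = 0 :=
    modulus_eq_zero_of_exists hQ hρ.measurable hρ.lintegral_ne_top fun γ hγ => hγ
  have h1 := (le_iSup₂ (f := fun (Γ₀ : Set (Curve X)) (_ : modulus μ Q Γ₀ = 0) =>
    ⨅ γ ∈ joiningCurves A B \ Γ₀, curveLength (u ∘ γ)) _ h0).trans_lt h
  simp only [iInf_lt_iff] at h1
  obtain ⟨γ, hγ, hlt⟩ := h1
  exact ⟨γ, hγ.1.2.1, hγ.1.2.2, hγ.2, hlt⟩

theorem essLength_le_essDist (x y : X) {δ : ℝ} (hδ : 0 < δ) :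
    essLength μ Q u (joiningCurves (Metric.closedBall x δ) (Metric.closedBall y δ)) ≤
      essDist μ Q u x y :=
  le_iSup₂ (f := fun (δ : ℝ) (_ : 0 < δ) => essLength μ Q u
    (joiningCurves (Metric.closedBall x δ) (Metric.closedBall y δ))) δ hδ

variable [BorelSpace X]

/-- Every exceptional family is detected by a test density. The competitors must be Lipschitz, which
a constant speed reparametrization achieves without changing endpoints, integrals or the `u`-length.
-/
theorem essLength_le (hQ : 0 < Q) {A B : Set X} {a : ℝ≥0∞}
    (h : ∀ ρ, IsTestDensity μ Q ρ → ∃ γ : Curve X, γ 0 ∈ A ∧ γ 1 ∈ B ∧ lineIntegral ρ γ ≠ ∞ ∧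
      curveLength (u ∘ γ) ≤ a) :
    essLength μ Q u (joiningCurves A B) ≤ a := by
  refine iSup₂_le fun Γ₀ hΓ₀ => ?_
  obtain ⟨ρ, hm, hint, hρ⟩ := exists_of_modulus_eq_zero hQ hΓ₀
  obtain ⟨γ, h0, h1, hfin, hlen⟩ := h ρ ⟨hm, hint⟩
  obtain ⟨γ', σ, hL, hσ, hσ0, hσ1, rfl⟩ :=
    exists_lipschitz_reparam γ (rectifiable_of_lineIntegral_ne_top hfin)
  have hsurj : Function.Surjective σ := fun t =>
    mem_range_of_exists_le_of_exists_ge σ.continuous ⟨0, hσ0.trans_le unitInterval.nonneg'⟩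
      ⟨1, unitInterval.le_one'.trans_eq hσ1.symm⟩
  have hrect : curveLength γ' ≠ ∞ := by
    rw [← curveLength_comp_of_surj γ' hσ hsurj]
    exact rectifiable_of_lineIntegral_ne_top hfin
  have hmem : γ' ∈ joiningCurves A B \ Γ₀ := by
    refine ⟨⟨hL, by simpa [hσ0] using h0, by simpa [hσ1] using h1⟩, fun hmem => ?_⟩
    rw [lineIntegral_comp_of_surj hrect σ hσ hσ0 hσ1 hm] at hfin
    exact hfin (hρ _ hmem)
  refine (biInf_le (fun γ : Curve X => curveLength (u ∘ γ)) hmem).trans ?_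
  rw [← curveLength_comp_of_surj (u ∘ γ') hσ hsurj]
  exact hlen

theorem essDist_le (hQ : 0 < Q) {x y : X} {a : ℝ≥0∞} {δ₀ : ℝ} (hδ₀ : 0 < δ₀)
    (h : ∀ δ, 0 < δ → δ ≤ δ₀ → ∀ ρ, IsTestDensity μ Q ρ → ∃ γ : Curve X,
      γ 0 ∈ Metric.closedBall x δ ∧ γ 1 ∈ Metric.closedBall y δ ∧ lineIntegral ρ γ ≠ ∞ ∧
      curveLength (u ∘ γ) ≤ a) :
    essDist μ Q u x y ≤ a := by
  refine iSup₂_le fun δ hδ => ?_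
  refine (essLength_anti μ Q u x y (min_le_left δ δ₀)).trans ?_
  exact essLength_le hQ (h _ (lt_min hδ hδ₀) (min_le_right _ _))

/-- Off an exceptional family, the `u`-length of a curve is at least the essential pull-back
distance of its endpoints. -/
theorem exists_testDensity_essDist_le (hX : IsMetricMeasureSpace μ) (hQ : 0 < Q) :
    ∃ ρ, IsTestDensity μ Q ρ ∧ ∀ γ : Curve X, lineIntegral ρ γ ≠ ∞ →
      essDist μ Q u (γ 0) (γ 1) ≤ curveLength (u ∘ γ) := by
  have := hX.proper
  have hB := TopologicalSpace.isBasis_countableBasis X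
  -- For fixed basic open sets and a fixed rational bound, failure for all densities would
  -- contradict `essLength_le`. There are countably many such triples, so their densities merge into
  -- one.
  have key : ∀ i : TopologicalSpace.countableBasis X × TopologicalSpace.countableBasis X × ℚ,
      ∃ ρ, IsTestDensity μ Q ρ ∧ ∀ γ : Curve X, lineIntegral ρ γ ≠ ∞ → γ 0 ∈ i.1.1 →
        γ 1 ∈ i.2.1.1 → curveLength (u ∘ γ) ≤ ENNReal.ofReal i.2.2 →
        essLength μ Q u (joiningCurves i.1.1 i.2.1.1) ≤ ENNReal.ofReal i.2.2 := by
    intro i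
    by_contra! hcon
    obtain ⟨-, -, -, -, -, hlt⟩ := hcon _ (isTestDensity_zero hQ)
    refine absurd (essLength_le hQ fun ρ hρ => ?_) (not_le.2 hlt)
    obtain ⟨γ, h1, h2, h3, h4, -⟩ := hcon ρ hρ
    exact ⟨γ, h2, h3, h1, h4⟩
  choose ρ hρ hρ' using key
  have : Countable (TopologicalSpace.countableBasis X) :=
    (TopologicalSpace.countable_countableBasis X).to_subtype
  obtain ⟨ρ', h', H'⟩ := exists_testDensity_forall hQ hρ
  refine ⟨ρ', h', fun γ hγ => iSup₂_le fun δ hδ => ?_⟩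
  by_contra! hlt
  obtain ⟨a, ha1, ha2⟩ := ENNReal.lt_iff_exists_rat_btwn.1 hlt
  have hnhds : ∀ x : X, ∃ U ∈ TopologicalSpace.countableBasis X, x ∈ U ∧
      U ⊆ Metric.closedBall x δ := fun x =>
    hB.mem_nhds_iff.1 (Metric.closedBall_mem_nhds x hδ)
  obtain ⟨U, hU, hxU, hUs⟩ := hnhds (γ 0)
  obtain ⟨V, hV, hyV, hVs⟩ := hnhds (γ 1)
  have := hρ' (⟨U, hU⟩, ⟨V, hV⟩, a) γ (H' γ hγ _) hxU hyV ha2.1.le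
  exact absurd ((essLength_mono hUs hVs).trans this) (not_le.2 ha2.2)

theorem exists_curve_of_essDist_lt (hQ : 0 < Q) {x y : X} (hxy : x ≠ y) {a : ℝ≥0∞}
    (h : essDist μ Q u x y < a) {ρ : X → ℝ≥0∞} (hρ : IsTestDensity μ Q ρ) {N : Set X}
    (hN : μ N = 0) {δ : ℝ} (hδ : 0 < δ) :
    ∃ γ : Curve X, γ 0 ∈ Metric.closedBall x δ ∧ γ 1 ∈ Metric.closedBall y δ ∧ γ 0 ∉ N ∧
      γ 1 ∉ N ∧ lineIntegral ρ γ ≠ ∞ ∧ curveLength (u ∘ γ) ≤ a := by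
  obtain ⟨ρN, hρN, HN⟩ := exists_testDensity_null hQ hN
  obtain ⟨ρ', hρ', H⟩ := exists_testDensity_pair hQ hρ hρN
  set ε := min δ (dist x y / 2) with hε
  have hd : 0 < dist x y := dist_pos.2 hxy
  have hε0 : 0 < ε := by positivity
  have hεd : ε ≤ dist x y / 2 := min_le_right _ _
  -- As `ε ≤ d(x,y) / 2`, the curve leaves the `ε`-balls of both `x` and `y`; it can therefore be
  -- trimmed at each end to a point off `N` in that ball.
  obtain ⟨γ, h0, h1, hfin, hlt⟩ := exists_curve_of_essLength_lt hQ
    ((essLength_le_essDist x y (half_pos hε0)).trans_lt h) hρ'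
  have hrect := rectifiable_of_lineIntegral_ne_top hfin
  have h0 : dist (γ 0) x ≤ ε / 2 := h0
  have h1 : dist (γ 1) y ≤ ε / 2 := h1
  have hae := HN γ (H γ hfin).2
  obtain ⟨s, hs, hsN⟩ := exists_notMem_of_exits hrect hae (half_lt_self hε0) h0 (by
    have := dist_triangle_left x y (γ 1)
    linarith)
  obtain ⟨t, ht, htN⟩ : ∃ t, dist (γ t) y < ε ∧ γ t ∉ N := by
    have hae' : ∀ᵐ t ∂lenMeas (reverse γ), reverse γ t ∉ N :=
      HN _ (by rw [lineIntegral_reverse _ hρN.measurable]; exact (H γ hfin).2)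
    have hr0 : reverse γ 0 = γ 1 := by simp [reverse]
    have hr1 : reverse γ 1 = γ 0 := by simp [reverse]
    obtain ⟨t, ht, htN⟩ := exists_notMem_of_exits (γ := reverse γ)
      (by rw [reverse]; exact (curveLength_comp_symm γ).trans_ne hrect) hae' (half_lt_self hε0)
      (hr0 ▸ h1) (by
        rw [hr1]
        have := dist_triangle_left x y (γ 0)
        linarith)
    exact ⟨unitInterval.symm t, ht, htN⟩
  obtain ⟨γ', h0', h1', hle, hlen⟩ := exists_subcurve u γ s t
  refine ⟨γ', ?_, ?_, h0' ▸ hsN, h1' ▸ htN, ?_, hlen.trans hlt.le⟩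
  · rw [h0']; exact hs.le.trans (min_le_left _ _)
  · rw [h1']; exact ht.le.trans (min_le_left _ _)
  · exact ne_top_of_le_ne_top (H γ hfin).1 (hle ρ hρ.measurable)

theorem essDist_comm (hQ : 0 < Q) (x y : X) : essDist μ Q u x y = essDist μ Q u y x := by
  suffices H : ∀ x y, essDist μ Q u x y ≤ essDist μ Q u y x from le_antisymm (H x y) (H y x)
  intro x y
  refine le_of_forall_gt_imp_ge_of_dense fun a ha => ?_
  refine essDist_le hQ one_pos fun δ hδ _ ρ hρ => ?_
  obtain ⟨γ, h0, h1, hfin, hlt⟩ := exists_curve_of_essLength_lt hQ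
    ((essLength_le_essDist y x hδ).trans_lt ha) hρ
  refine ⟨reverse γ, by simpa [reverse] using h1, by simpa [reverse] using h0, ?_, ?_⟩
  · rwa [lineIntegral_reverse _ hρ.measurable]
  · exact (curveLength_comp_symm (u ∘ γ)).trans_le hlt.le

/-- Off an exceptional family, a weak upper gradient controls the lengths of the images of all
subcurves. -/
theorem exists_testDensity_weakUpperGradient (hX : IsMetricMeasureSpace μ) (hQ : 0 < Q) {p : ℝ}
    (hp : Q ≤ p) {g : X → ℝ≥0∞} (hg : IsWeakUpperGradient μ p u g) (hgp : LocallyLp μ p g) :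
    ∃ ρ, IsTestDensity μ Q ρ ∧ ∀ γ : Curve X, lineIntegral ρ γ ≠ ∞ →
      lineIntegral g γ ≠ ∞ ∧ ∀ s t, s ≤ t →
        eVariationOn (u ∘ γ) (Icc s t) ≤ ∫⁻ r in Icc s t, g (γ r) ∂lenMeas γ := by
  obtain ⟨hgm, Γ₀, hΓ₀, hug⟩ := hg
  obtain ⟨ρp, hm, hint, hρp⟩ := exists_of_modulus_eq_zero (hQ.trans_le hp) hΓ₀
  obtain ⟨ρ₁, h₁, H₁⟩ := ((LocallyLp.of_lintegral_ne_top hint).mono_exponent hX hQ.le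
    hp).exists_testDensity hX hQ hm
  obtain ⟨ρ₂, h₂, H₂⟩ := (hgp.mono_exponent hX hQ.le hp).exists_testDensity hX hQ hgm
  obtain ⟨ρ, h, H⟩ := exists_testDensity_pair hQ h₁ h₂
  refine ⟨ρ, h, fun γ hγ => ⟨H₂ γ (H γ hγ).2, fun s t hst => ?_⟩⟩
  have hrect := rectifiable_of_lineIntegral_ne_top hγ
  have hMat : ∀ t, (lenMeas γ).withDensity (fun r => g (γ r)) {t} = 0 := fun t =>
    withDensity_absolutelyContinuous _ _ (lenMeas_singleton hrect t)
  rw [← withDensity_apply _ measurableSet_Icc]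
  refine eVariationOn_le_measure hMat fun a b hab _ _ => ?_
  rw [withDensity_apply _ measurableSet_Icc, ← lineIntegral_affineSub hrect hab hgm]
  -- Finiteness of the integral of `ρp` passes to subcurves, so all of them avoid `Γ₀` at once.
  have hnot : γ.comp (affineSub a b) ∉ Γ₀ := fun hmem =>
    (ne_top_of_le_ne_top (H₁ γ (H γ hγ).1) (lineIntegral_affineSub_le γ hab hm)) (hρp _ hmem)
  have := hug _ hnot
  rw [UpperGradientAlong, edist_comm] at this
  simpa [affineSub_zero, affineSub_one] using this

theorem curveLength_le_lineIntegral_of_forall {g : X → ℝ≥0∞} (hg : Measurable g) {γ : Curve X}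
    (hγ : lineIntegral g γ ≠ ∞) (h : ∀ s t, s ≤ t →
      eVariationOn (u ∘ γ) (Icc s t) ≤ ∫⁻ r in Icc s t, g (γ r) ∂lenMeas γ) :
    curveLength (u ∘ γ) ≤ lineIntegral g γ := by
  have h01 := h 0 1 zero_le_one
  have huniv : Icc (0 : unitInterval) 1 = univ := Icc_bot_top
  rw [huniv, Measure.restrict_univ] at h01
  rwa [lineIntegral_eq (rectifiable_of_lineIntegral_ne_top hγ) hg]

end EssDist


/-! ## The pseudometric -/

section PseudoMetric

variable {X Y : Type*} [MetricSpace X] [MeasurableSpace X] [BorelSpace X] [MetricSpace Y]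
  {μ : Measure X} {Q p : ℝ} {u : X → Y} {g : X → ℝ≥0∞}

/-- The standing assumptions on a map with a `p`-weak upper gradient in `L^p_loc`, where `p > Q`. -/
structure SobolevSetting (μ : Measure X) (Q p : ℝ) (u : X → Y) (g : X → ℝ≥0∞) : Prop where
  metricMeasure : IsMetricMeasureSpace μ
  doubling : IsDoubling μ
  one_le : 1 ≤ Q
  lt : Q < p
  volume : RelativeVolumeLowerBound μ Q
  poincare : SupportsPoincare μ Q
  nontrivial : Nontrivial X
  weakUpperGradient : IsWeakUpperGradient μ p u g
  locallyLp : LocallyLp μ p g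

theorem IsMetricMeasureSpace.exists_mem_ball_notMem (hX : IsMetricMeasureSpace μ) {N : Set X}
    (hN : μ N = 0) (x : X) {r : ℝ} (hr : 0 < r) : ∃ z ∈ Metric.ball x r, z ∉ N := by
  by_contra! hcon
  exact (hX.ball_pos x r hr).ne' (measure_mono_null hcon hN)

namespace SobolevSetting

theorem pos (S : SobolevSetting μ Q p u g) : 0 < Q := zero_lt_one.trans_le S.one_le

/-- The order of quantifiers is essential: only the null set depends on `ρ`, so the bound survives
the supremum over exceptional families in the essential distance. -/
theorem exists_holder_curve (S : SobolevSetting μ Q p u g) :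
    ∃ M : X → ℝ → ℝ≥0, ∀ ρ, IsTestDensity μ Q ρ → ∃ N, μ N = 0 ∧ ∀ x₀ R, 0 < R →
      ∀ z₁ ∈ Metric.ball x₀ R, ∀ z₂ ∈ Metric.ball x₀ R, z₁ ∉ N → z₂ ∉ N →
      ∀ r, 0 < r → 2 * r ≤ R → dist z₁ z₂ ≤ r → ∃ γ : Curve X, γ 0 = z₁ ∧ γ 1 = z₂ ∧
        lineIntegral ρ γ ≠ ∞ ∧ curveLength (u ∘ γ) ≤ M x₀ R * ENNReal.ofReal (r ^ (1 - Q / p)) := by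
  have := S.metricMeasure.proper
  have := S.metricMeasure.isLocallyFinite
  have := S.nontrivial
  obtain ⟨g', hgle, hg'lsc, hg'⟩ := S.locallyLp.exists_lowerSemicontinuous_ge
    (S.pos.trans S.lt) S.weakUpperGradient.1
  have key : ∀ (x₀ : X) (R : ℝ), ∃ M : ℝ≥0, 0 < R → _ := fun x₀ R => by
    by_cases hR : 0 < R
    · obtain ⟨M, hM⟩ := exists_curve_lineIntegral_le S.metricMeasure S.doubling S.one_le S.lt
        S.volume S.poincare hg'lsc hg' x₀ hR
      exact ⟨M, fun _ => hM⟩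
    · exact ⟨0, fun h => absurd h hR⟩
  choose M hM using key
  refine ⟨fun x₀ R => M x₀ R + 1, fun ρ hρ => ?_⟩
  obtain ⟨ρu, hρu, hu⟩ := exists_testDensity_weakUpperGradient S.metricMeasure S.pos S.lt.le
    S.weakUpperGradient S.locallyLp
  obtain ⟨ρ₁, hρ₁, h₁⟩ := exists_testDensity_pair S.pos hρ hρu
  obtain ⟨ρ₂, hle, hlsc, hρ₂⟩ := hρ₁.exists_lowerSemicontinuous S.metricMeasure S.pos
  refine ⟨{z | ¬ MaxFinite μ Q ρ₂ z}, ae_maxFinite S.metricMeasure S.doubling hρ₂.measurable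
    hρ₂.lintegral_ne_top, fun x₀ R hR z₁ hz₁ z₂ hz₂ hN₁ hN₂ r hr hrR hz => ?_⟩
  have hpow : 0 < r ^ (1 - Q / p) := by positivity
  obtain ⟨γ, h0, h1, hfin, hle'⟩ := hM x₀ R hR ρ₂ hlsc z₁ hz₁ z₂ hz₂ (not_not.1 hN₁) (not_not.1 hN₂)
    r hr hrR hz (r ^ (1 - Q / p)).toNNReal (Real.toNNReal_pos.2 hpow)
  have hfin₁ := h₁ γ (ne_top_of_le_ne_top hfin (lineIntegral_mono hle γ))
  obtain ⟨hgfin, hlen⟩ := hu γ hfin₁.2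
  refine ⟨γ, h0, h1, hfin₁.1, ?_⟩
  calc curveLength (u ∘ γ) ≤ lineIntegral g γ :=
        curveLength_le_lineIntegral_of_forall S.weakUpperGradient.1 hgfin hlen
    _ ≤ lineIntegral g' γ := lineIntegral_mono hgle γ
    _ ≤ _ := hle'
    _ = _ := by push_cast; rw [← ENNReal.ofReal]; ring

theorem exists_small_curve (S : SobolevSetting μ Q p u g) :
    ∃ δ : X → ℝ≥0 → ℝ, (∀ x ε, 0 < ε → 0 < δ x ε) ∧ ∀ ρ, IsTestDensity μ Q ρ → ∃ N, μ N = 0 ∧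
      ∀ x₀ ε, 0 < ε → ∀ z₁ ∈ Metric.closedBall x₀ (δ x₀ ε), ∀ z₂ ∈ Metric.closedBall x₀ (δ x₀ ε),
      z₁ ∉ N → z₂ ∉ N → ∃ γ : Curve X, γ 0 = z₁ ∧ γ 1 = z₂ ∧
        lineIntegral ρ γ ≠ ∞ ∧ curveLength (u ∘ γ) ≤ ε := by
  obtain ⟨M, hM⟩ := S.exists_holder_curve
  have hα : 0 < 1 - Q / p := by
    have := (div_lt_one (S.pos.trans S.lt)).2 S.lt
    linarith
  -- Two points of the closed `δ`-ball have distance at most `r = 2 δ`; the bound `δ ≤ 1 / 4` gives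
  -- `2 r ≤ R` for `R = 1`.
  have key : ∀ (x : X) (ε : ℝ≥0), ∃ δ : ℝ, 0 < ε → 0 < δ ∧ δ ≤ 1 / 4 ∧
      M x 1 * ENNReal.ofReal ((2 * δ) ^ (1 - Q / p)) ≤ ε := by
    intro x ε
    by_cases hε : 0 < ε
    · have hlim : Tendsto (fun δ : ℝ => M x 1 * ENNReal.ofReal ((2 * δ) ^ (1 - Q / p))) (𝓝 0)
          (𝓝 (M x 1 * ENNReal.ofReal ((2 * (0 : ℝ)) ^ (1 - Q / p)))) := by
        refine ENNReal.Tendsto.const_mul (ENNReal.tendsto_ofReal ?_) (Or.inr ENNReal.coe_ne_top)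
        exact ((continuous_const.mul continuous_id).rpow_const fun _ => Or.inr hα.le).tendsto 0
      rw [mul_zero, Real.zero_rpow hα.ne', ENNReal.ofReal_zero, mul_zero] at hlim
      have hev := (hlim.mono_left (nhdsWithin_le_nhds (s := Ioi 0))).eventually
        (gt_mem_nhds (show (0 : ℝ≥0∞) < ε by exact_mod_cast hε))
      obtain ⟨δ, h1, h2, h3⟩ :=
        (hev.and (Ioc_mem_nhdsGT (show (0 : ℝ) < 1 / 4 by norm_num))).exists
      exact ⟨δ, fun _ => ⟨h2, h3, h1.le⟩⟩
    · exact ⟨0, fun h => absurd h hε⟩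
  choose δ hδ using key
  refine ⟨δ, fun x ε hε => (hδ x ε hε).1, fun ρ hρ => ?_⟩
  obtain ⟨N, hN, H⟩ := hM ρ hρ
  refine ⟨N, hN, fun x₀ ε hε z₁ hz₁ z₂ hz₂ hN₁ hN₂ => ?_⟩
  obtain ⟨hδ0, hδ1, hδM⟩ := hδ x₀ ε hε
  obtain ⟨γ, h0, h1, hfin, hle⟩ := H x₀ 1 one_pos z₁
    (Metric.closedBall_subset_ball (by linarith) hz₁) z₂
    (Metric.closedBall_subset_ball (by linarith) hz₂) hN₁ hN₂ (2 * δ x₀ ε) (by positivity)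
    (by linarith) (by
      have := dist_triangle_right z₁ z₂ x₀
      have h1 := Metric.mem_closedBall.1 hz₁
      have h2 := Metric.mem_closedBall.1 hz₂
      linarith)
  exact ⟨γ, h0, h1, hfin, hle.trans hδM⟩

theorem essDist_ne_top (S : SobolevSetting μ Q p u g) (x y : X) : essDist μ Q u x y ≠ ∞ := by
  obtain ⟨M, hM⟩ := S.exists_holder_curve
  set r := dist x y + 1 with hr
  have hr0 : 0 < r := by positivity
  refine ne_top_of_le_ne_top (b := M x (2 * r) * ENNReal.ofReal (r ^ (1 - Q / p)))
    (ENNReal.mul_ne_top ENNReal.coe_ne_top ENNReal.ofReal_ne_top)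
    (essDist_le S.pos (show (0 : ℝ) < 1 / 2 by norm_num) fun δ hδ hδ1 ρ hρ => ?_)
  obtain ⟨N, hN, H⟩ := hM ρ hρ
  obtain ⟨z₁, hz₁, hN₁⟩ := S.metricMeasure.exists_mem_ball_notMem hN x hδ
  obtain ⟨z₂, hz₂, hN₂⟩ := S.metricMeasure.exists_mem_ball_notMem hN y hδ
  have h1 := Metric.mem_ball.1 hz₁
  have h2 := Metric.mem_ball.1 hz₂
  have h3 := dist_triangle4_right z₁ z₂ x y
  have hd : (0 : ℝ) ≤ dist x y := dist_nonneg
  obtain ⟨γ, h0, h1, hfin, hle⟩ := H x (2 * r) (by positivity) z₁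
    (Metric.mem_ball.2 (by linarith)) z₂ (Metric.mem_ball.2 (by
      have := dist_triangle z₂ y x
      rw [dist_comm y x] at this
      linarith)) hN₁ hN₂ r hr0 le_rfl (by linarith)
  exact ⟨γ, h0 ▸ Metric.ball_subset_closedBall hz₁, h1 ▸ Metric.ball_subset_closedBall hz₂,
    hfin, hle⟩

theorem exists_forall_essDist_le (S : SobolevSetting μ Q p u g) (x : X) {ε : ℝ≥0} (hε : 0 < ε) :
    ∃ δ > 0, ∀ y, dist y x < δ → essDist μ Q u x y ≤ ε := by
  obtain ⟨δ, hδ, hδ'⟩ := S.exists_small_curve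
  refine ⟨δ x ε, hδ x ε hε, fun y hy => ?_⟩
  -- For `t ≤ δ x ε - d(y,x)`, the `t`-ball at `y` stays in the `δ x ε`-ball at `x`.
  refine essDist_le S.pos (sub_pos.2 hy) fun t ht htle ρ hρ => ?_
  obtain ⟨N, hN, H⟩ := hδ' ρ hρ
  obtain ⟨z₁, hz₁, hN₁⟩ := S.metricMeasure.exists_mem_ball_notMem hN x ht
  obtain ⟨z₂, hz₂, hN₂⟩ := S.metricMeasure.exists_mem_ball_notMem hN y ht
  have hd : (0 : ℝ) ≤ dist y x := dist_nonneg
  have h1 := Metric.mem_ball.1 hz₁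
  have h2 := Metric.mem_ball.1 hz₂
  have h3 := dist_triangle z₂ y x
  obtain ⟨γ, h0, h1, hfin, hle⟩ := H x ε hε z₁ (Metric.mem_closedBall.2 (by linarith)) z₂
    (Metric.mem_closedBall.2 (by linarith)) hN₁ hN₂
  exact ⟨γ, h0 ▸ Metric.ball_subset_closedBall hz₁, h1 ▸ Metric.ball_subset_closedBall hz₂,
    hfin, hle⟩

theorem essDist_self (S : SobolevSetting μ Q p u g) (x : X) : essDist μ Q u x x = 0 := by
  refine le_antisymm (ENNReal.le_of_forall_pos_le_add fun ε hε _ => ?_) bot_le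
  obtain ⟨δ, hδ, h⟩ := S.exists_forall_essDist_le x hε
  rw [zero_add]
  exact h x (by rwa [dist_self])

/-- Two nearly optimal curves end and begin near `y`, but not at the same point. With these
endpoints off the null set, a curve of small `u`-length closes the gap. Coinciding points are
treated apart because trimming a curve off a null set needs distinct centres. -/
theorem essDist_triangle (S : SobolevSetting μ Q p u g) (x y z : X) :
    essDist μ Q u x z ≤ essDist μ Q u x y + essDist μ Q u y z := by
  rcases eq_or_ne x y with rfl | hxy
  · exact le_add_self
  rcases eq_or_ne y z with rfl | hyz
  · exact le_self_add
  refine ENNReal.le_of_forall_pos_le_add fun ε hε _ => ?_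
  have hε3 : 0 < ε / 3 := by positivity
  have hε3' : ((ε / 3 : ℝ≥0) : ℝ≥0∞) ≠ 0 := by exact_mod_cast hε3.ne'
  obtain ⟨δ, hδ, hδ'⟩ := S.exists_small_curve
  refine essDist_le S.pos (hδ y _ hε3) fun t ht htle ρ hρ => ?_
  obtain ⟨N, hN, H⟩ := hδ' ρ hρ
  obtain ⟨γ₁, a₀, a₁, -, aN, afin, alen⟩ := exists_curve_of_essDist_lt S.pos hxy
    (ENNReal.lt_add_right (S.essDist_ne_top x y) hε3') hρ hN ht
  obtain ⟨γ₂, b₀, b₁, bN, -, bfin, blen⟩ := exists_curve_of_essDist_lt S.pos hyz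
    (ENNReal.lt_add_right (S.essDist_ne_top y z) hε3') hρ hN ht
  obtain ⟨c, c₀, c₁, cfin, clen⟩ := H y _ hε3 (γ₁ 1)
    (Metric.closedBall_subset_closedBall htle a₁) (γ₂ 0)
    (Metric.closedBall_subset_closedBall htle b₀) aN bN
  have hc2 : concat γ₁ c c₀.symm 1 = γ₂ 0 := by rw [concat_one, c₁]
  refine ⟨concat (concat γ₁ c c₀.symm) γ₂ hc2, ?_, ?_, ?_, ?_⟩
  · rwa [concat_zero, concat_zero]
  · rwa [concat_one]
  · refine ne_top_of_le_ne_top ?_ (lineIntegral_concat_le _ _ hc2 hρ.measurable)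
    refine ENNReal.add_ne_top.2 ⟨ne_top_of_le_ne_top (ENNReal.add_ne_top.2 ⟨afin, cfin⟩)
      (lineIntegral_concat_le _ _ c₀.symm hρ.measurable), bfin⟩
  · rw [curveLength_concat, curveLength_concat]
    calc _ ≤ (essDist μ Q u x y + (ε / 3 : ℝ≥0)) + (ε / 3 : ℝ≥0) +
          (essDist μ Q u y z + (ε / 3 : ℝ≥0)) := by gcongr
      _ = essDist μ Q u x y + essDist μ Q u y z +
          ((ε / 3 : ℝ≥0) + (ε / 3 : ℝ≥0) + (ε / 3 : ℝ≥0) : ℝ≥0) := by push_cast; ring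
      _ = _ := by rw [add_thirds]

theorem isFinitePseudoDist (S : SobolevSetting μ Q p u g) :
    IsFinitePseudoDist (essDist μ Q u) :=
  ⟨S.essDist_self, essDist_comm S.pos, S.essDist_triangle, S.essDist_ne_top⟩

theorem continuous_proj (S : SobolevSetting μ Q p u g) :
    Continuous (proj S.isFinitePseudoDist) := by
  refine EMetric.continuous_iff.2 fun x ε hε => ?_
  obtain ⟨ε', hε', hlt⟩ := ENNReal.lt_iff_exists_nnreal_btwn.1 hε
  obtain ⟨δ, hδ, h⟩ := S.exists_forall_essDist_le x (by exact_mod_cast hε' : 0 < ε')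
  refine ⟨ENNReal.ofReal δ, ENNReal.ofReal_pos.2 hδ, fun y hy => ?_⟩
  rw [edist_lt_ofReal] at hy
  rw [edist_comm, edist_proj]
  exact (h y hy).trans_lt hlt

end SobolevSetting

end PseudoMetric


/-! ## The metric space of classes -/

section Classes

variable {X Y : Type*} [MetricSpace X] [MeasurableSpace X] [BorelSpace X] [MetricSpace Y]
  {μ : Measure X} {Q p : ℝ} {u : X → Y} {g : X → ℝ≥0∞}

/-- If the fibre split into two closed pieces, a compact shell around one of them would miss the
fibre, so its projection would have positive distance `m` from the class. Points of the two pieces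
have essential distance zero, so a curve of `u`-length less than `m / 2` runs from near one to near
the other. It must cross the shell, which is too far away. -/
theorem SobolevSetting.isPreconnected_fiber (S : SobolevSetting μ Q p u g)
    (h : IsFinitePseudoDist (essDist μ Q u)) (z : QuotientSpace h)
    (hz : IsCompact (proj h ⁻¹' {z})) : IsPreconnected (proj h ⁻¹' {z}) := by
  have := S.metricMeasure.proper
  have hP : Continuous (proj h) := S.continuous_proj
  refine (isPreconnected_iff_subset_of_fully_disjoint_closed hz.isClosed).2
    fun V W hV hW hVW hdisj => ?_
  by_contra! hcon
  obtain ⟨⟨b, hb, hbV⟩, ⟨a, ha, haW⟩⟩ :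
      (∃ b ∈ proj h ⁻¹' {z}, b ∉ V) ∧ ∃ a ∈ proj h ⁻¹' {z}, a ∉ W :=
    ⟨not_subset.1 hcon.1, not_subset.1 hcon.2⟩
  have haV : a ∈ V := (hVW ha).resolve_right haW
  have hbW : b ∈ W := (hVW hb).resolve_left hbV
  obtain ⟨L, hL, hAL, hLW⟩ := exists_compact_between (hz.inter_right hV) hW.isOpen_compl
    fun x hx hxW => disjoint_left.1 hdisj hx.2 hxW
  have haL : a ∈ interior L := hAL ⟨ha, haV⟩
  have hbL : b ∈ Lᶜ := fun h => hLW h hbW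
  have hab : essDist μ Q u a b = 0 := (proj_eq_iff h a b).1 (ha.trans hb.symm)
  obtain ⟨m, hm, hmle⟩ := (hL.diff isOpen_interior).exists_forall_le'
    (f := fun y => dist (proj h a) (proj h y)) (a := 0)
    (continuous_const.dist hP).continuousOn fun y hy => by
      refine dist_pos.2 fun heq => ?_
      have hyF : y ∈ proj h ⁻¹' {z} := heq.symm.trans ha
      rcases hVW hyF with hyV | hyW
      · exact hy.2 (hAL ⟨hyF, hyV⟩)
      · exact hLW hy.1 hyW
  obtain ⟨δ₁, hδ₁, h₁⟩ := Metric.nhds_basis_closedBall.mem_iff.1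
    (isOpen_interior.mem_nhds haL)
  obtain ⟨δ₂, hδ₂, h₂⟩ := Metric.nhds_basis_closedBall.mem_iff.1
    (hL.isClosed.isOpen_compl.mem_nhds hbL)
  obtain ⟨δ₃, hδ₃, h₃⟩ := Metric.continuous_iff.1 hP a (m / 2) (half_pos hm)
  set δ := min (min δ₁ δ₂) (δ₃ / 2) with hδ
  have hδ0 : 0 < δ := by positivity
  obtain ⟨ρ, hρ, hρD⟩ := exists_testDensity_essDist_le (u := u) S.metricMeasure S.pos
  obtain ⟨γ, γ0, γ1, hfin, hlt⟩ := exists_curve_of_essLength_lt (a := ENNReal.ofReal (m / 2)) S.pos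
    ((essLength_le_essDist a b hδ0).trans_lt (by rw [hab]; simpa using hm)) hρ
  have hγ0 : γ 0 ∈ interior L := h₁ (Metric.closedBall_subset_closedBall
    ((min_le_left _ _).trans (min_le_left _ _)) γ0)
  have hγ1 : γ 1 ∈ Lᶜ := h₂ (Metric.closedBall_subset_closedBall
    ((min_le_left _ _).trans (min_le_right _ _)) γ1)
  obtain ⟨t, htL, htI⟩ : ∃ t, γ t ∈ L ∧ γ t ∉ interior L := by
    by_contra! hcov
    obtain ⟨t, -, ht1, ht2⟩ := isPreconnected_univ (γ ⁻¹' interior L) (γ ⁻¹' Lᶜ)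
      (isOpen_interior.preimage γ.continuous) (hL.isClosed.isOpen_compl.preimage γ.continuous)
      (fun t _ => (em (γ t ∈ L)).imp (hcov t) id) ⟨0, trivial, hγ0⟩ ⟨1, trivial, hγ1⟩
    exact ht2 (interior_subset ht1)
  obtain ⟨γ', e0, e1, hle, hlen⟩ := exists_subcurve u γ 0 t
  have hD := hρD γ' (ne_top_of_le_ne_top hfin (hle ρ hρ.measurable))
  rw [e0, e1, ← edist_proj h] at hD
  have hD' : dist (proj h (γ 0)) (proj h (γ t)) < m / 2 := by
    rw [← edist_lt_ofReal]
    exact (hD.trans hlen).trans_lt hlt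
  have hD'' : dist (proj h (γ 0)) (proj h a) < m / 2 := h₃ _ (by
    have h5 : dist (γ 0) a ≤ δ := γ0
    have h6 : δ ≤ δ₃ / 2 := min_le_right _ _
    linarith)
  have h7 : m ≤ dist (proj h a) (proj h (γ t)) := hmle _ ⟨htL, htI⟩
  have h8 := dist_triangle_left (proj h a) (proj h (γ t)) (proj h (γ 0))
  linarith

/-- The standing assumptions on a map of finite distortion type with a Jacobian. -/
structure JacobianSetting [MeasurableSpace Y] [BorelSpace Y] (μ : Measure X) (ν : Measure Y)
    (Q p K : ℝ) (u : X → Y) (g J : X → ℝ≥0∞) : Prop extends SobolevSetting μ Q p u g where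
  target : IsMetricMeasureSpace ν
  continuous : Continuous u
  isCompact_preimage : ∀ C : Set Y, IsCompact C → IsCompact (u ⁻¹' C)
  nonconstant : ∃ x y : X, u x ≠ u y
  jacobian : HasLocIntJacobian μ ν u J
  distortion : ∀ᵐ x ∂μ, g x ^ Q ≤ ENNReal.ofReal K * J x

variable [MeasurableSpace Y] [BorelSpace Y] {ν : Measure Y} {K : ℝ} {J : X → ℝ≥0∞}

/-- The push-forward of the measure with density `J` under the projection. -/
def classMeasure (μ : Measure X) (J : X → ℝ≥0∞) {D : X → X → ℝ≥0∞} (h : IsFinitePseudoDist D) :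
    Measure (QuotientSpace h) :=
  (μ.withDensity J).map (proj h)

namespace JacobianSetting

theorem edist_le (S : JacobianSetting μ ν Q p K u g J) (x y : X) :
    edist (u x) (u y) ≤ essDist μ Q u x y :=
  edist_le_essDist μ S.pos S.continuous x y

theorem continuous_proj (S : JacobianSetting μ ν Q p K u g J)
    (h : IsFinitePseudoDist (essDist μ Q u)) : Continuous (proj h) :=
  S.toSobolevSetting.continuous_proj

/-- The essential distance dominates the distance of the `u`-images, so the set is closed in the
`u`-preimage of a compact ball. -/
theorem isCompact_preimage_closedBall (S : JacobianSetting μ ν Q p K u g J)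
    (h : IsFinitePseudoDist (essDist μ Q u)) (z : QuotientSpace h) (r : ℝ) :
    IsCompact (proj h ⁻¹' Metric.closedBall z r) := by
  have := S.target.proper
  obtain ⟨x, rfl⟩ := proj_surjective h z
  refine (S.isCompact_preimage _ (isCompact_closedBall (u x) r)).of_isClosed_subset
    (Metric.isClosed_closedBall.preimage (S.continuous_proj h)) fun y hy => ?_
  have hy' : edist (proj h y) (proj h x) ≤ ENNReal.ofReal r := by
    have hy : dist (proj h y) (proj h x) ≤ r := hy
    rw [edist_dist]
    exact ENNReal.ofReal_le_ofReal hy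
  rcases lt_or_ge r 0 with hr | hr
  · have hy : dist (proj h y) (proj h x) ≤ r := hy
    linarith [dist_nonneg (x := proj h y) (y := proj h x)]
  · rw [edist_proj] at hy'
    have := (S.edist_le y x).trans hy'
    rwa [edist_le_ofReal hr] at this

theorem properSpace (S : JacobianSetting μ ν Q p K u g J)
    (h : IsFinitePseudoDist (essDist μ Q u)) : ProperSpace (QuotientSpace h) := by
  refine ⟨fun z r => ?_⟩
  rw [← image_preimage_eq (Metric.closedBall z r) (proj_surjective h)]
  exact (S.isCompact_preimage_closedBall h z r).image (S.continuous_proj h)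

theorem isPreconnected_fiber (S : JacobianSetting μ ν Q p K u g J)
    (h : IsFinitePseudoDist (essDist μ Q u)) (z : QuotientSpace h) :
    IsPreconnected (proj h ⁻¹' {z}) := by
  refine S.toSobolevSetting.isPreconnected_fiber h z ?_
  rw [← Metric.closedBall_zero]
  exact S.isCompact_preimage_closedBall h z 0

theorem setLIntegral_jacobian_ne_top (S : JacobianSetting μ ν Q p K u g J) {C : Set X}
    (hC : IsCompact C) : ∫⁻ x in C, J x ∂μ ≠ ∞ := by
  have := S.jacobian.locallyIntegrable.lt_top_of_isCompact hC
  simpa using this.ne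

/-- The points with nontrivial classes lie over a null set. -/
theorem exists_null_forall_eq (S : JacobianSetting μ ν Q p K u g J)
    (h : IsFinitePseudoDist (essDist μ Q u)) :
    ∃ W : Set Y, MeasurableSet W ∧ ν W = 0 ∧ ∀ x x', u x ∉ W → proj h x = proj h x' → x = x' := by
  have := S.metricMeasure.proper
  have hP := S.continuous_proj h
  obtain ⟨x₀, -, -⟩ := S.nonconstant
  -- Bounding the points and separating them by `1 / (n + 1)` makes each set of identified pairs
  -- compact, so its image in `Y` is compact and `J` is integrable over the preimage of that image.
  set C : ℕ → Set (X × X) := fun n =>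
    (Metric.closedBall x₀ n ×ˢ Metric.closedBall x₀ n) ∩
      {q | proj h q.1 = proj h q.2 ∧ 1 / ((n : ℝ) + 1) ≤ dist q.1 q.2} with hC
  have hCc : ∀ n, IsCompact (C n) := fun n => by
    refine ((isCompact_closedBall x₀ n).prod (isCompact_closedBall x₀ n)).inter_right ?_
    exact (isClosed_eq (hP.comp continuous_fst) (hP.comp continuous_snd)).inter
      (isClosed_le continuous_const (continuous_fst.dist continuous_snd))
  have hW : ∀ n, IsCompact ((fun q : X × X => u q.1) '' C n) := fun n =>
    (hCc n).image (S.continuous.comp continuous_fst)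
  refine ⟨⋃ n, (fun q : X × X => u q.1) '' C n, MeasurableSet.iUnion fun n => (hW n).measurableSet,
    measure_iUnion_null fun n => ?_, fun x x' hx hxx' => ?_⟩
  · set W := (fun q : X × X => u q.1) '' C n
    have hfin := S.setLIntegral_jacobian_ne_top (S.isCompact_preimage W (hW n))
    rw [S.jacobian.area _ ((hW n).measurableSet.preimage S.continuous.measurable),
      multiplicityIntegral] at hfin
    by_contra hne
    refine hfin (eq_top_iff.2 ?_)
    calc ∞ = ∫⁻ y in W, ∞ ∂ν := by rw [setLIntegral_const, ENNReal.top_mul hne]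
      _ = ∫⁻ y, W.indicator (fun _ => ∞) y ∂ν :=
          (lintegral_indicator (hW n).measurableSet _).symm
      _ ≤ _ := lintegral_mono fun y => ?_
    by_cases hy : y ∈ W
    · rw [indicator_of_mem hy]
      obtain ⟨⟨a, b⟩, ⟨hmem, hab, hd⟩, rfl⟩ := hy
      have hab' : a ≠ b := by
        rintro rfl
        rw [dist_self] at hd
        have : 0 < 1 / ((n : ℝ) + 1) := by positivity
        linarith
      -- A connected class with two points is infinite. As `u` is constant on it, the multiplicity
      -- is infinite over all of `W`; positive measure of `W` would make the integral of `J`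
      -- infinite.
      have hinf : (proj h ⁻¹' {proj h a}).Infinite :=
        ((S.isPreconnected_fiber h (proj h a)).infinite_of_nontrivial
          ⟨a, rfl, b, hab.symm, hab'⟩)
      have hsub : proj h ⁻¹' {proj h a} ⊆ u ⁻¹' {u a} ∩ u ⁻¹' W := fun x hx => by
        have hux : u x = u a := by
          have h0 := (proj_eq_iff h x a).1 hx
          exact edist_le_zero.1 ((S.edist_le x a).trans h0.le)
        exact ⟨hux, ⟨(a, b), ⟨hmem, hab, hd⟩, hux.symm⟩⟩
      change ∞ ≤ ((u ⁻¹' {u a} ∩ u ⁻¹' W).encard : ℝ≥0∞)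
      rw [(hinf.mono hsub).encard_eq]
      simp
    · rw [indicator_of_notMem hy]
      exact bot_le
  · by_contra hne
    have hd : 0 < dist x x' := dist_pos.2 hne
    obtain ⟨n, hn⟩ := exists_nat_gt (max (max (dist x x₀) (dist x' x₀)) (1 / dist x x'))
    have h1 : dist x x₀ ≤ n := ((le_max_left _ _).trans (le_max_left _ _)).trans hn.le
    have h2 : dist x' x₀ ≤ n := ((le_max_right _ _).trans (le_max_left _ _)).trans hn.le
    have h3 : 1 / dist x x' ≤ n + 1 := ((le_max_right _ _).trans hn.le).trans (by linarith)
    refine hx (mem_iUnion.2 ⟨n, ⟨(x, x'), ⟨⟨h1, h2⟩, hxx', ?_⟩, rfl⟩⟩)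
    rw [div_le_iff₀ hd] at h3
    rw [div_le_iff₀ (by positivity)]
    linarith

/-! ### The measure on the classes and the multiplicity of the projection -/

variable {h : IsFinitePseudoDist (essDist μ Q u)}

theorem classMeasure_apply (S : JacobianSetting μ ν Q p K u g J) {E : Set (QuotientSpace h)}
    (hE : MeasurableSet E) : classMeasure μ J h E = ∫⁻ x in proj h ⁻¹' E, J x ∂μ := by
  have hP := (S.continuous_proj h).measurable
  rw [classMeasure, Measure.map_apply hP hE, withDensity_apply _ (hP hE)]

theorem setLIntegral_preimage_null (S : JacobianSetting μ ν Q p K u g J) {W : Set Y}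
    (hW : MeasurableSet W) (h0 : ν W = 0) : ∫⁻ x in u ⁻¹' W, J x ∂μ = 0 := by
  rw [S.jacobian.area _ (S.continuous.measurable hW), multiplicityIntegral]
  have hae : (fun y => ((u ⁻¹' {y} ∩ u ⁻¹' W).encard : ℝ≥0∞)) =ᵐ[ν] fun _ => 0 := by
    filter_upwards [compl_mem_ae_iff.2 h0] with y hy
    have : u ⁻¹' {y} ∩ u ⁻¹' W = ∅ := by
      ext x
      simp only [mem_inter_iff, mem_preimage, mem_singleton_iff, mem_empty_iff_false, iff_false]
      rintro ⟨rfl, hx⟩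
      exact hy hx
    simp [this]
  rw [lintegral_congr_ae hae, lintegral_zero]

/-- For `y` outside the null set `W`, the projection is injective on the fibre of `u` over `y`. The
multiplicities of `u` and of its factor then agree, and the area formula for `u` is the required
identity. -/
theorem isPullbackMeasure (S : JacobianSetting μ ν Q p K u g J)
    (hu : ∀ x y, edist (u x) (u y) ≤ essDist μ Q u x y) :
    IsPullbackMeasure ν (factor h u hu) (classMeasure μ J h) := by
  intro E hE
  obtain ⟨W, hW, hW0, hinj⟩ := S.exists_null_forall_eq h
  rw [S.classMeasure_apply hE, S.jacobian.area _ ((S.continuous_proj h).measurable hE)]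
  refine lintegral_congr_ae ?_
  filter_upwards [compl_mem_ae_iff.2 hW0] with y hy
  have himage : factor h u hu ⁻¹' {y} ∩ E = proj h '' (u ⁻¹' {y} ∩ proj h ⁻¹' E) := by
    ext z
    constructor
    · rintro ⟨hz, hzE⟩
      obtain ⟨x, rfl⟩ := proj_surjective h z
      exact ⟨x, ⟨hz, hzE⟩, rfl⟩
    · rintro ⟨x, ⟨hx, hxE⟩, rfl⟩
      exact ⟨hx, hxE⟩
  rw [himage, InjOn.encard_image]
  intro x hx x' _ heq
  refine hinj x x' ?_ heq
  rw [show u x = y from hx.1]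
  exact hy

theorem ae_factor_notMem (S : JacobianSetting μ ν Q p K u g J) {W : Set Y} (hW : MeasurableSet W)
    (h0 : ν W = 0) : ∀ᵐ z ∂classMeasure μ J h, ∀ x, proj h x = z → u x ∉ W := by
  have hP := (S.continuous_proj h).measurable
  have hf : Measurable (factor h u S.edist_le) := by
    refine Continuous.measurable ?_
    refine (LipschitzWith.mk_one (f := factor h u S.edist_le) fun a b => ?_).continuous
    obtain ⟨x, rfl⟩ := proj_surjective h a
    obtain ⟨y, rfl⟩ := proj_surjective h b
    have := S.edist_le x y
    rw [← edist_proj h, edist_dist, edist_dist] at this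
    exact (ENNReal.ofReal_le_ofReal_iff dist_nonneg).1 this
  have hnull : classMeasure μ J h (factor h u S.edist_le ⁻¹' W) = 0 := by
    rw [S.classMeasure_apply (hf hW)]
    exact S.setLIntegral_preimage_null hW h0
  filter_upwards [compl_mem_ae_iff.2 hnull] with z hz x hx hxW
  subst hx
  exact hz hxW

theorem ae_encard_fiber (S : JacobianSetting μ ν Q p K u g J) :
    ∀ᵐ z ∂classMeasure μ J h, (proj h ⁻¹' {z}).encard = 1 := by
  obtain ⟨W, hW, hW0, hinj⟩ := S.exists_null_forall_eq h
  filter_upwards [S.ae_factor_notMem hW hW0] with z hz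
  obtain ⟨x, rfl⟩ := proj_surjective h z
  refine encard_eq_one.2 ⟨x, ?_⟩
  ext x'
  exact ⟨fun hx' => (hinj x x' (hz x rfl) hx'.symm).symm, fun hx' => by rw [hx']; rfl⟩

/-- Away from `u⁻¹(W)`, which carries no `J μ`-mass, the projection is injective. The image of the
remaining part `E₀` is Borel by the Lusin–Souslin theorem, its preimage is `E₀` again, and its
indicator equals the multiplicity almost everywhere. -/
theorem hasLocIntJacobian_proj (S : JacobianSetting μ ν Q p K u g J) :
    HasLocIntJacobian μ (classMeasure μ J h) (proj h) J := by
  have := S.metricMeasure.proper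
  have hP := S.continuous_proj h
  refine ⟨hP.measurable, S.jacobian.measurable, fun E hE => ?_, S.jacobian.locallyIntegrable⟩
  obtain ⟨W, hW, hW0, hinj⟩ := S.exists_null_forall_eq h
  set E₀ := E ∩ (u ⁻¹' W)ᶜ with hE₀
  have hWm : MeasurableSet (u ⁻¹' W) := S.continuous.measurable hW
  have hE₀m : MeasurableSet E₀ := hE.inter hWm.compl
  have himage : MeasurableSet (proj h '' E₀) :=
    hE₀m.image_of_continuousOn_injOn hP.continuousOn fun x hx x' _ heq => hinj x x' hx.2 heq
  have hpre : proj h ⁻¹' (proj h '' E₀) = E₀ := by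
    refine subset_antisymm ?_ (subset_preimage_image _ _)
    rintro x ⟨x', hx', heq⟩
    rwa [← hinj x' x hx'.2 heq]
  have h1 : ∫⁻ x in E, J x ∂μ = ∫⁻ x in E₀, J x ∂μ := by
    rw [← lintegral_inter_add_sdiff J E hWm, hE₀, sdiff_eq]
    have : ∫⁻ x in E ∩ u ⁻¹' W, J x ∂μ = 0 :=
      le_antisymm ((lintegral_mono_set inter_subset_right).trans
        (S.setLIntegral_preimage_null hW hW0).le) bot_le
    rw [this, zero_add]
  calc ∫⁻ x in E, J x ∂μ = classMeasure μ J h (proj h '' E₀) := by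
        rw [S.classMeasure_apply himage, hpre, h1]
    _ = ∫⁻ z, (proj h '' E₀).indicator 1 z ∂classMeasure μ J h :=
        (lintegral_indicator_one himage).symm
    _ = _ := lintegral_congr_ae ?_
  filter_upwards [S.ae_factor_notMem hW hW0] with z hz
  by_cases hzE : z ∈ proj h '' E₀
  · rw [indicator_of_mem hzE]
    obtain ⟨x, hx, rfl⟩ := hzE
    have : proj h ⁻¹' {proj h x} ∩ E = {x} := by
      ext x'
      constructor
      · rintro ⟨hx', -⟩
        exact (hinj x x' hx.2 (Eq.symm hx')).symm
      · rintro rfl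
        exact ⟨rfl, hx.1⟩
    rw [this, encard_singleton]
    simp
  · rw [indicator_of_notMem hzE]
    have : proj h ⁻¹' {z} ∩ E = ∅ := by
      ext x
      simp only [mem_inter_iff, mem_preimage, mem_singleton_iff, mem_empty_iff_false, iff_false]
      rintro ⟨hx, hxE⟩
      exact hzE ⟨x, ⟨hxE, hz x hx⟩, hx⟩
    simp [this]

end JacobianSetting

end Classes


/-! ## Positivity of the measure of balls -/

section Positivity

variable {X Y : Type*} [MetricSpace X] [MeasurableSpace X] [BorelSpace X] [MetricSpace Y]
  {μ : Measure X} {Q p : ℝ} {u : X → Y} {g : X → ℝ≥0∞}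

theorem lineIntegral_one (γ : Curve X) : lineIntegral (fun _ => 1) γ = curveLength γ := by
  by_cases hγ : curveLength γ = ∞
  · rw [lineIntegral_eq_top hγ, hγ]
  · rw [lineIntegral_eq hγ measurable_const, lintegral_one, lenMeas_univ hγ]

namespace SobolevSetting

/-- Applied to the identity, the curve construction yields curves that are short in `X` itself and
hence stay in a prescribed open set. -/
theorem id (S : SobolevSetting μ Q p u g) :
    SobolevSetting μ Q p (fun x : X => x) (fun _ => 1) where
  metricMeasure := S.metricMeasure
  doubling := S.doubling
  one_le := S.one_le
  lt := S.lt
  volume := S.volume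
  poincare := S.poincare
  nontrivial := S.nontrivial
  weakUpperGradient := by
    refine ⟨measurable_const, ∅, modulus_empty μ (S.pos.trans S.lt), fun γ _ => ?_⟩
    rw [UpperGradientAlong, lineIntegral_one]
    exact eVariationOn.edist_le γ (mem_univ _) (mem_univ _)
  locallyLp := fun x => ⟨_, Metric.ball_mem_nhds x one_pos, by
    simpa using S.metricMeasure.ball_lt_top x 1 one_pos⟩

/-- Nearby points off a null set are joined by curves short enough to remain in `O`. Almost every
such curve meets the exceptional points of `g` in zero length, so the integral of `g` along it, and
with it the `u`-length, vanishes. -/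
theorem essDist_eq_zero_of_ae (S : SobolevSetting μ Q p u g) {O : Set X} (hO : IsOpen O)
    (h0 : ∀ᵐ x ∂μ, x ∈ O → g x = 0) {x : X} (hx : x ∈ O) :
    ∃ δ > 0, ∀ y, dist y x < δ → essDist μ Q u x y = 0 := by
  obtain ⟨R, hR, hRO⟩ := Metric.isOpen_iff.1 hO x hx
  obtain ⟨δ, hδ, hδ'⟩ := S.id.exists_small_curve
  set ε : ℝ≥0 := (R / 2).toNNReal with hε
  have hε0 : 0 < ε := Real.toNNReal_pos.2 (half_pos hR)
  refine ⟨min (δ x ε) (R / 2), lt_min (hδ x ε hε0) (half_pos hR), fun y hy => ?_⟩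
  refine le_antisymm (essDist_le S.pos (sub_pos.2 hy) fun t ht htle ρ hρ => ?_) bot_le
  obtain ⟨ρu, hρu, hu⟩ := exists_testDensity_weakUpperGradient S.metricMeasure S.pos S.lt.le
    S.weakUpperGradient S.locallyLp
  obtain ⟨ρ₀, hρ₀, h₀⟩ := exists_testDensity_null S.pos h0
  obtain ⟨ρ₁, hρ₁, h₁⟩ := exists_testDensity_pair S.pos hρ hρu
  obtain ⟨ρ₂, hρ₂, h₂⟩ := exists_testDensity_pair S.pos hρ₁ hρ₀
  obtain ⟨N, hN, H⟩ := hδ' ρ₂ hρ₂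
  obtain ⟨z₁, hz₁, hN₁⟩ := S.metricMeasure.exists_mem_ball_notMem hN x ht
  obtain ⟨z₂, hz₂, hN₂⟩ := S.metricMeasure.exists_mem_ball_notMem hN y ht
  have hd : (0 : ℝ) ≤ dist y x := dist_nonneg
  have e1 := Metric.mem_ball.1 hz₁
  have e2 := Metric.mem_ball.1 hz₂
  have e3 := dist_triangle z₂ y x
  have e4 := min_le_left (δ x ε) (R / 2)
  have e5 := min_le_right (δ x ε) (R / 2)
  obtain ⟨γ, γ0, γ1, hfin, hle⟩ := H x ε hε0 z₁ (Metric.mem_closedBall.2 (by linarith)) z₂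
    (Metric.mem_closedBall.2 (by linarith)) hN₁ hN₂
  obtain ⟨hfin₁, hfin₀⟩ := h₂ γ hfin
  obtain ⟨hfinρ, hfinu⟩ := h₁ γ hfin₁
  refine ⟨γ, γ0 ▸ Metric.ball_subset_closedBall hz₁, γ1 ▸ Metric.ball_subset_closedBall hz₂, hfinρ,
    ?_⟩
  obtain ⟨hgfin, hlen⟩ := hu γ hfinu
  refine (curveLength_le_lineIntegral_of_forall S.weakUpperGradient.1 hgfin hlen).trans ?_
  rw [lineIntegral_eq (rectifiable_of_lineIntegral_ne_top hfin) S.weakUpperGradient.1]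
  refine le_of_eq (lintegral_eq_zero_of_ae_eq_zero ?_)
  filter_upwards [h₀ γ hfin₀] with s hs
  have hs : ¬ ¬ (γ s ∈ O → g (γ s) = 0) := hs
  refine not_not.1 hs (hRO ?_)
  have hes : edist (γ s) (γ 0) ≤ ENNReal.ofReal (R / 2) :=
    (eVariationOn.edist_le γ (mem_univ _) (mem_univ _)).trans hle
  rw [edist_le_ofReal (half_pos hR).le, γ0] at hes
  have := dist_triangle (γ s) z₁ x
  exact Metric.mem_ball.2 (by linarith)

end SobolevSetting

variable [MeasurableSpace Y] [BorelSpace Y] {ν : Measure Y} {K : ℝ} {J : X → ℝ≥0∞}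
  {h : IsFinitePseudoDist (essDist μ Q u)}

namespace JacobianSetting

/-- If the measure vanished, so would `J` and, by the distortion inequality, `g` almost everywhere
over the ball. The projection would be locally constant there, the fibre of `z` open and closed, and
`u` constant by connectedness. -/
theorem classMeasure_ball_pos (S : JacobianSetting μ ν Q p K u g J) (z : QuotientSpace h) {r : ℝ}
    (hr : 0 < r) : 0 < classMeasure μ J h (Metric.ball z r) := by
  by_contra! hle
  have hP := S.continuous_proj h
  have := S.nontrivial
  have := connectedSpace_of_poincare S.metricMeasure S.doubling S.one_le S.poincare
  set O := proj h ⁻¹' Metric.ball z r with hOdef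
  have hO : IsOpen O := Metric.isOpen_ball.preimage hP
  have hJ0 : ∀ᵐ x ∂μ, x ∈ O → J x = 0 := by
    rw [← ae_restrict_iff' hO.measurableSet]
    have h0 := le_antisymm hle bot_le
    rw [S.classMeasure_apply Metric.isOpen_ball.measurableSet] at h0
    exact (lintegral_eq_zero_iff S.jacobian.measurable).1 h0
  have hg0 : ∀ᵐ x ∂μ, x ∈ O → g x = 0 := by
    filter_upwards [hJ0, S.distortion] with x hx hx' hxO
    rw [hx hxO, mul_zero, nonpos_iff_eq_zero] at hx'
    exact (ENNReal.rpow_eq_zero_iff_of_pos S.pos).1 hx'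
  have hopen : IsOpen (proj h ⁻¹' {z}) := by
    refine Metric.isOpen_iff.2 fun x hx => ?_
    have hxz : proj h x = z := hx
    obtain ⟨δ, hδ, H⟩ := S.essDist_eq_zero_of_ae hO hg0 (x := x)
      (show proj h x ∈ Metric.ball z r by rw [hxz]; exact Metric.mem_ball_self hr)
    refine ⟨δ, hδ, fun y hy => ?_⟩
    exact ((proj_eq_iff h x y).2 (H y hy)).symm.trans hxz
  obtain ⟨x, rfl⟩ := proj_surjective h z
  have huniv := IsClopen.eq_univ ⟨isClosed_singleton.preimage hP, hopen⟩ ⟨x, rfl⟩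
  obtain ⟨a, b, hab⟩ := S.nonconstant
  have hpa : a ∈ proj h ⁻¹' {proj h x} := by rw [huniv]; trivial
  have hpb : b ∈ proj h ⁻¹' {proj h x} := by rw [huniv]; trivial
  exact hab (edist_le_zero.1 ((S.edist_le a b).trans
    ((proj_eq_iff h a b).1 (Eq.trans hpa (Eq.symm hpb))).le))

theorem isMetricMeasureSpace (S : JacobianSetting μ ν Q p K u g J) :
    IsMetricMeasureSpace (classMeasure μ J h) where
  proper := S.properSpace h
  ball_pos := fun z _ hr => S.classMeasure_ball_pos z hr
  ball_lt_top := fun z r _ => by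
    rw [S.classMeasure_apply Metric.isOpen_ball.measurableSet]
    refine lt_of_le_of_lt (lintegral_mono_set (preimage_mono Metric.ball_subset_closedBall)) ?_
    exact (S.setLIntegral_jacobian_ne_top (S.isCompact_preimage_closedBall h z r)).lt_top

end JacobianSetting

end Positivity

/-! ## The Sobolev-to-Lipschitz property -/

section SobolevToLipschitz

theorem exists_testDensity_edist_le_curveLength {Z E : Type*} [MetricSpace Z] [MeasurableSpace Z]
    [BorelSpace Z] [MetricSpace E] {m : Measure Z} {Q : ℝ} (hQ : 0 < Q) {f : Z → E} {g : Z → ℝ≥0∞}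
    (hg : IsWeakUpperGradient m Q f g) (hle : ∀ᵐ z ∂m, g z ≤ 1) :
    ∃ ρ, IsTestDensity m Q ρ ∧ ∀ γ : Curve Z, lineIntegral ρ γ ≠ ∞ →
      edist (f (γ 1)) (f (γ 0)) ≤ curveLength γ := by
  obtain ⟨hgm, Γ₀, hΓ₀, hug⟩ := hg
  obtain ⟨ρ₁, hm, hint, h₁⟩ := exists_of_modulus_eq_zero hQ hΓ₀
  obtain ⟨ρ₂, hρ₂, h₂⟩ := exists_testDensity_null hQ hle
  obtain ⟨ρ, hρ, H⟩ := exists_testDensity_pair hQ ⟨hm, hint⟩ hρ₂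
  refine ⟨ρ, hρ, fun γ hγ => ?_⟩
  obtain ⟨hγ₁, hγ₂⟩ := H γ hγ
  refine (hug γ fun hmem => hγ₁ (h₁ γ hmem)).trans ?_
  have hrect := rectifiable_of_lineIntegral_ne_top hγ
  rw [lineIntegral_eq hrect hgm, ← lineIntegral_one, lineIntegral_eq hrect measurable_const]
  refine lintegral_mono_ae ?_
  filter_upwards [h₂ γ hγ₂] with t ht
  exact not_not.1 ht

variable {X Y : Type*} [MetricSpace X] [MeasurableSpace X] [BorelSpace X] [MetricSpace Y]
  {μ : Measure X} {Q p : ℝ} {u : X → Y} {g : X → ℝ≥0∞} [MeasurableSpace Y] [BorelSpace Y]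
  {ν : Measure Y} {K : ℝ} {J : X → ℝ≥0∞} {h : IsFinitePseudoDist (essDist μ Q u)}

namespace JacobianSetting

/-- The distortion inequality enters here: the integral of `(ρ ∘ P)^Q g^Q` is at most `K` times that
of `(ρ ∘ P)^Q J`, which is the integral of `ρ^Q` over the classes. -/
theorem isTestDensity_pullback (S : JacobianSetting μ ν Q p K u g J) {ρ : QuotientSpace h → ℝ≥0∞}
    (hρ : IsTestDensity (classMeasure μ J h) Q ρ) :
    IsTestDensity μ Q (fun x => ρ (proj h x) * g x) := by
  have hP := (S.continuous_proj h).measurable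
  have hρQ : Measurable fun z => ρ z ^ Q := hρ.measurable.pow_const Q
  have hρP : Measurable fun x => ρ (proj h x) ^ Q := hρQ.comp hP
  refine ⟨(hρ.measurable.comp hP).mul S.weakUpperGradient.1, ?_⟩
  have hint := hρ.lintegral_ne_top
  rw [classMeasure, lintegral_map hρQ hP,
    lintegral_withDensity_eq_lintegral_mul _ S.jacobian.measurable hρP] at hint
  refine ne_top_of_le_ne_top (ENNReal.mul_ne_top (ENNReal.ofReal_ne_top (r := K)) hint) ?_
  rw [← lintegral_const_mul _ (S.jacobian.measurable.mul hρP)]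
  refine lintegral_mono_ae ?_
  filter_upwards [S.distortion] with x hx
  rw [ENNReal.mul_rpow_of_nonneg _ _ S.pos.le]
  calc ρ (proj h x) ^ Q * g x ^ Q ≤ ρ (proj h x) ^ Q * (ENNReal.ofReal K * J x) := by gcongr
    _ = _ := by simp only [Pi.mul_apply]; ring

/-- Off an exceptional family, the projection of a curve avoids a given exceptional family and is
not longer than the image of the curve under `u`. -/
theorem exists_testDensity_proj (S : JacobianSetting μ ν Q p K u g J)
    {ρ : QuotientSpace h → ℝ≥0∞} (hρ : IsTestDensity (classMeasure μ J h) Q ρ) :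
    ∃ ρ', IsTestDensity μ Q ρ' ∧ ∀ γ : Curve X, lineIntegral ρ' γ ≠ ∞ →
      ∃ c : Curve (QuotientSpace h), (∀ t, c t = proj h (γ t)) ∧ lineIntegral ρ c ≠ ∞ ∧
        curveLength c ≤ curveLength (u ∘ γ) := by
  have hP := S.continuous_proj h
  have hgm := S.weakUpperGradient.1
  obtain ⟨ρu, hρu, hu⟩ := exists_testDensity_weakUpperGradient S.metricMeasure S.pos S.lt.le
    S.weakUpperGradient S.locallyLp
  obtain ⟨ρD, hρD, hD⟩ := exists_testDensity_essDist_le (u := u) S.metricMeasure S.pos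
  obtain ⟨ρ₁, hρ₁, h₁⟩ := exists_testDensity_pair S.pos hρu hρD
  obtain ⟨ρ₂, hρ₂, h₂⟩ := exists_testDensity_pair S.pos hρ₁ (S.isTestDensity_pullback hρ)
  refine ⟨ρ₂, hρ₂, fun γ hγ => ?_⟩
  obtain ⟨hγ₁, hγρ⟩ := h₂ γ hγ
  obtain ⟨hγu, hγD⟩ := h₁ γ hγ₁
  obtain ⟨hgfin, hlen⟩ := hu γ hγu
  have hrect := rectifiable_of_lineIntegral_ne_top hγ
  let c : Curve (QuotientSpace h) := ⟨fun t => proj h (γ t), hP.comp γ.continuous⟩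
  have hcu : ∀ s t, s ≤ t → edist (c s) (c t) ≤ eVariationOn (u ∘ γ) (Icc s t) := by
    intro s t hst
    have hfin := ne_top_of_le_ne_top hγD (lineIntegral_affineSub_le γ hst hρD.measurable)
    have hle := hD _ hfin
    rw [← edist_proj h] at hle
    refine le_trans (le_of_eq ?_) (hle.trans (le_of_eq ?_))
    · simp [c, affineSub_zero, affineSub_one]
    · exact curveLength_affineSub (u ∘ γ) hst
  set M := (lenMeas γ).withDensity fun r => g (γ r) with hM
  have hMat : ∀ t, M {t} = 0 := fun t =>
    withDensity_absolutelyContinuous _ _ (lenMeas_singleton hrect t)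
  have hMfin : IsFiniteMeasure M := isFiniteMeasure_withDensity (by
    rwa [lineIntegral_eq hrect hgm] at hgfin)
  have hcM : ∀ s t, eVariationOn c (Icc s t) ≤ M (Icc s t) := fun s t =>
    eVariationOn_le_measure hMat fun a b hab _ _ => by
      rw [hM, withDensity_apply _ measurableSet_Icc]
      exact (hcu a b hab).trans (hlen a b hab)
  have huniv : Icc (0 : unitInterval) 1 = univ := Icc_bot_top
  have hc : curveLength c ≠ ∞ := by
    have := hcM 0 1
    rw [huniv] at this
    exact ne_top_of_le_ne_top (measure_ne_top M univ) this
  -- The projected curve has speed at most `g` with respect to arc length of `γ`, so its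
  -- `ρ`-integral is at most the integral of `(ρ ∘ P) g` along `γ`.
  have hcle : lenMeas c ≤ M := measure_le_of_Icc_le hMat one_pos fun s t hst _ => by
    rw [lenMeas_Icc hc hst]
    exact hcM s t
  refine ⟨c, fun t => rfl, ?_, ?_⟩
  · rw [lineIntegral_eq hc hρ.measurable]
    have hgγ : Measurable fun t => g (γ t) := hgm.comp γ.continuous.measurable
    have hρc : Measurable fun t => ρ (c t) := hρ.measurable.comp c.continuous.measurable
    refine ne_top_of_le_ne_top ?_ (lintegral_mono' hcle le_rfl)
    rw [hM, lintegral_withDensity_eq_lintegral_mul _ hgγ hρc]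
    rw [lineIntegral_eq hrect (S.isTestDensity_pullback hρ).measurable] at hγρ
    refine ne_of_eq_of_ne (lintegral_congr fun t => ?_) hγρ
    exact mul_comm _ _
  · let v : Curve Y := ⟨u ∘ γ, S.continuous.comp γ.continuous⟩
    have hv : curveLength v ≠ ∞ :=
      ne_top_of_le_ne_top hgfin (curveLength_le_lineIntegral_of_forall hgm hgfin hlen)
    have := eVariationOn_le_measure (M := lenMeas v) (c := c) (s := 0) (t := 1)
      (lenMeas_singleton hv) fun a b hab _ _ => by
        rw [lenMeas_Icc hv hab]
        exact hcu a b hab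
    rwa [huniv, lenMeas_univ hv] at this

/-- Off the null set, `x` and `y` themselves can be joined to the endpoints of a nearly optimal
curve by curves of small `u`-length, so the estimate along curves yields one at the points. -/
theorem exists_null_edist_le_essDist (S : JacobianSetting μ ν Q p K u g J) {E : Type*}
    [MetricSpace E] {F : X → E} {ρ : X → ℝ≥0∞} (hρ : IsTestDensity μ Q ρ)
    (hF : ∀ γ : Curve X, lineIntegral ρ γ ≠ ∞ →
      edist (F (γ 1)) (F (γ 0)) ≤ curveLength (u ∘ γ)) :
    ∃ N, μ N = 0 ∧ ∀ x y, x ∉ N → y ∉ N → edist (F x) (F y) ≤ essDist μ Q u x y := by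
  obtain ⟨δ, hδ, hδ'⟩ := S.exists_small_curve
  obtain ⟨N, hN, H⟩ := hδ' ρ hρ
  refine ⟨N, hN, fun x y hx hy => ?_⟩
  rcases eq_or_ne x y with rfl | hxy
  · simp
  refine ENNReal.le_of_forall_pos_le_add fun ε hε _ => ?_
  have hε3 : 0 < ε / 3 := by positivity
  have hε3' : ((ε / 3 : ℝ≥0) : ℝ≥0∞) ≠ 0 := by exact_mod_cast hε3.ne'
  have hx0 := hδ x _ hε3
  have hy0 := hδ y _ hε3
  obtain ⟨γ, h0, h1, hN0, hN1, hfin, hlen⟩ := exists_curve_of_essDist_lt S.pos hxy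
    (ENNReal.lt_add_right (S.essDist_ne_top x y) hε3') hρ hN (lt_min hx0 hy0)
  obtain ⟨a, a0, a1, afin, alen⟩ := H x _ hε3 (γ 0)
    (Metric.closedBall_subset_closedBall (min_le_left _ _) h0) x
    (Metric.mem_closedBall_self hx0.le) hN0 hx
  obtain ⟨b, b0, b1, bfin, blen⟩ := H y _ hε3 y (Metric.mem_closedBall_self hy0.le) (γ 1)
    (Metric.closedBall_subset_closedBall (min_le_right _ _) h1) hy hN1
  have e1 := (hF a afin).trans alen
  have e2 := (hF γ hfin).trans hlen
  have e3 := (hF b bfin).trans blen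
  rw [a0, a1] at e1
  rw [edist_comm] at e2
  rw [b0, b1] at e3
  calc edist (F x) (F y) ≤ edist (F x) (F (γ 0)) + edist (F (γ 0)) (F (γ 1)) +
        edist (F (γ 1)) (F y) := edist_triangle4 _ _ _ _
    _ ≤ (ε / 3 : ℝ≥0) + (essDist μ Q u x y + (ε / 3 : ℝ≥0)) + (ε / 3 : ℝ≥0) := by gcongr
    _ = essDist μ Q u x y + ((ε / 3 : ℝ≥0) + (ε / 3 : ℝ≥0) + (ε / 3 : ℝ≥0) : ℝ≥0) := by
        push_cast; ring
    _ = _ := by rw [add_thirds]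

/-- A class all of whose points lie in `N` pulls back into the union of `u⁻¹(W)` and a null set,
where `J μ` vanishes. Injectivity off `u⁻¹(W)` makes the good classes a Borel set. -/
theorem ae_exists_notMem (S : JacobianSetting μ ν Q p K u g J) {N : Set X} (hN : μ N = 0) :
    ∀ᵐ z ∂classMeasure μ J h, ∃ x, proj h x = z ∧ x ∉ N := by
  have := S.metricMeasure.proper
  have hP := S.continuous_proj h
  obtain ⟨W, hW, hW0, hinj⟩ := S.exists_null_forall_eq h
  have hWm : MeasurableSet (u ⁻¹' W) := S.continuous.measurable hW
  have hNm := measurableSet_toMeasurable μ N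
  have himage : MeasurableSet (proj h '' (u ⁻¹' W ∪ toMeasurable μ N)ᶜ) :=
    (hWm.union hNm).compl.image_of_continuousOn_injOn hP.continuousOn fun x hx x' _ heq =>
      hinj x x' (fun hxW => hx (Or.inl hxW)) heq
  have hnull : classMeasure μ J h (proj h '' (u ⁻¹' W ∪ toMeasurable μ N)ᶜ)ᶜ = 0 := by
    rw [S.classMeasure_apply himage.compl]
    have hsub : proj h ⁻¹' (proj h '' (u ⁻¹' W ∪ toMeasurable μ N)ᶜ)ᶜ ⊆
        u ⁻¹' W ∪ toMeasurable μ N := by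
      intro x hx
      by_contra hcon
      exact hx ⟨x, hcon, rfl⟩
    refine le_antisymm ((lintegral_mono_set hsub).trans ((lintegral_union_le _ _ _).trans ?_))
      bot_le
    rw [S.setLIntegral_preimage_null hW hW0, zero_add,
      setLIntegral_measure_zero _ _ ((measure_toMeasurable N).trans hN)]
  filter_upwards [compl_mem_ae_iff.2 hnull] with z hz
  obtain ⟨x, hx, rfl⟩ := not_not.1 hz
  exact ⟨x, rfl, fun hxN => hx (Or.inr (subset_toMeasurable μ N hxN))⟩

theorem sobolevToLipschitz (S : JacobianSetting μ ν Q p K u g J) :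
    SobolevToLipschitz (classMeasure μ J h) Q := by
  intro f gf _ hgf hle
  obtain ⟨ρ, hρ, hf⟩ := exists_testDensity_edist_le_curveLength S.pos hgf.weakUpperGradient hle
  obtain ⟨ρ', hρ', H⟩ := S.exists_testDensity_proj hρ
  obtain ⟨N, hN, hF⟩ := S.exists_null_edist_le_essDist (F := fun x => f (proj h x)) hρ'
    fun γ hγ => by
      obtain ⟨c, hc, hfin, hlen⟩ := H γ hγ
      have := (hf c hfin).trans hlen
      rwa [hc, hc] at this
  have hlip : LipschitzOnWith 1 f {z | ∃ x, proj h x = z ∧ x ∉ N} := by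
    rintro _ ⟨x, rfl, hx⟩ _ ⟨y, rfl, hy⟩
    rw [edist_proj, ENNReal.coe_one, one_mul]
    exact hF x y hx hy
  -- McShane's extension from the set of classes having a representative off `N`, which has full
  -- measure.
  obtain ⟨f', hf', heq⟩ := hlip.extend_real
  refine ⟨f', hf', ?_⟩
  filter_upwards [S.ae_exists_notMem hN] with z hz
  exact heq hz

end JacobianSetting

end SobolevToLipschitz

end

end EssPullback

theorem mainTheorem9 {X Y : Type*}
    [MetricSpace X] [MeasurableSpace X] [BorelSpace X]
    [MetricSpace Y] [MeasurableSpace Y] [BorelSpace Y]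
    (μ : Measure X) (ν : Measure Y) (Q p K : ℝ)
    (hX : IsMetricMeasureSpace μ) (hdoubling : IsDoubling μ)
    (hQ : 1 ≤ Q) (hvol : RelativeVolumeLowerBound μ Q) (hpoincare : SupportsPoincare μ Q)
    (hY : IsMetricMeasureSpace ν)
    (hp : Q < p) (u : X → Y) (hu : IsLocallyNewtonian μ p u) (hcont : Continuous u)
    (hproper : ∀ C : Set Y, IsCompact C → IsCompact (u ⁻¹' C))
    (hnonconst : ∃ x y : X, u x ≠ u y)
    (gu : X → ℝ≥0∞) (hgu : IsMinimalWeakUpperGradient μ p u gu)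
    (Ju : X → ℝ≥0∞) (hJu : HasLocIntJacobian μ ν u Ju)
    (hK : 1 ≤ K) (hqr : ∀ᵐ x ∂μ, gu x ^ Q ≤ ENNReal.ofReal K * Ju x) :
    -- the essential pull-back distance is a finite pseudometric, so that `Y_u` is defined
    ∃ h : IsFinitePseudoDist (essDist μ Q u),
    -- the pull-back measure `ν_u` on `Y_u` exists
    ∃ νu : Measure (QuotientSpace h),
      IsPullbackMeasure ν
        (factor h u (edist_le_essDist μ (lt_of_lt_of_le one_pos hQ) hcont)) νu ∧
      IsMetricMeasureSpace νu ∧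
      SobolevToLipschitz νu Q ∧
      HasLocIntJacobian μ νu (proj h) Ju ∧
      ∀ᵐ z ∂νu, (proj h ⁻¹' {z}).encard = 1 := by
  have : Nontrivial X := by
    obtain ⟨x, y, hxy⟩ := hnonconst
    exact ⟨x, y, fun h => hxy (congrArg u h)⟩
  have S : JacobianSetting μ ν Q p K u gu Ju :=
    { metricMeasure := hX, doubling := hdoubling, one_le := hQ, lt := hp, volume := hvol
      poincare := hpoincare, nontrivial := this, weakUpperGradient := hgu.weakUpperGradient
      locallyLp := hgu.locallyLp, target := hY, continuous := hcont
      isCompact_preimage := hproper, nonconstant := hnonconst, jacobian := hJu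
      distortion := hqr }
  exact ⟨S.isFinitePseudoDist, classMeasure μ Ju S.isFinitePseudoDist, S.isPullbackMeasure _,
    S.isMetricMeasureSpace, S.sobolevToLipschitz, S.hasLocIntJacobian_proj, S.ae_encard_fiber⟩
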